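/- Let $n\ge 3$ be finite. $\mathsf{CA}_n$ is the class of cylindric algebras of dimension $n$ (Boolean algebras with cylindrifications $\mathsf c_i$ and diagonals $\mathsf d_{ij}$, $i,j<n$, satisfying the usual axioms). For $\mathfrak B\in\mathsf{CA}_{n+k}$, $\mathfrak{Nr}_n\mathfrak B$ is the algebra of dimension $n$ whose universe is $\{x\in\mathfrak B:\mathsf c_jx=x \text{ for all } n\le j<n+k\}$, with the operations of $\mathfrak B$ indexed by $i,j<n$; $S\mathsf{Nr}_n\mathsf{CA}_{n+k}$ is the class of all algebras embeddable into some $\mathfrak{Nr}_n\mathfrak B$, $\mathfrak B\in\mathsf{CA}_{n+k}$. $\mathsf{RCA}_n$ (the representable algebras) is the class of all algebras embeddable into a product of full cylindric set algebras $\wp({}^nU)$. The atom structure of an atomic $\mathfrak A$ is $\mathrm{At}\,\mathfrak A=(\text{atoms},T_i,E_{ij})$ with $T_i(a,b)$ iff $a\le \mathsf c_ib$ and $E_{ij}(a)$ iff $a\le\mathsf d_{ij}$; $\mathfrak{Cm}$ denotes the complex algebra of an atom structure. A class $\mathsf K$ is atom-canonical if $\mathfrak{Cm}\,\mathrm{At}\,\mathfrak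 A\in\mathsf K$ for every atomic $\mathfrak A\in\mathsf K$. A completion of $\mathfrak A$ is a $\mathsf{CA}_n$ that is complete as a Boolean algebra and has $\mathfrak A$ as a dense subalgebra (below every nonzero element there is a nonzero element of the subalgebra); $\mathsf K$ is closed under completions if it contains all completions of its members. $\mathsf K$ is Sahlqvist axiomatizable if, among the algebras in $\mathsf{CA}_n$, its members are exactly the models of some set of Sahlqvist equations, i.e. equations $t=1$ with $t$ a Sahlqvist formula in the usual modal sense, the diamonds being the $\mathsf c_i$ and the constants the $\mathsf d_{ij}$. A relativized representation of $\mathfrak A\in\mathsf{CA}_n$ consists of a set $M$, a set $V\subseteq{}^nM$ with $M=\bigcup_{s\in V}\mathrm{rng}(s)$, and an injective homomorphism $f:\mathfrak A\to\wp(V)$, where $\wp(V)$ carries the Boolean set operations, $\mathsf c_iX=\{s\in V:\exists t\in X,\ t_j=s_j \text{ for all } j\ne i\}$ and $\mathsf d_{ij}=\{s\in V:s_i=s_j\}$. It is complete if $f(\sum X)=\bigcup_{x\in X}f(x)$ whenever $\sum X$ exists in $\mathfrak A$. A set $C\subseteq M$ is a clique if ${}^nC\subseteq V$. The representation is $m$-square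 ($m\geq n$) if for all $s\in{}^mM$ with $\mathrm{rng}(s)$ a clique, all injective $l:n\to m$, all $i<n$ and all $a\in\mathfrak A$ with $s\circ l\in f(\mathsf c_ia)$, there is $t\in{}^mM$ with $\mathrm{rng}(t)$ a clique, $t_j=s_j$ for all $j\neq l(i)$, and $t\circ l\in f(a)$. Then: 1. There are two atomic algebras in $\mathsf{CA}_n$ with isomorphic atom structures, one of which is representable while the other is not representable and not even in $S\mathsf{Nr}_n\mathsf{CA}_{n+4}$. 2. For every finite $k\ge4$, the class $S\mathsf{Nr}_n\mathsf{CA}_{n+k}$ is not closed under completions and is not atom-canonical. Also, $\mathsf{RCA}_n$ is not atom-canonical. 3. There is a non-representable $\mathsf{CA}_n$, not even in $S\mathsf{Nr}_n\mathsf{CA}_{n+4}$, that has a dense representable subalgebra. 4. For every finite $k\ge4$, $S\mathsf{Nr}_n\mathsf{CA}_{n+k}$ is not Sahlqvist axiomatizable. Also, $\mathsf{RCA}_n$ is not Sahlqvist axiomatizable. 5. There is an atomic representable $\mathsf{CA}_n$ that, for every finite $k\ge4$, has no complete relativized $(n+k)$-square representation. -/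

import Mathlib

universe u

/-- Algebras of the similarity type of `CA_n`: a Boolean algebra with unary operations `c_i`
and constants `d_ij`, for `i, j < n`. The cylindric laws are imposed by `CylAlg.IsCA`. -/
structure CylAlg (n : ℕ) where
  carrier : Type u
  [boolAlg : BooleanAlgebra carrier]
  cyl : Fin n → carrier → carrier
  diag : Fin n → Fin n → carrier

/-- Relational structures of the similarity type of `CA_n` atom structures. -/
structure AtomStr (n : ℕ) where
  carrier : Type u
  T : Fin n → carrier → carrier → Prop
  E : Fin n → Fin n → carrier → Prop

namespace CylAlg

instance instCoeSortCylAlg (n : ℕ) : CoeSort (CylAlg.{u} n) (Type u) := ⟨CylAlg.carrier⟩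

instance instBooleanAlgebraCylAlg {n : ℕ} (A : CylAlg.{u} n) : BooleanAlgebra A.carrier :=
  A.boolAlg

/-- The class `CA_n` of cylindric algebras of dimension `n`. -/
structure IsCA {n : ℕ} (A : CylAlg.{u} n) : Prop where
  cyl_bot : ∀ i, A.cyl i ⊥ = ⊥
  le_cyl : ∀ i x, x ≤ A.cyl i x
  cyl_inf_cyl : ∀ i x y, A.cyl i (x ⊓ A.cyl i y) = A.cyl i x ⊓ A.cyl i y
  cyl_comm : ∀ i j x, A.cyl i (A.cyl j x) = A.cyl j (A.cyl i x)
  diag_self : ∀ i, A.diag i i = ⊤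
  diag_eq : ∀ i j k, k ≠ i → k ≠ j → A.diag i j = A.cyl k (A.diag i k ⊓ A.diag k j)
  cyl_diag_disjoint : ∀ i j, i ≠ j → ∀ x,
    A.cyl i (A.diag i j ⊓ x) ⊓ A.cyl i (A.diag i j ⊓ xᶜ) = ⊥

namespace IsCA

variable {n : ℕ} {A : CylAlg.{u} n}

theorem cyl_cyl (h : A.IsCA) (i : Fin n) (x : A) : A.cyl i (A.cyl i x) = A.cyl i x := by
  have h1 := h.cyl_inf_cyl i ⊤ x
  have h2 : A.cyl i ⊤ = ⊤ := top_le_iff.mp (h.le_cyl i ⊤)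
  rw [h2] at h1
  simpa using h1

theorem fixed_inf (h : A.IsCA) {i : Fin n} {x y : A} (hx : A.cyl i x = x) (hy : A.cyl i y = y) :
    A.cyl i (x ⊓ y) = x ⊓ y := by
  have h1 := h.cyl_inf_cyl i x y
  rwa [hx, hy] at h1

theorem fixed_compl (h : A.IsCA) {i : Fin n} {x : A} (hx : A.cyl i x = x) :
    A.cyl i xᶜ = xᶜ := by
  have h1 := h.cyl_inf_cyl i xᶜ x
  rw [hx, compl_inf_eq_bot, h.cyl_bot] at h1
  exact le_antisymm (disjoint_iff.mpr h1.symm).le_compl_right (h.le_cyl i xᶜ)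

theorem fixed_sup (h : A.IsCA) {i : Fin n} {x y : A} (hx : A.cyl i x = x) (hy : A.cyl i y = y) :
    A.cyl i (x ⊔ y) = x ⊔ y := by
  have h1 := h.fixed_compl (h.fixed_inf (h.fixed_compl hx) (h.fixed_compl hy))
  simpa using h1

theorem fixed_diag (h : A.IsCA) {i j k : Fin n} (hi : k ≠ i) (hj : k ≠ j) :
    A.cyl k (A.diag i j) = A.diag i j := by
  rw [h.diag_eq i j k hi hj, h.cyl_cyl]

end IsCA

/-- Injective homomorphisms (preservation of joins and complements gives all Boolean
operations). -/
structure IsEmbedding {n : ℕ} {A B : CylAlg.{u} n} (f : A → B) : Prop where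
  injective : Function.Injective f
  map_sup : ∀ x y, f (x ⊔ y) = f x ⊔ f y
  map_compl : ∀ x, f xᶜ = (f x)ᶜ
  map_cyl : ∀ i x, f (A.cyl i x) = B.cyl i (f x)
  map_diag : ∀ i j, f (A.diag i j) = B.diag i j

/-- Subalgebras. -/
structure Sub {n : ℕ} (A : CylAlg.{u} n) extends BooleanSubalgebra A.carrier where
  cyl_mem : ∀ i, ∀ x ∈ carrier, A.cyl i x ∈ carrier
  diag_mem : ∀ i j, A.diag i j ∈ carrier

/-- A subalgebra, as an algebra. -/
def Sub.toAlg {n : ℕ} {A : CylAlg.{u} n} (S : A.Sub) : CylAlg.{u} n where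
  carrier := S.toBooleanSubalgebra
  cyl i x := ⟨A.cyl i x.1, S.cyl_mem i x.1 x.2⟩
  diag i j := ⟨A.diag i j, S.diag_mem i j⟩

/-- A subalgebra is dense if below each nonzero element there is a nonzero element of it. -/
def Sub.IsDense {n : ℕ} {A : CylAlg.{u} n} (S : A.Sub) : Prop :=
  ∀ x : A, x ≠ ⊥ → ∃ y ∈ S.carrier, y ≠ ⊥ ∧ y ≤ x

/-- The reduct of an algebra of dimension `n + k` to the first `n` dimensions. -/
def reduct {n k : ℕ} (B : CylAlg.{u} (n + k)) : CylAlg.{u} n where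
  carrier := B.carrier
  cyl i x := B.cyl (Fin.castAdd k i) x
  diag i j := B.diag (Fin.castAdd k i) (Fin.castAdd k j)

/-- The neat `n`-reduct: the subalgebra of the `n`-dimensional reduct consisting of the elements
`x` with `c_j x = x` for all `n ≤ j < n + k`. -/
def neatSub {n k : ℕ} (B : CylAlg.{u} (n + k)) (hB : B.IsCA) : B.reduct.Sub where
  carrier := {x : B | ∀ j : Fin k, B.cyl (Fin.natAdd n j) x = x}
  supClosed' := fun _ hx _ hy j => hB.fixed_sup (hx j) (hy j)
  infClosed' := fun _ hx _ hy j => hB.fixed_inf (hx j) (hy j)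
  compl_mem' := fun hx j => hB.fixed_compl (hx j)
  bot_mem' := fun j => hB.cyl_bot _
  cyl_mem := fun i x hx j => by
    have h1 := hB.cyl_comm (Fin.natAdd n j) (Fin.castAdd k i) x
    have h2 : B.cyl (Fin.natAdd n j) x = x := hx j
    rw [h2] at h1
    exact h1
  diag_mem := fun i j l => hB.fixed_diag
    (by intro h; have := congrArg Fin.val h; simp at this; omega)
    (by intro h; have := congrArg Fin.val h; simp at this; omega)

/-- `Nr_n B`. -/
def Nr {n k : ℕ} (B : CylAlg.{u} (n + k)) (hB : B.IsCA) : CylAlg.{u} n :=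
  (B.neatSub hB).toAlg

/-- The class `S Nr_n CA_{n+k}`. -/
def InSNr (n k : ℕ) (A : CylAlg.{u} n) : Prop :=
  ∃ (B : CylAlg.{u} (n + k)) (hB : B.IsCA) (f : A → B.Nr hB), IsEmbedding f

/-- The full cylindric set algebra of all `n`-ary relations on `U`. -/
def setAlg (n : ℕ) (U : Type u) : CylAlg.{u} n where
  carrier := Set (Fin n → U)
  cyl i X := {s | ∃ t ∈ X, ∀ j, j ≠ i → t j = s j}
  diag i j := {s | s i = s j}

/-- Direct products. -/
def prod {n : ℕ} {I : Type u} (F : I → CylAlg.{u} n) : CylAlg.{u} n where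
  carrier := ∀ a, (F a).carrier
  cyl i x := fun a => (F a).cyl i (x a)
  diag i j := fun a => (F a).diag i j

/-- The class `RCA_n` of representable algebras: those embeddable into a product of full
cylindric set algebras of dimension `n`. -/
def InRCA (n : ℕ) (A : CylAlg.{u} n) : Prop :=
  ∃ (I : Type u) (U : I → Type u) (f : A → prod (fun a => setAlg n (U a))), IsEmbedding f

/-- The atom structure `At A`. -/
def atomStr {n : ℕ} (A : CylAlg.{u} n) : AtomStr.{u} n where
  carrier := {a : A // IsAtom a}
  T i a b := a.1 ≤ A.cyl i b.1
  E i j a := a.1 ≤ A.diag i j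

end CylAlg

/-- Two atom structures are isomorphic. -/
def AtomStr.Isomorphic {n : ℕ} (F G : AtomStr.{u} n) : Prop :=
  ∃ e : F.carrier ≃ G.carrier,
    (∀ i a b, F.T i a b ↔ G.T i (e a) (e b)) ∧ ∀ i j a, F.E i j a ↔ G.E i j (e a)

/-- The complex algebra `Cm F`. -/
def AtomStr.complexAlg {n : ℕ} (F : AtomStr.{u} n) : CylAlg.{u} n where
  carrier := Set F.carrier
  cyl i X := {a | ∃ b ∈ X, F.T i a b}
  diag i j := {a | F.E i j a}

/-- A class of algebras is atom-canonical if it contains `Cm At A` for each atomic member `A`. -/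
def AtomCanonical {n : ℕ} (K : CylAlg.{u} n → Prop) : Prop :=
  ∀ A : CylAlg.{u} n, K A → IsAtomic A → K A.atomStr.complexAlg

/-- `B` is a (Dedekind–MacNeille, Monk) completion of `A`: a complete cylindric algebra having
(an isomorphic copy of) `A` as a dense subalgebra. -/
def IsCompletionOf {n : ℕ} (B A : CylAlg.{u} n) : Prop :=
  B.IsCA ∧ (∀ X : Set B, ∃ x, IsLUB X x) ∧
    ∃ (S : B.Sub) (f : A → S.toAlg), CylAlg.IsEmbedding f ∧ Function.Surjective f ∧ S.IsDense

/-- A class of algebras is closed under completions. -/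
def ClosedUnderCompletions {n : ℕ} (K : CylAlg.{u} n → Prop) : Prop :=
  ∀ A B : CylAlg.{u} n, K A → IsCompletionOf B A → K B

/-- Terms (equivalently modal formulas) of the signature of `CA_n`. -/
inductive CylTerm (n : ℕ) : Type where
  | var : ℕ → CylTerm n
  | bot : CylTerm n
  | top : CylTerm n
  | diag : Fin n → Fin n → CylTerm n
  | neg : CylTerm n → CylTerm n
  | and : CylTerm n → CylTerm n → CylTerm n
  | or : CylTerm n → CylTerm n → CylTerm n
  | cyl : Fin n → CylTerm n → CylTerm n

namespace CylTerm

variable {n : ℕ}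

/-- The value of a term in an algebra under an assignment. -/
def eval (A : CylAlg.{u} n) (v : ℕ → A) : CylTerm n → A
  | var p => v p
  | bot => ⊥
  | top => ⊤
  | diag i j => A.diag i j
  | neg t => (eval A v t)ᶜ
  | and s t => eval A v s ⊓ eval A v t
  | or s t => eval A v s ⊔ eval A v t
  | cyl i t => A.cyl i (eval A v t)

/-- The equation `t = 1` holds in `A`. -/
def ValidIn (A : CylAlg.{u} n) (t : CylTerm n) : Prop :=
  ∀ v : ℕ → A, eval A v t = ⊤

/-- The dual operator `-c_i-`. -/
def box (i : Fin n) (t : CylTerm n) : CylTerm n := neg (cyl i (neg t))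

/-- The variables occurring in a term. -/
def vars : CylTerm n → Set ℕ
  | var p => {p}
  | bot => ∅
  | top => ∅
  | diag _ _ => ∅
  | neg t => vars t
  | and s t => vars s ∪ vars t
  | or s t => vars s ∪ vars t
  | cyl _ t => vars t

/-- `HasPolarity true t`: each variable of `t` is in the scope of an even number of complement
signs; `HasPolarity false t`: each one is in the scope of an odd number of them. -/
def HasPolarity : Bool → CylTerm n → Prop
  | b, var _ => b = true
  | _, bot => True
  | _, top => True
  | _, diag _ _ => True
  | b, neg t => HasPolarity (!b) t
  | b, and s t => HasPolarity b s ∧ HasPolarity b t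
  | b, or s t => HasPolarity b s ∧ HasPolarity b t
  | b, cyl _ t => HasPolarity b t

/-- Boxed atoms: a variable preceded by finitely many dual operators. -/
inductive IsBoxedAtom : CylTerm n → Prop
  | var (p : ℕ) : IsBoxedAtom (var p)
  | box (i : Fin n) {t : CylTerm n} : IsBoxedAtom t → IsBoxedAtom (box i t)

/-- Sahlqvist antecedents: built from `1`, `0`, boxed atoms and negative terms by means of meets,
joins and the operators `c_i`. -/
inductive IsSahlqvistAntecedent : CylTerm n → Prop
  | top : IsSahlqvistAntecedent top
  | bot : IsSahlqvistAntecedent bot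
  | boxed {t : CylTerm n} : IsBoxedAtom t → IsSahlqvistAntecedent t
  | negative {t : CylTerm n} : HasPolarity false t → IsSahlqvistAntecedent t
  | and {s t : CylTerm n} :
      IsSahlqvistAntecedent s → IsSahlqvistAntecedent t → IsSahlqvistAntecedent (and s t)
  | or {s t : CylTerm n} :
      IsSahlqvistAntecedent s → IsSahlqvistAntecedent t → IsSahlqvistAntecedent (or s t)
  | cyl (i : Fin n) {t : CylTerm n} : IsSahlqvistAntecedent t → IsSahlqvistAntecedent (cyl i t)

/-- Sahlqvist terms: built from Sahlqvist implications (a Sahlqvist antecedent implies a positive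
term) by dual operators, meets, and joins of terms without common variables. -/
inductive IsSahlqvist : CylTerm n → Prop
  | imp {s t : CylTerm n} :
      IsSahlqvistAntecedent s → HasPolarity true t → IsSahlqvist (or (neg s) t)
  | box (i : Fin n) {t : CylTerm n} : IsSahlqvist t → IsSahlqvist (box i t)
  | and {s t : CylTerm n} : IsSahlqvist s → IsSahlqvist t → IsSahlqvist (and s t)
  | or {s t : CylTerm n} :
      IsSahlqvist s → IsSahlqvist t → Disjoint (vars s) (vars t) → IsSahlqvist (or s t)

end CylTerm

/-- A class of cylindric algebras is Sahlqvist axiomatizable if, among cylindric algebras, it is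
the class of all models of a set of equations `t = 1` with `t` a Sahlqvist term. -/
def SahlqvistAxiomatizable {n : ℕ} (K : CylAlg.{u} n → Prop) : Prop :=
  ∃ Γ : Set (CylTerm n), (∀ t ∈ Γ, t.IsSahlqvist) ∧
    ∀ A : CylAlg.{u} n, A.IsCA → (K A ↔ ∀ t ∈ Γ, t.ValidIn A)

/-- The set algebra with unit `V ⊆ ⁿM`: all subsets of `V`, with the operations relativized
to `V`. -/
def CylAlg.relSetAlg (n : ℕ) {M : Type u} (V : Set (Fin n → M)) : CylAlg.{u} n where
  carrier := Set V
  cyl i X := {s | ∃ t ∈ X, ∀ j, j ≠ i → t.1 j = s.1 j}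
  diag i j := {s | s.1 i = s.1 j}

/-- Relativized representations of `A`. -/
structure RelRep {n : ℕ} (A : CylAlg.{u} n) where
  M : Type u
  V : Set (Fin n → M)
  cover : ∀ x : M, ∃ s ∈ V, ∃ i, s i = x
  f : A → CylAlg.relSetAlg n V
  embedding : CylAlg.IsEmbedding f

namespace RelRep

variable {n : ℕ} {A : CylAlg.{u} n}

/-- The tuple `s` belongs to the relation representing `a`. -/
def Sat (R : RelRep A) (a : A) (s : Fin n → R.M) : Prop :=
  ∃ x : R.V, x ∈ (show Set R.V from R.f a) ∧ x.1 = s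

/-- A set of points is a clique if all `n`-tuples of its points belong to the unit. -/
def IsClique (R : RelRep A) (C : Set R.M) : Prop :=
  ∀ s : Fin n → R.M, (∀ i, s i ∈ C) → s ∈ R.V

/-- A relativized representation is complete if it preserves all existing suprema. -/
def IsComplete (R : RelRep A) : Prop :=
  ∀ (X : Set A) (x : A), IsLUB X x → ∀ s, R.Sat x s ↔ ∃ a ∈ X, R.Sat a s

/-- A relativized representation is `m`-square if witnesses for cylindrifiers can be found inside
cliques with at most `m` points. -/
def IsSquare (R : RelRep A) (m : ℕ) : Prop :=
  ∀ s : Fin m → R.M, R.IsClique (Set.range s) →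
    ∀ (l : Fin n ↪ Fin m) (i : Fin n) (a : A), R.Sat (A.cyl i a) (s ∘ l) →
      ∃ t : Fin m → R.M, R.IsClique (Set.range t) ∧ (∀ j, j ≠ l i → t j = s j) ∧
        R.Sat a (t ∘ l)

end RelRep

/-! The proof is a rainbow construction with blurred reds. Write n = m + 3. An atom is a structure
on m + 3 points: an equivalence relation (the kernel) and a colour for every pair of points over
every m-tuple, such that all triangles in the link of an m-tuple are allowed. Over m distinct points
only three others remain, so each link contains at most one triangle (`cover`); this counting makes
arbitrary n behave like n = 3.

The obstruction. Over a base edge u v coloured `w Set.univ` one may put apexes of five tints, joined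
to u by `g i` and to v by yellow. The rules force a red edge between any two apexes of different
tints. Atoms only use the reds `r l c`, which have three shades, and a red triangle needs three
distinct shades. Of the four edges from one apex to the others, two share a shade and lie in a
forbidden triangle. The base and one apex occupy three dimensions of the algebra and the other
apexes four spare ones, so the complex algebra of the atoms has no neat embedding with four or more
spare dimensions (`RainbowRel.contradiction`, `not_inSNr`). A complete square representation of any
algebra of sets of atoms with all singletons would assign atoms to the tuples of a clique and run
into the same pigeonhole argument (`Typing.false_of_apexes`).

The escape. `blurAlg` consists of the sets of atoms that, for some N, do not distinguish reds of
level at least N. It contains all singletons, as an atom has finitely many colours, but not the sets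
fixing a shade at all levels. Reds of growing level converge to the limit red `rho`, for which
monochromatic triangles are allowed. On ℕ there is a structure, using `rho` as well, that solves all
one-point extension problems (`exists_homogeneous`); unprescribed new edges are white, black or
`rho` (`NiceOn.addPoint`). It represents `blurAlg`: a tuple satisfies X if it has the same N-blur as
some atom in X. Cylindrifications are respected because blurring is a bisimulation (`Str.lift`).

Hence `blurAlg` is representable, while the complex algebra, which has the same atoms and is its
completion, is not. All five claims compare the two. For Sahlqvist equations, the accessibility
relations are symmetric, so least valuations are built from singletons by cylindrifications and lie
in `blurAlg`; a refutation in the complex algebra thus descends (`IsSahlqvist.validIn`). -/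

namespace Rainbow

/-! ### Colours, the triangle rules, and blurring of colours -/

/-- Edge colours: five greens, yellow, black, whites indexed by sets of tints, reds indexed by a
level and a shade, and a limit red `rho`. -/
inductive Col where
  | g (i : Fin 5)
  | yel
  | blk
  | w (S : Set (Fin 5))
  | r (l : ℕ) (c : Fin 3)
  | rho

namespace Col

instance : Countable Col := by
  let F : Col → ℕ × Fin 5 × Set (Fin 5) × ℕ × Fin 3 := fun c => match c with
    | g i => (0, i, ∅, 0, 0)
    | yel => (1, 0, ∅, 0, 0)
    | blk => (2, 0, ∅, 0, 0)
    | w S => (3, 0, S, 0, 0)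
    | r l c => (4, 0, ∅, l, c)
    | rho => (5, 0, ∅, 0, 0)
  refine Function.Injective.countable (f := F) ?_
  intro a b h
  cases a <;> cases b <;> simp_all [F]

/-- The reds, of finite level or limit. -/
def IsRed : Col → Prop
  | r _ _ => True
  | rho => True
  | _ => False

/-- The rule for a triangle, in one of its orientations. -/
def Rule : Col → Col → Col → Prop
  -- The yellow clauses and the green-green-white clause together leave only red for an edge between
  -- two apexes of different tints over the same base.
  | yel, yel, yel => False
  | yel, yel, blk => False
  | yel, yel, g _ => False
  | g i, g j, w _ => i = j
  | g i, yel, w S => i ∈ S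
  | r l i, r l' j, r l'' k => l = l' ∧ l = l'' ∧ i ≠ j ∧ i ≠ k ∧ j ≠ k
  -- Three reds are all `rho` or all of one finite level, so a red triangle passes to the limit only
  -- as a whole.
  | r _ _, r _ _, rho => False
  | r _ _, rho, rho => False
  | _, _, _ => True

/-- The triangle with the given edge colours is allowed. -/
def Allowed (a b c : Col) : Prop :=
  (Rule a b c ∧ Rule a c b) ∧ (Rule b a c ∧ Rule b c a) ∧ (Rule c a b ∧ Rule c b a)

theorem Allowed.rot {a b c : Col} (h : Allowed a b c) : Allowed b c a :=
  ⟨⟨h.2.1.2, h.2.1.1⟩, ⟨h.2.2.2, h.2.2.1⟩, h.1⟩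

theorem Allowed.swap {a b c : Col} (h : Allowed a b c) : Allowed b a c :=
  ⟨h.2.1, h.1, ⟨h.2.2.2, h.2.2.1⟩⟩

/-- No forbidden triangle has two white edges, so `w ∅` can serve as a neutral filler. -/
theorem allowed_white_white (c : Col) : Allowed c (w ∅) (w ∅) := by
  cases c <;> simp [Allowed, Rule]

/-- Identify the reds of level at least `N` with `rho`. -/
def blur (N : ℕ) : Col → Col
  | r l c => if l < N then r l c else rho
  | c => c

theorem blur_blur {N N' : ℕ} (h : N ≤ N') (c : Col) : blur N (blur N' c) = blur N c := by
  cases c with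
  | r l c =>
    by_cases h1 : l < N'
    · simp [blur, h1]
    · simp [blur, h1, show ¬ l < N by omega]
  | _ => rfl

theorem blur_cases (N : ℕ) (c : Col) : (blur N c = c ∧ c ≠ rho) ∨
    (blur N c = rho ∧ (c = rho ∨ ∃ l k, N ≤ l ∧ c = r l k)) := by
  cases c with
  | r l c => by_cases h1 : l < N <;> simp [blur, h1]; omega
  | _ => simp [blur]

theorem blur_eq_iff {N : ℕ} {c d : Col} (h : blur N c = blur N d) :
    c = d ∨ ((c = rho ∨ ∃ l k, N ≤ l ∧ c = r l k) ∧ (d = rho ∨ ∃ l k, N ≤ l ∧ d = r l k)) := by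
  rcases blur_cases N c with ⟨h1, h2⟩ | ⟨h1, h2⟩ <;> rcases blur_cases N d with ⟨h3, h4⟩ | ⟨h3, h4⟩ <;>
  rw [h1, h3] at h
  · exact Or.inl h
  · exact absurd h h2
  · exact absurd h.symm h4
  · exact Or.inr ⟨h2, h4⟩

theorem exists_ne_ne (c : Fin 3) : ∃ d e : Fin 3, c ≠ d ∧ c ≠ e ∧ d ≠ e := by
  revert c; decide

theorem isRed_cases {c : Col} (h : IsRed c) : c = rho ∨ ∃ l k, c = r l k := by
  cases c <;> simp_all [IsRed]

/-- Without three reds, a red edge may be replaced by any other. -/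
theorem Allowed.replace_red {a a' b c : Col} (h : Allowed a b c) (ha : IsRed a) (ha' : IsRed a')
    (hbc : ¬ (IsRed b ∧ IsRed c)) : Allowed a' b c := by
  rcases isRed_cases ha with rfl | ⟨l, k, rfl⟩ <;> rcases isRed_cases ha' with rfl | ⟨l', k', rfl⟩ <;>
  cases b <;> cases c <;> first | exact h | exact absurd ⟨trivial, trivial⟩ hbc

theorem Allowed.red_cases {a b c : Col} (h : Allowed a b c) (ha : IsRed a) (hb : IsRed b)
    (hc : IsRed c) : (a = rho ∧ b = rho ∧ c = rho) ∨
      ∃ l i j k, a = r l i ∧ b = r l j ∧ c = r l k ∧ i ≠ j ∧ i ≠ k ∧ j ≠ k := by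
  rcases isRed_cases ha with rfl | ⟨l, i, rfl⟩ <;> rcases isRed_cases hb with rfl | ⟨l', i', rfl⟩ <;>
  rcases isRed_cases hc with rfl | ⟨l'', i'', rfl⟩ <;> (try simp [Allowed, Rule] at h)
  · simp
  · obtain ⟨⟨⟨rfl, rfl, h1, h2, h3⟩, -⟩, -⟩ := h
    exact Or.inr ⟨l, i, i', i'', rfl, rfl, rfl, h1, h2, h3⟩

theorem allowed_red {l : ℕ} {i j k : Fin 3} (h1 : i ≠ j) (h2 : i ≠ k) (h3 : j ≠ k) :
    Allowed (r l i) (r l j) (r l k) := by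
  simp [Allowed, Rule, h1, h2, h3, h1.symm, h2.symm, h3.symm]

theorem allowed_rho : Allowed rho rho rho := by simp [Allowed, Rule]

/-- Replace the limit red by a red of level `N`. -/
def sharpen (N : ℕ) : Col → Col
  | rho => r N 0
  | c => c

theorem blur_sharpen (N : ℕ) (c : Col) : blur N (sharpen N c) = blur N c := by
  cases c <;> simp [sharpen, blur]

theorem sharpen_ne_rho (N : ℕ) (c : Col) : sharpen N c ≠ rho := by
  cases c <;> simp [sharpen]

theorem sharpen_isRed {N : ℕ} {c : Col} : IsRed (sharpen N c) ↔ IsRed c := by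
  cases c <;> simp [sharpen, IsRed]

theorem sharpen_of_not_isRed {N : ℕ} {c : Col} (h : ¬ IsRed c) : sharpen N c = c := by
  cases c <;> simp_all [sharpen, IsRed]

theorem isRed_of_blur_eq {N : ℕ} {c d : Col} (h : blur N c = blur N d) : IsRed c ↔ IsRed d := by
  cases c <;> cases d <;> simp only [blur] at h <;> (try split_ifs at h) <;> simp_all [IsRed]

/-- Only the clauses about three reds tell reds apart. -/
theorem Allowed.sharpen_of_not_red {N : ℕ} {a b c : Col} (h : Allowed a b c)
    (hr : ¬ (IsRed a ∧ IsRed b ∧ IsRed c)) :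
    Allowed (sharpen N a) (sharpen N b) (sharpen N c) := by
  cases a <;> cases b <;> cases c <;> first | exact h | exact absurd ⟨trivial, trivial, trivial⟩ hr

/-- An allowed triangle can be approximated by one without limit reds. -/
theorem Allowed.approx {a b c : Col} (h : Allowed a b c) (N : ℕ) : ∃ a' b' c',
    Allowed a' b' c' ∧ blur N a' = blur N a ∧ blur N b' = blur N b ∧ blur N c' = blur N c ∧
      a' ≠ rho ∧ b' ≠ rho ∧ c' ≠ rho := by
  by_cases hr : IsRed a ∧ IsRed b ∧ IsRed c
  · rcases h.red_cases hr.1 hr.2.1 hr.2.2 with ⟨rfl, rfl, rfl⟩ | ⟨l, i, j, k, rfl, rfl, rfl, -⟩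
    -- A `rho` triangle is imitated by the three shades of level `N`, the first level that the blur
    -- does not see.
    · exact ⟨r N 0, r N 1, r N 2, allowed_red (by decide) (by decide) (by decide), by simp [blur]⟩
    · exact ⟨_, _, _, h, rfl, rfl, rfl, by simp⟩
  · exact ⟨_, _, _, h.sharpen_of_not_red (N := N) hr, blur_sharpen _ _, blur_sharpen _ _,
      blur_sharpen _ _, sharpen_ne_rho _ _, sharpen_ne_rho _ _, sharpen_ne_rho _ _⟩

/-- Allowed triangles can be lifted along a change of one edge that is invisible to the blur. -/
theorem Allowed.lift {a a' b c : Col} {N : ℕ} (h : Allowed a b c) (ha : blur N a' = blur N a) :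
    ∃ b' c', Allowed a' b' c' ∧ blur N b' = blur N b ∧ blur N c' = blur N c ∧
      (a' ≠ rho → b' ≠ rho ∧ c' ≠ rho) := by
  by_cases hr : IsRed a ∧ IsRed b ∧ IsRed c
  · rcases blur_eq_iff ha with rfl | ⟨h1, h2⟩
    · refine ⟨b, c, h, rfl, rfl, fun h' => ?_⟩
      rcases h.red_cases hr.1 hr.2.1 hr.2.2 with ⟨rfl, rfl, rfl⟩ | ⟨l, i, j, k, rfl, rfl, rfl, -⟩
      · exact absurd rfl h'
      · simp
    -- The old edge `a` is `rho` or of level at least `N`. Since a red triangle has a single level,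
    -- `b` and `c` are blurred as well and may be moved to the level of `a'`.
    · have hb : blur N b = rho ∧ blur N c = rho := by
        rcases h.red_cases hr.1 hr.2.1 hr.2.2 with ⟨rfl, rfl, rfl⟩ | ⟨l, i, j, k, rfl, rfl, rfl, -⟩
        · simp [blur]
        · rcases h2 with h2 | ⟨l', k', h2, h3⟩
          · simp at h2
          · simp only [r.injEq] at h3
            simp [blur]; omega
      rw [hb.1, hb.2]
      rcases h1 with rfl | ⟨l, k, hl, rfl⟩
      · exact ⟨rho, rho, allowed_rho, by simp [blur], by simp [blur], by simp⟩
      · obtain ⟨d, e, h1, h2, h3⟩ := exists_ne_ne k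
        refine ⟨r l d, r l e, allowed_red h1 h2 h3, ?_, ?_, by simp⟩ <;> simp [blur] <;> omega
  · refine ⟨sharpen N b, sharpen N c, ?_, blur_sharpen _ _, blur_sharpen _ _,
      fun _ => ⟨sharpen_ne_rho _ _, sharpen_ne_rho _ _⟩⟩
    have h1 := h.sharpen_of_not_red (N := N) hr
    rcases blur_eq_iff ha with rfl | ⟨h2, h3⟩
    · by_cases ha' : IsRed a'
      · exact h1.replace_red (sharpen_isRed.2 ha') ha' (by simp only [sharpen_isRed]; tauto)
      · rwa [sharpen_of_not_isRed ha'] at h1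
    · have ha1 : IsRed a := by rcases h3 with rfl | ⟨l, k, -, rfl⟩ <;> simp [IsRed]
      exact h1.replace_red (sharpen_isRed.2 ha1) ((isRed_of_blur_eq ha).2 ha1)
        (by simp only [sharpen_isRed]; tauto)

end Col

open Col

/-! ### One-point extensions of coloured graphs -/

/-- A coloured graph on `V` all of whose triangles are allowed; a finite red between two apexes
over the same base is only present if no third tint may occur over that base. -/
structure NiceOn {X : Type*} (V : Set X) (N : X → X → Col) : Prop where
  symm : ∀ u ∈ V, ∀ v ∈ V, u ≠ v → N u v = N v u
  tri : ∀ u ∈ V, ∀ v ∈ V, ∀ t ∈ V, u ≠ v → u ≠ t → v ≠ t → Allowed (N u v) (N v t) (N u t)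
  -- Otherwise a later apex over `p`, `q` of a third tint could be forced to send `rho` to both `u`
  -- and `v`, and two `rho` edges with a finite red are forbidden.
  base : ∀ u ∈ V, ∀ v ∈ V, ∀ p ∈ V, ∀ q ∈ V, u ≠ v → p ≠ q → u ≠ p → u ≠ q → v ≠ p → v ≠ q →
    ∀ i j l c, N u p = g i → N v p = g j → N u q = yel → N v q = yel → N u v = r l c →
      ∃ S, N p q = w S ∧ S ⊆ {i, j}

theorem NiceOn.congr {X : Type*} {V : Set X} {N N' : X → X → Col} (h : NiceOn V N)
    (hN : ∀ u ∈ V, ∀ v ∈ V, u ≠ v → N' u v = N u v) : NiceOn V N' where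
  symm u hu v hv huv := by rw [hN u hu v hv huv, hN v hv u hu huv.symm, h.symm u hu v hv huv]
  tri u hu v hv t ht h1 h2 h3 := by
    rw [hN u hu v hv h1, hN v hv t ht h3, hN u hu t ht h2]
    exact h.tri u hu v hv t ht h1 h2 h3
  base u hu v hv p hp q hq h1 h2 h3 h4 h5 h6 := by
    rw [hN u hu v hv h1, hN u hu p hp h3, hN v hv p hp h5, hN u hu q hq h4, hN v hv q hq h6,
      hN p hp q hq h2]
    exact h.base u hu v hv p hp q hq h1 h2 h3 h4 h5 h6

open Classical in
/-- The colour of the edge from a new point, with prescribed edges `a` to `D`, to `v`. -/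
noncomputable def newCol {X : Type*} (D : Set X) (a : X → Col) (N : X → X → Col) (v : X) : Col :=
  if v ∈ D then a v
  -- Two different greens at a common point exclude white, two yellows exclude black; `rho` is the
  -- last resort. The white label holds only the tints that are forced, which is what preserves
  -- `base`.
  else if ∃ p ∈ D, ∃ i j, a p = g i ∧ N p v = g j ∧ i ≠ j then
    if ∃ p ∈ D, a p = yel ∧ N p v = yel then rho else blk
  else w {k | ∃ z ∈ D, (a z = g k ∧ N z v = yel) ∨ (a z = yel ∧ N z v = g k)}

open Classical in
/-- Extend a coloured graph by the point `x`. -/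
noncomputable def addPoint {X : Type*} (D : Set X) (a : X → Col) (N : X → X → Col) (x : X) :
    X → X → Col :=
  fun u v => if u = x then newCol D a N v else if v = x then newCol D a N u else N u v

section newCol

variable {X : Type*} {D : Set X} {a : X → Col} {N : X → X → Col} {v : X}

theorem newCol_mem (h : v ∈ D) : newCol D a N v = a v := by simp [newCol, h]

theorem newCol_cases (h : v ∉ D) :
    (newCol D a N v = w {k | ∃ z ∈ D, (a z = g k ∧ N z v = yel) ∨ (a z = yel ∧ N z v = g k)} ∧
      ∀ p ∈ D, ∀ i j, a p = g i → N p v = g j → i = j) ∨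
    (newCol D a N v = blk ∧ (∃ p ∈ D, ∃ i j, a p = g i ∧ N p v = g j ∧ i ≠ j) ∧
      ∀ p ∈ D, a p = yel → N p v ≠ yel) ∨
    (newCol D a N v = rho ∧ (∃ p ∈ D, ∃ i j, a p = g i ∧ N p v = g j ∧ i ≠ j) ∧
      ∃ p ∈ D, a p = yel ∧ N p v = yel) := by
  unfold newCol
  rw [if_neg h]
  split_ifs with h1 h2
  · exact Or.inr (Or.inr ⟨rfl, h1, h2⟩)
  · refine Or.inr (Or.inl ⟨rfl, h1, ?_⟩)
    push Not at h2; exact h2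
  · refine Or.inl ⟨rfl, ?_⟩
    push Not at h1; exact h1

end newCol

section addPoint

variable {X : Type*} {V D : Set X} {a : X → Col} {N : X → X → Col} {x v : X} {i : Fin 5} {l : ℕ}
  {c : Fin 3}

theorem addPoint_left (v : X) : addPoint D a N x x v = newCol D a N v := by simp [addPoint]

theorem addPoint_right {u : X} (h : u ≠ x) : addPoint D a N x u x = newCol D a N u := by
  simp [addPoint, h]

theorem addPoint_old {u v : X} (h : u ≠ x) (h' : v ≠ x) : addPoint D a N x u v = N u v := by
  simp [addPoint, h, h']

/-- Unprescribed new edges are white, black or `rho`, so greens, yellows and finite reds at the new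
point are all prescribed. -/
theorem newCol_eq_g (h : newCol D a N v = g i) : v ∈ D ∧ a v = g i := by
  by_cases hv : v ∈ D
  · exact ⟨hv, by rwa [newCol_mem hv] at h⟩
  · rcases newCol_cases (a := a) (N := N) hv with h1 | h1 | h1 <;> rw [h1.1] at h <;> cases h

theorem newCol_eq_yel (h : newCol D a N v = yel) : v ∈ D ∧ a v = yel := by
  by_cases hv : v ∈ D
  · exact ⟨hv, by rwa [newCol_mem hv] at h⟩
  · rcases newCol_cases (a := a) (N := N) hv with h1 | h1 | h1 <;> rw [h1.1] at h <;> cases h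

theorem newCol_eq_r (h : newCol D a N v = r l c) : v ∈ D ∧ a v = r l c := by
  by_cases hv : v ∈ D
  · exact ⟨hv, by rwa [newCol_mem hv] at h⟩
  · rcases newCol_cases (a := a) (N := N) hv with h1 | h1 | h1 <;> rw [h1.1] at h <;> cases h

/-- Triangles with exactly one prescribed edge at the new point. -/
theorem allowed_newCol_mem {p v : X} (hp : p ∈ D) (hv : v ∉ D)
    (hrho : newCol D a N v = rho → ¬ (IsRed (a p) ∧ IsRed (N p v))) :
    Allowed (a p) (N p v) (newCol D a N v) := by
  rcases newCol_cases (a := a) (N := N) hv with ⟨h1, h2⟩ | ⟨h1, -, h2⟩ | ⟨h1, -⟩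
  · rw [h1]
    have h2 := h2 p hp
    generalize hS : {k | ∃ z ∈ D, (a z = g k ∧ N z v = yel) ∨ (a z = yel ∧ N z v = g k)} = S
    have hS1 : ∀ k, a p = g k → N p v = yel → k ∈ S := fun k hk hk' => by
      rw [← hS]; exact ⟨p, hp, Or.inl ⟨hk, hk'⟩⟩
    have hS2 : ∀ k, a p = yel → N p v = g k → k ∈ S := fun k hk hk' => by
      rw [← hS]; exact ⟨p, hp, Or.inr ⟨hk, hk'⟩⟩
    generalize a p = α at *
    generalize N p v = β at *
    cases α <;> cases β <;> simp_all [Allowed, Rule]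
  · rw [h1]
    have h2 := h2 p hp
    generalize a p = α at *
    generalize N p v = β at *
    cases α <;> cases β <;> simp_all [Allowed, Rule]
  · have hr := hrho h1
    rw [h1]
    generalize a p = α at *
    generalize N p v = β at *
    cases α <;> cases β <;> simp_all [Allowed, Rule, IsRed]

/-- The critical triangle has two unprescribed `rho` edges. As `D` has at most two points, both
edges arise from the same green point `p` and the same yellow point `q`, and `base` excludes a
finite red opposite the new point. -/
theorem allowed_newCol_newCol {u v : X} (hN : NiceOn V N) (hD : D ⊆ V)
    (h3 : ∀ p ∈ D, ∀ q ∈ D, ∀ t ∈ D, p = q ∨ p = t ∨ q = t)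
    (ha : ∀ p ∈ D, ∀ q ∈ D, p ≠ q → Allowed (a p) (N p q) (a q))
    (hu : u ∈ V) (hv : v ∈ V) (huv : u ≠ v) :
    Allowed (newCol D a N u) (N u v) (newCol D a N v) := by
  have hmem : ∀ p ∈ D, ∀ v ∉ D, Allowed (a p) (N p v) (newCol D a N v) := by
    intro p hp v hv
    refine allowed_newCol_mem hp hv fun h => ?_
    rcases newCol_cases (a := a) (N := N) hv with h1 | h1 | h1
    · rw [h1.1] at h; cases h
    · rw [h1.1] at h; cases h
    · obtain ⟨-, ⟨p1, hp1, i, j, h1, h2, -⟩, p2, hp2, h3', h4⟩ := h1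
      have h12 : p1 ≠ p2 := by rintro rfl; rw [h1] at h3'; cases h3'
      rcases h3 p1 hp1 p2 hp2 p hp with h5 | rfl | rfl
      · exact absurd h5 h12
      · rw [h1]; simp [IsRed]
      · rw [h3']; simp [IsRed]
  by_cases huD : u ∈ D <;> by_cases hvD : v ∈ D
  · rw [newCol_mem huD, newCol_mem hvD]; exact ha u huD v hvD huv
  · rw [newCol_mem huD]; exact hmem u huD v hvD
  · rw [newCol_mem hvD, hN.symm u hu v hv huv]; exact (hmem v hvD u huD).swap.rot.rot
  · have key : newCol D a N u = rho → newCol D a N v = rho →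
        N u v = rho ∨ ∃ S, N u v = w S := by
      intro h1 h2
      rcases newCol_cases (a := a) (N := N) huD with h | h | h
      · rw [h.1] at h1; cases h1
      · rw [h.1] at h1; cases h1
      obtain ⟨-, ⟨p, hp, i, j, hpi, hpj, hij⟩, q, hq, hqy, hqu⟩ := h
      rcases newCol_cases (a := a) (N := N) hvD with h | h | h
      · rw [h.1] at h2; cases h2
      · rw [h.1] at h2; cases h2
      obtain ⟨-, ⟨p', hp', i', j', hpi', hpj', hij'⟩, q', hq', hqy', hqu'⟩ := h
      have hpq : p ≠ q := by rintro rfl; rw [hpi] at hqy; cases hqy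
      have hpq1 : p ≠ q' := by rintro rfl; rw [hpi] at hqy'; cases hqy'
      have hpq2 : p' ≠ q := by rintro rfl; rw [hpi'] at hqy; cases hqy
      obtain rfl : p = p' := by
        rcases h3 p hp q hq p' hp' with h | h | h
        exacts [absurd h hpq, h, absurd h.symm hpq2]
      obtain rfl : q = q' := by
        rcases h3 p hp q hq q' hq' with h | h | h
        exacts [absurd h hpq, absurd h hpq1, h]
      rw [hpi] at hpi'
      cases hpi'
      have hup : u ≠ p := fun h => huD (h ▸ hp)
      have huq : u ≠ q := fun h => huD (h ▸ hq)
      have hvp : v ≠ p := fun h => hvD (h ▸ hp)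
      have hvq : v ≠ q := fun h => hvD (h ▸ hq)
      have t1 := hN.tri p (hD hp) u hu v hv hup.symm hvp.symm huv
      have t2 := hN.tri q (hD hq) u hu v hv huq.symm hvq.symm huv
      have hb := hN.base u hu v hv p (hD hp) q (hD hq) huv hpq hup huq hvp hvq j j'
      have t3 := ha p hp q hq hpq
      rw [hN.symm u hu p (hD hp) hup, hN.symm v hv p (hD hp) hvp, hN.symm u hu q (hD hq) huq,
        hN.symm v hv q (hD hq) hvq] at hb
      rw [hpj, hpj'] at t1
      rw [hqu, hqu'] at t2
      rw [hpi, hqy] at t3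
      generalize N u v = γ at *
      cases γ with
      | rho => exact Or.inl rfl
      | r l c =>
        obtain ⟨S, hS, hS'⟩ := hb l c hpj hpj' hqu hqu' rfl
        -- The new point itself is an apex of tint `i` over `p`, `q`, so `i` is in the label of that
        -- edge, whereas `base` only admits `j` and `j'`.
        rw [hS] at t3
        have : i ∈ S := by simpa [Allowed, Rule] using t3
        rcases hS' this with h | h
        · exact absurd h hij
        · exact absurd h hij'
      | w S =>
        exact Or.inr ⟨S, rfl⟩
      | g k => simp [Allowed, Rule] at t2
      | yel => simp [Allowed, Rule] at t2
      | blk => simp [Allowed, Rule] at t2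
    clear hmem
    generalize N u v = γ at *
    rcases newCol_cases (a := a) (N := N) huD with h | h | h <;>
    rcases newCol_cases (a := a) (N := N) hvD with h' | h' | h' <;> rw [h.1, h'.1]
    pick_goal 9
    · rcases key h.1 h'.1 with rfl | ⟨S, rfl⟩
      · exact allowed_rho
      · simp [Allowed, Rule]
    all_goals clear key h h'; cases γ <;> simp [Allowed, Rule]

/-- For `base`: were the new point one of the two apexes, its green, yellow and finite red edges
would put three points into `D`. If it is one of the two base points, the apexes exhaust `D`, and
the label chosen by `newCol` contains no tint besides theirs. -/
theorem NiceOn.addPoint (hN : NiceOn V N) (hx : x ∉ V) (hD : D ⊆ V)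
    (h3 : ∀ p ∈ D, ∀ q ∈ D, ∀ t ∈ D, p = q ∨ p = t ∨ q = t)
    (ha : ∀ p ∈ D, ∀ q ∈ D, p ≠ q → Allowed (a p) (N p q) (a q)) :
    NiceOn (insert x V) (addPoint D a N x) where
  symm := by
    rintro u (rfl | hu) v (rfl | hv) huv
    · rfl
    · rw [addPoint_left, addPoint_right huv.symm]
    · rw [addPoint_left, addPoint_right huv]
    · have hu' : u ≠ x := fun h => hx (h ▸ hu)
      have hv' : v ≠ x := fun h => hx (h ▸ hv)
      rw [addPoint_old hu' hv', addPoint_old hv' hu', hN.symm u hu v hv huv]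
  tri := by
    have key := fun u hu v hv huv => allowed_newCol_newCol (u := u) (v := v) hN hD h3 ha hu hv huv
    have hne : ∀ u ∈ V, u ≠ x := fun u hu h => hx (h ▸ hu)
    rintro u (rfl | hu) v (rfl | hv) t (rfl | ht) huv hut hvt
    · exact absurd rfl huv
    · exact absurd rfl huv
    · exact absurd rfl hut
    · rw [addPoint_left, addPoint_left, addPoint_old huv.symm hut.symm]
      exact key v hv t ht hvt
    · exact absurd rfl hvt
    · rw [addPoint_left, addPoint_right huv, addPoint_old huv hvt.symm]
      exact (key u hu t ht hut).swap.rot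
    · rw [addPoint_right hut, addPoint_right hvt, addPoint_old hut hvt]
      exact (key u hu v hv huv).rot
    · rw [addPoint_old (hne _ hu) (hne _ hv), addPoint_old (hne _ hv) (hne _ ht),
        addPoint_old (hne _ hu) (hne _ ht)]
      exact hN.tri u hu v hv t ht huv hut hvt
  base := by
    have hne : ∀ u ∈ V, u ≠ x := fun u hu h => hx (h ▸ hu)
    rintro u hu v hv p hp q hq huv hpq hup huq hvp hvq i j l c h1 h2 h4 h5 h6
    rcases hu with rfl | hu
    · rw [addPoint_left] at h1 h4 h6
      rcases h3 _ (newCol_eq_g h1).1 _ (newCol_eq_yel h4).1 _ (newCol_eq_r h6).1 with h | h | h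
      exacts [absurd h hpq, absurd h hvp.symm, absurd h hvq.symm]
    rcases hv with rfl | hv
    · rw [addPoint_left] at h2 h5
      rw [addPoint_right huv] at h6
      rcases h3 _ (newCol_eq_g h2).1 _ (newCol_eq_yel h5).1 _ (newCol_eq_r h6).1 with h | h | h
      exacts [absurd h hpq, absurd h hup.symm, absurd h huq.symm]
    rw [addPoint_old (hne _ hu) (hne _ hv)] at h6
    rcases hp with rfl | hp
    · rw [addPoint_right hup] at h1
      rw [addPoint_right hvp] at h2
      rw [addPoint_left]
      have hq : q ∈ V := hq.resolve_left hpq.symm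
      rw [addPoint_old (hne _ hu) (hne _ hq)] at h4
      rw [addPoint_old (hne _ hv) (hne _ hq)] at h5
      obtain ⟨huD, hu1⟩ := newCol_eq_g h1
      obtain ⟨hvD, hv1⟩ := newCol_eq_g h2
      have hD' : ∀ z ∈ D, z = u ∨ z = v := fun z hz => by
        rcases h3 u huD v hvD z hz with h | h | h
        exacts [absurd h huv, Or.inl h.symm, Or.inr h.symm]
      have hqD : q ∉ D := fun h => by
        rcases hD' q h with h | h
        exacts [huq h.symm, hvq h.symm]
      have hgg : ¬ ∃ p ∈ D, ∃ i j, a p = g i ∧ N p q = g j ∧ i ≠ j := by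
        rintro ⟨z, hz, i', j', -, h, -⟩
        rcases hD' z hz with rfl | rfl
        · rw [h4] at h; cases h
        · rw [h5] at h; cases h
      rcases newCol_cases (a := a) (N := N) hqD with h | h | h
      · refine ⟨_, h.1, ?_⟩
        rintro k ⟨z, hz, ⟨hk, -⟩ | ⟨-, hk⟩⟩ <;> rcases hD' z hz with rfl | rfl
        · rw [hu1] at hk; cases hk; simp
        · rw [hv1] at hk; cases hk; simp
        · rw [h4] at hk; cases hk
        · rw [h5] at hk; cases hk
      · exact absurd h.2.1 hgg
      · exact absurd h.2.1 hgg
    rcases hq with rfl | hq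
    · rw [addPoint_right huq] at h4
      rw [addPoint_right hvq] at h5
      rw [addPoint_right hpq]
      rw [addPoint_old (hne _ hu) (hne _ hp)] at h1
      rw [addPoint_old (hne _ hv) (hne _ hp)] at h2
      obtain ⟨huD, hu1⟩ := newCol_eq_yel h4
      obtain ⟨hvD, hv1⟩ := newCol_eq_yel h5
      have hD' : ∀ z ∈ D, z = u ∨ z = v := fun z hz => by
        rcases h3 u huD v hvD z hz with h | h | h
        exacts [absurd h huv, Or.inl h.symm, Or.inr h.symm]
      have hpD : p ∉ D := fun h => by
        rcases hD' p h with h | h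
        exacts [hup h.symm, hvp h.symm]
      have hgg : ¬ ∃ z ∈ D, ∃ i j, a z = g i ∧ N z p = g j ∧ i ≠ j := by
        rintro ⟨z, hz, i', j', h, -, -⟩
        rcases hD' z hz with rfl | rfl
        · rw [hu1] at h; cases h
        · rw [hv1] at h; cases h
      rcases newCol_cases (a := a) (N := N) hpD with h | h | h
      · refine ⟨_, h.1, ?_⟩
        rintro k ⟨z, hz, ⟨hk, -⟩ | ⟨-, hk⟩⟩ <;> rcases hD' z hz with rfl | rfl
        · rw [hu1] at hk; cases hk
        · rw [hv1] at hk; cases hk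
        · rw [h1] at hk; cases hk; simp
        · rw [h2] at hk; cases hk; simp
      · exact absurd h.2.1 hgg
      · exact absurd h.2.1 hgg
    rw [addPoint_old (hne _ hu) (hne _ hp)] at h1
    rw [addPoint_old (hne _ hv) (hne _ hp)] at h2
    rw [addPoint_old (hne _ hu) (hne _ hq)] at h4
    rw [addPoint_old (hne _ hv) (hne _ hq)] at h5
    rw [addPoint_old (hne _ hp) (hne _ hq)]
    exact hN.base u hu v hv p hp q hq huv hpq hup huq hvp hvq i j l c h1 h2 h4 h5 h6

end addPoint

end Rainbow

/-! ### Structures: a kernel and coloured links over m-tuples -/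

namespace Rainbow

open Col

/-- The points `e`, `u`, `v` are pairwise unrelated. -/
def ND {X : Type*} {m : ℕ} (K : X → X → Prop) (e : Fin m → X) (u v : X) : Prop :=
  (∀ i j, K (e i) (e j) → i = j) ∧ (∀ i, ¬ K (e i) u) ∧ (∀ i, ¬ K (e i) v) ∧ ¬ K u v

theorem ND.comm {X : Type*} {m : ℕ} {K : X → X → Prop} (hK : Equivalence K) {e : Fin m → X}
    {u v : X} : ND K e u v ↔ ND K e v u := by
  constructor <;> exact fun ⟨h1, h2, h3, h4⟩ => ⟨h1, h3, h2, fun h => h4 (hK.symm h)⟩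

/-- Unrelated points are distinct, and `m + 3` distinct points exhaust `Y`. Hence a link has at most
one triangle, and none if the kernel is nontrivial. -/
theorem cover {Y : Type*} [Fintype Y] {m : ℕ} (hY : Fintype.card Y = m + 3)
    {K : Y → Y → Prop} (hK : ∀ x, K x x) {e : Fin m → Y} {u v t : Y}
    (h1 : ND K e u v) (h2 : ND K e u t) (h3 : ND K e v t) (x : Y) :
    x ∈ Set.range e ∨ x = u ∨ x = v ∨ x = t := by
  have hKe : ∀ a b, a = b → K a b := fun a b h => h ▸ hK a
  let f : Fin m ⊕ Fin 3 → Y := Sum.elim e ![u, v, t]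
  have hf : Function.Injective f := by
    refine Function.Injective.sumElim ?_ ?_ ?_
    · intro i j h; exact h1.1 i j (hKe _ _ h)
    · have huv : u ≠ v := fun h => h1.2.2.2 (hKe _ _ h)
      have hut : u ≠ t := fun h => h2.2.2.2 (hKe _ _ h)
      have hvt : v ≠ t := fun h => h3.2.2.2 (hKe _ _ h)
      intro i j h
      fin_cases i <;> fin_cases j <;> simp_all
    · intro i j h
      fin_cases j
      · exact h1.2.1 i (hKe _ _ h)
      · exact h1.2.2.1 i (hKe _ _ h)
      · exact h2.2.2.1 i (hKe _ _ h)
  have hs : Function.Surjective f :=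
    ((Fintype.bijective_iff_injective_and_card f).2 ⟨hf, by simp [hY]⟩).2
  obtain ⟨i | i, rfl⟩ := hs x
  · exact Or.inl ⟨i, rfl⟩
  · fin_cases i <;> simp [f]

/-- Structures: a kernel and a colour for each pair of points over each `m`-tuple of points. -/
@[ext] structure Str (m : ℕ) (X : Type*) where
  rel : X → X → Prop
  col : (Fin m → X) → X → X → Col

namespace Str

variable {m : ℕ} {X Y : Type*}

/-- The kernel is a congruence, and modulo the kernel all triangles in links are allowed. -/
structure Good (S : Str m X) : Prop where
  equiv : Equivalence S.rel
  congr : ∀ e e' u u' v v', (∀ i, S.rel (e i) (e' i)) → S.rel u u' → S.rel v v' →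
    S.col e u v = S.col e' u' v'
  symm : ∀ e u v, S.col e u v = S.col e v u
  tri : ∀ e u v t, ND S.rel e u v → ND S.rel e u t → ND S.rel e v t →
    Allowed (S.col e u v) (S.col e v t) (S.col e u t)
  -- Normalising the meaningless colours makes equality of structures depend on genuine edges only.
  deg : ∀ e u v, ¬ ND S.rel e u v → S.col e u v = w ∅

/-- Pull a structure back along a function. -/
def pull (S : Str m X) (f : Y → X) : Str m Y where
  rel a b := S.rel (f a) (f b)
  col e u v := S.col (f ∘ e) (f u) (f v)

theorem Good.pull {S : Str m X} (h : S.Good) (f : Y → X) : (S.pull f).Good where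
  equiv := ⟨fun _ => h.equiv.refl _, fun h' => h.equiv.symm h', fun h1 h2 => h.equiv.trans h1 h2⟩
  congr _ _ _ _ _ _ h1 h2 h3 := h.congr _ _ _ _ _ _ h1 h2 h3
  symm _ _ _ := h.symm _ _ _
  tri _ _ _ _ h1 h2 h3 := h.tri _ _ _ _ h1 h2 h3
  deg _ _ _ h' := h.deg _ _ _ h'

theorem pull_pull {Z : Type*} (S : Str m X) (f : Y → X) (g : Z → Y) :
    (S.pull f).pull g = S.pull (f ∘ g) := rfl

theorem pull_id (S : Str m X) : S.pull id = S := rfl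

/-- Two structures agree off a point. -/
def AgreeOff (i : X) (S S' : Str m X) : Prop :=
  (∀ a b, a ≠ i → b ≠ i → (S.rel a b ↔ S'.rel a b)) ∧
    ∀ e u v, (∀ j, e j ≠ i) → u ≠ i → v ≠ i → S.col e u v = S'.col e u v

theorem AgreeOff.refl (i : X) (S : Str m X) : AgreeOff i S S :=
  ⟨fun _ _ _ _ => Iff.rfl, fun _ _ _ _ _ _ => rfl⟩

theorem AgreeOff.symm {i : X} {S S' : Str m X} (h : AgreeOff i S S') : AgreeOff i S' S :=
  ⟨fun a b ha hb => (h.1 a b ha hb).symm, fun e u v he hu hv => (h.2 e u v he hu hv).symm⟩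

theorem agreeOff_pull (S : Str m X) {f g : Y → X} {i : Y} (h : ∀ j, j ≠ i → f j = g j) :
    AgreeOff i (S.pull f) (S.pull g) := by
  refine ⟨fun a b ha hb => by simp [pull, h a ha, h b hb], fun e u v he hu hv => ?_⟩
  have : f ∘ e = g ∘ e := funext fun j => h _ (he j)
  simp [pull, h u hu, h v hv, this]

theorem AgreeOff.pull_eq {i : X} {S S' : Str m X} (h : AgreeOff i S S') {f : Y → X}
    (hf : ∀ j, f j ≠ i) : S.pull f = S'.pull f := by
  refine Str.ext ?_ ?_
  · funext a b; exact propext (h.1 _ _ (hf _) (hf _))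
  · funext e u v; exact h.2 _ _ _ (fun _ => hf _) (hf _) (hf _)

/-- If `i` is related to `j`, then moving `i` to `j` does not change the structure. -/
theorem Good.pull_update [DecidableEq X] {S : Str m X} (h : S.Good) {i j : X} (hij : S.rel j i) :
    S.pull (Function.update id i j) = S := by
  have key : ∀ a, S.rel (Function.update id i j a) a := fun a => by
    by_cases ha : a = i
    · subst ha; simpa using hij
    · simpa [ha] using h.equiv.refl a
  refine Str.ext ?_ ?_
  · funext a b
    exact propext ⟨fun h' => h.equiv.trans (h.equiv.symm (key a)) (h.equiv.trans h' (key b)),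
      fun h' => h.equiv.trans (key a) (h.equiv.trans h' (h.equiv.symm (key b)))⟩
  · funext e u v
    exact h.congr _ _ _ _ _ _ (fun _ => key _) (key _) (key _)

end Str

/-! ### Adding one point to a stage of the construction -/

section Extend

variable {m : ℕ}

/-- Prescribed colours for the tuples of a small set `R` of points containing the new point `k`. -/
structure Preset (k : ℕ) (χ κ : (Fin m → ℕ) → ℕ → ℕ → Col) (R : Set ℕ) : Prop where
  mem : k ∈ R
  le : ∀ x ∈ R, x ≤ k
  symm : ∀ e u v, (∀ i, e i ∈ R) → u ∈ R → v ∈ R → κ e u v = κ e v u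
  agree : ∀ e u v, (∀ i, e i ∈ R) → u ∈ R → v ∈ R → (∀ i, e i ≠ k) → u ≠ k → v ≠ k →
    κ e u v = χ e u v
  tri : ∀ e u v t, (∀ i, e i ∈ R) → u ∈ R → v ∈ R → t ∈ R → ND Eq e u v → ND Eq e u t →
    ND Eq e v t → Allowed (κ e u v) (κ e v t) (κ e u t)
  cover : ∀ (e : Fin m → ℕ) u v t, (∀ i, e i ∈ R) → u ∈ R → v ∈ R → t ∈ R → ND Eq e u v → ND Eq e u t →
    ND Eq e v t → ∀ x ∈ R, x ∈ Set.range e ∨ x = u ∨ x = v ∨ x = t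

/-- The colouring `χ` describes a structure on the points below `k`. -/
structure StageOK (k : ℕ) (χ : (Fin m → ℕ) → ℕ → ℕ → Col) : Prop where
  symm : ∀ e u v, χ e u v = χ e v u
  deg : ∀ e u v, ¬ ND Eq e u v → χ e u v = w ∅
  nice : ∀ e, Function.Injective e → (∀ i, e i < k) →
    NiceOn {x | x < k ∧ x ∉ Set.range e} (χ e)

open Classical in
/-- Add the point `k` with prescribed colours `κ` on `R`. -/
noncomputable def extendCol (k : ℕ) (χ κ : (Fin m → ℕ) → ℕ → ℕ → Col) (R : Set ℕ) :
    (Fin m → ℕ) → ℕ → ℕ → Col := fun e u v =>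
  if ND Eq e u v then
    if (∀ i, e i ∈ R) ∧ u ∈ R ∧ v ∈ R then κ e u v
    -- Links through `k` are new and are filled neutrally. Links avoiding `k` get one more vertex,
    -- with nothing prescribed when `e` leaves `R`.
    else if k ∈ Set.range e then w ∅
    else addPoint {p | p ∈ R ∧ p ≠ k ∧ p ∉ Set.range e ∧ ∀ i, e i ∈ R} (fun p => κ e k p) (χ e) k u v
  else w ∅

variable {k : ℕ} {χ κ : (Fin m → ℕ) → ℕ → ℕ → Col} {R : Set ℕ}

theorem extendCol_mem {e : Fin m → ℕ} {u v : ℕ} (h : ND Eq e u v) (he : ∀ i, e i ∈ R) (hu : u ∈ R)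
    (hv : v ∈ R) : extendCol k χ κ R e u v = κ e u v := by
  rw [extendCol, if_pos h, if_pos ⟨he, hu, hv⟩]

theorem extendCol_deg {e : Fin m → ℕ} {u v : ℕ} (h : ¬ ND Eq e u v) :
    extendCol k χ κ R e u v = w ∅ := by
  rw [extendCol, if_neg h]

theorem nd_eq {X : Type*} {e : Fin m → X} {u v : X} (he : Function.Injective e)
    (hu : u ∉ Set.range e) (hv : v ∉ Set.range e) (huv : u ≠ v) : ND Eq e u v :=
  ⟨fun _ _ h => he h, fun i h => hu ⟨i, h⟩, fun i h => hv ⟨i, h⟩, huv⟩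

theorem extendCol_range {e : Fin m → ℕ} {u v : ℕ} (he : k ∈ Set.range e)
    (hR : ¬ ((∀ i, e i ∈ R) ∧ u ∈ R ∧ v ∈ R)) : extendCol k χ κ R e u v = w ∅ := by
  by_cases h : ND Eq e u v
  · rw [extendCol, if_pos h, if_neg hR, if_pos he]
  · exact extendCol_deg h

/-- Tuples inside `R` are no exception: `newCol` returns the prescribed colours at `k`, and `κ`
agrees with `χ` on old points. -/
theorem extendCol_link (hP : Preset k χ κ R) {e : Fin m → ℕ} {u v : ℕ} (h : ND Eq e u v)
    (hk : k ∉ Set.range e) : extendCol k χ κ R e u v =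
      addPoint {p | p ∈ R ∧ p ≠ k ∧ p ∉ Set.range e ∧ ∀ i, e i ∈ R} (fun p => κ e k p)
        (χ e) k u v := by
  by_cases hR : (∀ i, e i ∈ R) ∧ u ∈ R ∧ v ∈ R
  · rw [extendCol_mem h hR.1 hR.2.1 hR.2.2]
    have hu : u ∉ Set.range e := fun ⟨i, hi⟩ => h.2.1 i hi
    have hv : v ∉ Set.range e := fun ⟨i, hi⟩ => h.2.2.1 i hi
    by_cases huk : u = k
    · subst huk
      rw [addPoint_left]
      exact Eq.symm (newCol_mem (a := fun p => κ e u p)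
        ⟨hR.2.2, fun h' => h.2.2.2 h'.symm, hv, hR.1⟩)
    · by_cases hvk : v = k
      · subst hvk
        rw [addPoint_right huk, hP.symm _ _ _ hR.1 hR.2.1 hR.2.2]
        exact Eq.symm (newCol_mem (a := fun p => κ e v p) ⟨hR.2.1, huk, hu, hR.1⟩)
      · rw [addPoint_old huk hvk]
        exact hP.agree _ _ _ hR.1 hR.2.1 hR.2.2 (fun i hi => hk ⟨i, hi⟩) huk hvk
  · rw [extendCol, if_pos h, if_neg hR, if_neg hk]

theorem extendCol_old (hP : Preset k χ κ R) (hχ : StageOK k χ) {e : Fin m → ℕ} {u v : ℕ}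
    (he : ∀ i, e i ≠ k) (hu : u ≠ k) (hv : v ≠ k) : extendCol k χ κ R e u v = χ e u v := by
  by_cases h : ND Eq e u v
  · rw [extendCol_link hP h (fun ⟨i, hi⟩ => he i hi), addPoint_old hu hv]
  · rw [extendCol_deg h, hχ.deg _ _ _ h]

/-- A link through `k` is neutral outside `R`, and `base` is vacuous there because the configuration
needs four points of `R` besides the tuple. A link avoiding `k` falls under `NiceOn.addPoint`; by
the same count, at most two of its old points are prescribed. -/
theorem StageOK.extend (hχ : StageOK k χ) (hP : Preset k χ κ R) :
    StageOK (k + 1) (extendCol k χ κ R) where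
  symm e u v := by
    by_cases h : ND Eq e u v
    · have h' := (ND.comm (K := Eq) ⟨fun _ => rfl, Eq.symm, Eq.trans⟩).1 h
      by_cases hk : k ∈ Set.range e
      · by_cases hR : (∀ i, e i ∈ R) ∧ u ∈ R ∧ v ∈ R
        · rw [extendCol_mem h hR.1 hR.2.1 hR.2.2, extendCol_mem h' hR.1 hR.2.2 hR.2.1,
            hP.symm _ _ _ hR.1 hR.2.1 hR.2.2]
        · rw [extendCol_range hk hR, extendCol_range hk (by tauto)]
      · rw [extendCol_link hP h hk, extendCol_link hP h' hk]
        unfold addPoint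
        have := h.2.2.2
        split_ifs <;> first | rfl | (subst_vars; exact absurd rfl this) | exact hχ.symm _ _ _
    · have h' := fun h' => h ((ND.comm (K := Eq) ⟨fun _ => rfl, Eq.symm, Eq.trans⟩).1 h')
      rw [extendCol_deg h, extendCol_deg h']
  deg e u v h := extendCol_deg h
  nice e hinj he := by
    by_cases hk : k ∈ Set.range e
    · refine ⟨?_, ?_, ?_⟩
      · rintro u ⟨-, hu⟩ v ⟨-, hv⟩ huv
        have h := nd_eq hinj hu hv huv
        have h' := nd_eq hinj hv hu huv.symm
        by_cases hR : (∀ i, e i ∈ R) ∧ u ∈ R ∧ v ∈ R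
        · rw [extendCol_mem h hR.1 hR.2.1 hR.2.2, extendCol_mem h' hR.1 hR.2.2 hR.2.1,
            hP.symm _ _ _ hR.1 hR.2.1 hR.2.2]
        · rw [extendCol_range hk hR, extendCol_range hk (by tauto)]
      · rintro u ⟨-, hu⟩ v ⟨-, hv⟩ t ⟨-, ht⟩ huv hut hvt
        have h1 := nd_eq hinj hu hv huv
        have h2 := nd_eq hinj hu ht hut
        have h3 := nd_eq hinj hv ht hvt
        by_cases hR : ∀ i, e i ∈ R
        · by_cases huR : u ∈ R
          · by_cases hvR : v ∈ R
            · by_cases htR : t ∈ R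
              · rw [extendCol_mem h1 hR huR hvR, extendCol_mem h2 hR huR htR, extendCol_mem h3 hR hvR htR]
                exact hP.tri _ _ _ _ hR huR hvR htR h1 h2 h3
              · rw [extendCol_range hk (v := t) (by tauto), extendCol_range hk (v := t) (by tauto)]
                exact allowed_white_white _
            · rw [extendCol_range hk (v := v) (by tauto), extendCol_range hk (u := v) (by tauto)]
              exact (allowed_white_white _).rot
          · rw [extendCol_range hk (u := u) (by tauto), extendCol_range hk (u := u) (by tauto)]
            exact (allowed_white_white _).rot.rot
        · rw [extendCol_range hk (u := u) (by tauto), extendCol_range hk (u := u) (by tauto)]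
          exact (allowed_white_white _).rot.rot
      · rintro u ⟨-, hu⟩ v ⟨-, hv⟩ p ⟨-, hp⟩ q ⟨-, hq⟩ huv hpq hup huq hvp hvq i j l c h1 - h3 - h5
        exfalso
        have key : ∀ a b, extendCol k χ κ R e a b ≠ w ∅ → (∀ i, e i ∈ R) ∧ a ∈ R ∧ b ∈ R := by
          intro a b hab
          by_contra hR
          exact hab (extendCol_range hk hR)
        have k1 := key u p (by rw [h1]; simp)
        have k3 := key u q (by rw [h3]; simp)
        have k5 := key u v (by rw [h5]; simp)
        rcases hP.cover e u v p k1.1 k1.2.1 k5.2.2 k1.2.2 (nd_eq hinj hu hv huv)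
          (nd_eq hinj hu hp hup) (nd_eq hinj hv hp hvp) q k3.2.2 with h | h | h | h
        exacts [hq h, huq h.symm, hvq h.symm, hpq h.symm]
    · have he' : ∀ i, e i < k := fun i => lt_of_le_of_ne (Nat.lt_succ_iff.1 (he i))
        fun h => hk ⟨i, h⟩
      have hset : {x | x < k + 1 ∧ x ∉ Set.range e} = insert k {x | x < k ∧ x ∉ Set.range e} := by
        ext x
        simp only [Set.mem_ofPred_eq, Set.mem_insert_iff]
        constructor
        · rintro ⟨h1, h2⟩
          rcases Nat.lt_succ_iff_lt_or_eq.1 h1 with h | h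
          exacts [Or.inr ⟨h, h2⟩, Or.inl h]
        · rintro (rfl | ⟨h1, h2⟩)
          exacts [⟨Nat.lt_succ_self _, hk⟩, ⟨by omega, h2⟩]
      rw [hset]
      refine NiceOn.congr (NiceOn.addPoint (a := fun p => κ e k p)
        (D := {p | p ∈ R ∧ p ≠ k ∧ p ∉ Set.range e ∧ ∀ i, e i ∈ R})
        (hχ.nice e hinj he') (fun h => lt_irrefl _ h.1) ?_ ?_ ?_) ?_
      · rintro p ⟨h1, h2, h3, -⟩
        exact ⟨lt_of_le_of_ne (hP.le p h1) h2, h3⟩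
      · rintro p ⟨h1, h2, h3, he⟩ q ⟨h4, h5, h6, -⟩ t ⟨h7, h8, h9, -⟩
        by_contra! h
        obtain ⟨hpq, hpt, hqt⟩ := h
        rcases hP.cover e p q t he h1 h4 h7 (nd_eq hinj h3 h6 hpq) (nd_eq hinj h3 h9 hpt)
          (nd_eq hinj h6 h9 hqt) k hP.mem with h | h | h | h
        exacts [hk h, h2 h.symm, h5 h.symm, h8 h.symm]
      · rintro p ⟨h1, h2, h3, heR⟩ q ⟨h4, h5, h6, -⟩ hpq
        have := hP.tri e k p q heR hP.mem h1 h4 (nd_eq hinj hk h3 h2.symm)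
          (nd_eq hinj hk h6 h5.symm) (nd_eq hinj h3 h6 hpq)
        rwa [hP.agree e p q heR h1 h4 (fun i => (he' i).ne) h2 h5] at this
      · intro u hu v hv huv
        have hr : ∀ x ∈ insert k {x | x < k ∧ x ∉ Set.range e}, x ∉ Set.range e := by
          rintro x (rfl | ⟨-, h⟩)
          exacts [hk, h]
        exact extendCol_link hP (nd_eq hinj (hr u hu) (hr v hv) huv) hk

end Extend

end Rainbow

/-! ### A homogeneous structure on the natural numbers -/

namespace Rainbow

open Col

variable {m : ℕ}

instance : Countable (Str m (Fin (m + 3))) := by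
  have : Function.Injective (fun S : Str m (Fin (m + 3)) => (S.rel, S.col)) := by
    intro S S' h
    simp only [Prod.mk.injEq] at h
    exact Str.ext h.1 h.2
  exact this.countable

/-- The structure on `ℕ` with trivial kernel and colouring `χ`. -/
def natStr (χ : (Fin m → ℕ) → ℕ → ℕ → Col) : Str m ℕ := ⟨Eq, χ⟩

/-- A one-point extension problem, to be solved by adding the point `k`. -/
structure Valid (k : ℕ) (χ : (Fin m → ℕ) → ℕ → ℕ → Col) (s : Fin (m + 3) → ℕ)
    (i : Fin (m + 3)) (τ : Str m (Fin (m + 3))) : Prop where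
  good : τ.Good
  lt : ∀ j, j ≠ i → s j < k
  isolated : ∀ j, j ≠ i → ¬ τ.rel j i
  agree : Str.AgreeOff i τ ((natStr χ).pull s)

/-- Since `i` is isolated, sending it to the fresh point `k` turns the kernel of `τ` into equality.
The colours are transported along a section `r` of the resulting tuple; the kernel is a congruence,
so the choice of section does not matter. -/
theorem Valid.exists_preset {k : ℕ} {χ : (Fin m → ℕ) → ℕ → ℕ → Col} {s : Fin (m + 3) → ℕ}
    {i : Fin (m + 3)} {τ : Str m (Fin (m + 3))} (h : Valid k χ s i τ) :
    ∃ κ R, Preset k χ κ R ∧ (natStr (extendCol k χ κ R)).pull (Function.update s i k) = τ := by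
  set t := Function.update s i k with ht
  have hti : t i = k := by simp [ht]
  have htj : ∀ j, j ≠ i → t j = s j := fun j hj => by simp [ht, hj]
  have hτ := h.good
  have hrel : ∀ a b, τ.rel a b ↔ t a = t b := by
    intro a b
    by_cases ha : a = i
    · subst ha
      by_cases hb : b = a
      · subst hb; simpa using hτ.equiv.refl b
      · rw [hti, htj b hb]
        exact ⟨fun h' => absurd (hτ.equiv.symm h') (h.isolated b hb),
          fun h' => absurd h' (h.lt b hb).ne'⟩
    · by_cases hb : b = i
      · subst hb
        rw [hti, htj a ha]
        exact ⟨fun h' => absurd h' (h.isolated a ha), fun h' => absurd h' (h.lt a ha).ne⟩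
      · rw [htj a ha, htj b hb]
        exact h.agree.1 a b ha hb
  let r := Function.invFun t
  have hr : ∀ x ∈ Set.range t, t (r x) = x := fun x hx => Function.invFun_eq hx
  have hrt : ∀ a, τ.rel (r (t a)) a := fun a => (hrel _ _).2 (hr _ ⟨a, rfl⟩)
  have hrr : ∀ x ∈ Set.range t, ∀ y ∈ Set.range t, τ.rel (r x) (r y) ↔ x = y := by
    intro x hx y hy
    rw [hrel, hr x hx, hr y hy]
  have hnd : ∀ e u v, (∀ j, e j ∈ Set.range t) → u ∈ Set.range t → v ∈ Set.range t →
      ND Eq e u v → ND τ.rel (r ∘ e : Fin m → _) (r u) (r v) := by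
    intro e u v he hu hv h'
    exact ⟨fun a b hab => h'.1 a b ((hrr _ (he a) _ (he b)).1 hab),
      fun a ha => h'.2.1 a ((hrr _ (he a) _ hu).1 ha),
      fun a ha => h'.2.2.1 a ((hrr _ (he a) _ hv).1 ha), fun ha => h'.2.2.2 ((hrr _ hu _ hv).1 ha)⟩
  have hne : ∀ x ∈ Set.range t, x ≠ k → r x ≠ i ∧ s (r x) = x := by
    intro x hx hxk
    have h1 : r x ≠ i := fun h1 => by
      have := hr x hx
      rw [h1, hti] at this
      exact hxk this.symm
    exact ⟨h1, by rw [← htj _ h1, hr x hx]⟩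
  have hP : Preset k χ (fun e u v => τ.col (r ∘ e) (r u) (r v)) (Set.range t) := by
    refine ⟨⟨i, hti⟩, ?_, ?_, ?_, ?_, ?_⟩
    · rintro x ⟨j, rfl⟩
      by_cases hj : j = i
      · rw [hj, hti]
      · rw [htj j hj]; exact (h.lt j hj).le
    · exact fun e u v _ _ _ => hτ.symm _ _ _
    · intro e u v he hu hv hek huk hvk
      rw [h.agree.2 (r ∘ e) _ _ (fun j => (hne _ (he j) (hek j)).1) (hne _ hu huk).1 (hne _ hv hvk).1]
      change χ (s ∘ r ∘ e) (s (r u)) (s (r v)) = _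
      have : s ∘ r ∘ e = e := funext fun j => (hne _ (he j) (hek j)).2
      rw [this, (hne _ hu huk).2, (hne _ hv hvk).2]
    · intro e u v t' he hu hv ht' h1 h2 h3
      exact hτ.tri _ _ _ _ (hnd _ _ _ he hu hv h1) (hnd _ _ _ he hu ht' h2) (hnd _ _ _ he hv ht' h3)
    · intro e u v t' he hu hv ht' h1 h2 h3 x hx
      have hinj : ∀ y ∈ Set.range t, r x = r y → x = y := fun y hy hxy => by
        rw [← hr x hx, hxy, hr y hy]
      rcases cover (by simp) hτ.equiv.refl (hnd _ _ _ he hu hv h1) (hnd _ _ _ he hu ht' h2)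
        (hnd _ _ _ he hv ht' h3) (r x) with ⟨j, hj⟩ | h | h | h
      · exact Or.inl ⟨j, (hinj _ (he j) hj.symm).symm⟩
      · exact Or.inr (Or.inl (hinj _ hu h))
      · exact Or.inr (Or.inr (Or.inl (hinj _ hv h)))
      · exact Or.inr (Or.inr (Or.inr (hinj _ ht' h)))
  refine ⟨_, _, hP, ?_⟩
  refine Str.ext ?_ ?_
  · funext a b
    exact propext (hrel a b).symm
  · funext e u v
    change extendCol k χ (fun e u v => τ.col (r ∘ e) (r u) (r v)) (Set.range t) (t ∘ e) (t u) (t v) = _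
    have hiff : ND τ.rel e u v ↔ ND Eq (t ∘ e) (t u) (t v) := by simp [ND, hrel]
    by_cases h' : ND Eq (t ∘ e) (t u) (t v)
    · rw [extendCol_mem (R := Set.range t) h' (fun j => Set.mem_range_self _)
        (Set.mem_range_self _) (Set.mem_range_self _)]
      exact hτ.congr _ _ _ _ _ _ (fun j => hrt _) (hrt _) (hrt _)
    · rw [extendCol_deg h', hτ.deg _ _ _ (fun h'' => h' (hiff.1 h''))]

/-- Serves the stages whose task is not valid: a point is added all the same. -/
theorem exists_preset (k : ℕ) (χ : (Fin m → ℕ) → ℕ → ℕ → Col) : ∃ κ R, Preset k χ κ R := by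
  refine ⟨fun _ _ _ => w ∅, {k}, rfl, fun x hx => le_of_eq hx, fun _ _ _ _ _ _ => rfl,
    fun e u v _ hu _ _ hu' => absurd hu hu', fun _ _ _ _ _ _ _ _ _ _ _ => allowed_white_white _, ?_⟩
  intro e u v t _ hu _ _ _ _ _ x hx
  exact Or.inr (Or.inl (hx.trans hu.symm))

theorem StageOK.step {k : ℕ} {χ : (Fin m → ℕ) → ℕ → ℕ → Col} (h : StageOK k χ)
    (s : Fin (m + 3) → ℕ) (i : Fin (m + 3)) (τ : Str m (Fin (m + 3))) :
    ∃ χ', StageOK (k + 1) χ' ∧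
      (∀ e u v, (∀ j, e j < k) → u < k → v < k → χ' e u v = χ e u v) ∧
      (Valid k χ s i τ → (natStr χ').pull (Function.update s i k) = τ) := by
  have hold : ∀ κ R, Preset k χ κ R → ∀ e u v, (∀ j, e j < k) → u < k → v < k →
      extendCol k χ κ R e u v = χ e u v := fun κ R hP e u v he hu hv =>
    extendCol_old hP h (fun j => (he j).ne) hu.ne hv.ne
  by_cases hV : Valid k χ s i τ
  · obtain ⟨κ, R, hP, h'⟩ := hV.exists_preset
    exact ⟨_, h.extend hP, hold κ R hP, fun _ => h'⟩
  · obtain ⟨κ, R, hP⟩ := exists_preset k χ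
    exact ⟨_, h.extend hP, hold κ R hP, fun h' => absurd h' hV⟩

theorem stageOK_zero : StageOK (m := m) 0 (fun _ _ _ => w ∅) where
  symm _ _ _ := rfl
  deg _ _ _ _ := rfl
  nice _ _ _ := ⟨fun _ h => absurd h.1 (Nat.not_lt_zero _), fun _ h => absurd h.1 (Nat.not_lt_zero _),
    fun _ h => absurd h.1 (Nat.not_lt_zero _)⟩

/-- Every task recurs at arbitrarily late stages, hence also after all its points have been created.
-/
theorem exists_enum (T : Type*) [Countable T] [Nonempty T] :
    ∃ f : ℕ → T, ∀ t k, ∃ k', k ≤ k' ∧ f k' = t := by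
  obtain ⟨f, hf⟩ := exists_surjective_nat T
  refine ⟨fun k => f k.unpair.1, fun t k => ?_⟩
  obtain ⟨j, rfl⟩ := hf t
  exact ⟨Nat.pair j k, Nat.right_le_pair j k, by simp⟩

/-- There is a homogeneous structure on `ℕ` in which all one-point extension problems have
solutions. -/
theorem exists_homogeneous (m : ℕ) : ∃ M : Str m ℕ, M.rel = Eq ∧ M.Good ∧
    ∀ (s : Fin (m + 3) → ℕ) (i : Fin (m + 3)) (τ : Str m (Fin (m + 3))), τ.Good →
      Str.AgreeOff i τ (M.pull s) → ∃ x, M.pull (Function.update s i x) = τ := by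
  have : Nonempty (Str m (Fin (m + 3))) := ⟨⟨Eq, fun _ _ _ => w ∅⟩⟩
  obtain ⟨f, hf⟩ := exists_enum ((Fin (m + 3) → ℕ) × Fin (m + 3) × Str m (Fin (m + 3)))
  choose next h1 h2 h3 using fun (k : ℕ) (χ : {χ : (Fin m → ℕ) → ℕ → ℕ → Col // StageOK k χ}) =>
    χ.2.step (f k).1 (f k).2.1 (f k).2.2
  let st : (k : ℕ) → {χ : (Fin m → ℕ) → ℕ → ℕ → Col // StageOK k χ} :=
    fun k => Nat.rec ⟨_, stageOK_zero⟩ (fun k χ => ⟨next k χ, h1 k χ⟩) k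
  have hst : ∀ k, (st (k + 1)).1 = next k (st k) := fun k => rfl
  -- The sum plus one strictly exceeds every argument, so the colour is read at a stage containing
  -- all these points; later stages do not change it.
  let χ : (Fin m → ℕ) → ℕ → ℕ → Col := fun e u v => (st (∑ j, e j + u + v + 1)).1 e u v
  have hstable : ∀ k d e u v, (∀ j, e j < k) → u < k → v < k →
      (st (k + d)).1 e u v = (st k).1 e u v := by
    intro k d e u v he hu hv
    induction d with
    | zero => rfl
    | succ d ih =>
      rw [← ih, ← Nat.add_assoc, hst]
      exact h2 _ _ _ _ _ (fun j => by have := he j; omega) (by omega) (by omega)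
  have hχ : ∀ k e u v, (∀ j, e j < k) → u < k → v < k → χ e u v = (st k).1 e u v := by
    intro k e u v he hu hv
    have hj : ∀ j, e j < ∑ j, e j + u + v + 1 := fun j => by
      have := Finset.single_le_sum (f := e) (fun _ _ => Nat.zero_le _) (Finset.mem_univ j)
      omega
    change (st (∑ j, e j + u + v + 1)).1 e u v = _
    rcases le_total k (∑ j, e j + u + v + 1) with h | h
    · obtain ⟨d, hd⟩ := Nat.exists_eq_add_of_le h
      rw [hd]
      exact hstable _ _ _ _ _ he hu hv
    · obtain ⟨d, hd⟩ := Nat.exists_eq_add_of_le h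
      rw [hd]
      exact (hstable _ _ _ _ _ hj (by omega) (by omega)).symm
  have hM : (natStr χ).Good := by
    refine ⟨⟨fun _ => rfl, Eq.symm, Eq.trans⟩, ?_, ?_, ?_, ?_⟩
    · intro e e' u u' v v' h1 h2 h3
      rw [show e = e' from funext h1, show u = u' from h2, show v = v' from h3]
    · intro e u v
      change (st (∑ j, e j + u + v + 1)).1 e u v = (st (∑ j, e j + v + u + 1)).1 e v u
      rw [(st _).2.symm, Nat.add_right_comm (∑ j, e j) u v]
    · intro e u v t h1 h2 h3
      have hk : ∃ k, (∀ j, e j < k) ∧ u < k ∧ v < k ∧ t < k := by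
        refine ⟨∑ j, e j + u + v + t + 1, fun j => ?_, by omega, by omega, by omega⟩
        have := Finset.single_le_sum (f := e) (fun _ _ => Nat.zero_le _) (Finset.mem_univ j)
        omega
      obtain ⟨k, he, hu, hv, ht⟩ := hk
      change Allowed (χ e u v) (χ e v t) (χ e u t)
      rw [hχ k e u v he hu hv, hχ k e v t he hv ht, hχ k e u t he hu ht]
      exact ((st k).2.nice e (fun a b hab => h1.1 a b hab) he).tri u
        ⟨hu, fun ⟨j, hj⟩ => h1.2.1 j hj⟩ v ⟨hv, fun ⟨j, hj⟩ => h1.2.2.1 j hj⟩ t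
        ⟨ht, fun ⟨j, hj⟩ => h2.2.2.1 j hj⟩ h1.2.2.2 h2.2.2.2 h3.2.2.2
    · intro e u v h
      exact (st (∑ j, e j + u + v + 1)).2.deg e u v h
  refine ⟨natStr χ, rfl, hM, ?_⟩
  intro s i τ hτ hag
  by_cases hiso : ∀ j, j ≠ i → ¬ τ.rel j i
  · obtain ⟨k, hk, hfk⟩ := hf (s, i, τ) (∑ j, s j + 1)
    have hs : ∀ j, s j < k := fun j => by
      have := Finset.single_le_sum (f := s) (fun _ _ => Nat.zero_le _) (Finset.mem_univ j)
      omega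
    have hpull : ∀ (k' : ℕ) (s' : Fin (m + 3) → ℕ), (∀ j, s' j < k') →
        (natStr χ).pull s' = (natStr (st k').1).pull s' := by
      intro k' s' hs'
      refine Str.ext rfl ?_
      funext e u v
      exact hχ k' _ _ _ (fun j => hs' _) (hs' _) (hs' _)
    have hval := h3 k (st k)
    rw [hfk] at hval
    refine ⟨k, ?_⟩
    rw [hpull (k + 1), hst]
    · refine hval ⟨hτ, fun j _ => hs j, hiso, ?_⟩
      rwa [← hpull k s hs]
    · intro j
      by_cases hj : j = i
      · simp [hj]
      · simp only [hj, ne_eq, not_false_eq_true, Function.update_of_ne]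
        exact (hs j).trans (Nat.lt_succ_self _)
  -- If `τ` identifies `i` with another point `j`, the old point `s j` is a solution.
  · push Not at hiso
    obtain ⟨j, hji, hrel⟩ := hiso
    refine ⟨s j, ?_⟩
    have h1 : Function.update s i (s j) = s ∘ Function.update id i j := by
      funext a
      by_cases ha : a = i
      · simp [ha]
      · simp [ha]
    rw [h1, ← Str.pull_pull, ← hag.pull_eq, hτ.pull_update hrel]
    intro a
    by_cases ha : a = i
    · simp [ha, hji]
    · simp [ha]

end Rainbow

/-! ### Blurring is a bisimulation -/

namespace Rainbow

open Col

/-- Any map is reached from any other by changing one value at a time; used to walk from a constant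
tuple to a given one by cylindric moves. -/
theorem update_induction {ι α : Type*} [Fintype ι] [DecidableEq ι] {P : (ι → α) → Prop}
    {f : ι → α} (hf : P f) (h : ∀ f i x, P f → P (Function.update f i x)) (g : ι → α) : P g := by
  have key : ∀ S : Finset ι, P (S.piecewise g f) := by
    intro S
    induction S using Finset.induction_on with
    | empty => simpa using hf
    | insert j S _ ih =>
      rw [Finset.piecewise_insert]
      exact h _ _ _ ih
  simpa using key Finset.univ

variable {m : ℕ}

namespace Str

/-- Identify reds of level at least `N` with the limit red. -/
def blur {X : Type*} (N : ℕ) (S : Str m X) : Str m X := ⟨S.rel, fun e u v => Col.blur N (S.col e u v)⟩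

/-- The limit red does not occur. -/
def RhoFree {X : Type*} (S : Str m X) : Prop := ∀ e u v, S.col e u v ≠ rho

theorem blur_pull {X Y : Type*} (N : ℕ) (S : Str m X) (f : Y → X) :
    (S.pull f).blur N = (S.blur N).pull f := rfl

theorem blur_blur {X : Type*} {N N' : ℕ} (h : N ≤ N') (S : Str m X) :
    (S.blur N').blur N = S.blur N :=
  Str.ext rfl (by funext e u v; exact Col.blur_blur h _)

theorem blur_eq_mono {X : Type*} {N N' : ℕ} (h : N ≤ N') {S S' : Str m X}
    (hS : S.blur N' = S'.blur N') : S.blur N = S'.blur N := by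
  rw [← blur_blur h S, hS, blur_blur h]

theorem rel_of_blur_eq {X : Type*} {N : ℕ} {S S' : Str m X} (h : S.blur N = S'.blur N) :
    S.rel = S'.rel :=
  show (S.blur N).rel = (S'.blur N).rel by rw [h]

theorem col_of_blur_eq {X : Type*} {N : ℕ} {S S' : Str m X} (h : S.blur N = S'.blur N) (e u v) :
    Col.blur N (S.col e u v) = Col.blur N (S'.col e u v) :=
  show (S.blur N).col e u v = (S'.blur N).col e u v by rw [h]

open Classical in
/-- The colouring of one link in the lifting lemma. -/
theorem exists_link {a c : Str m (Fin (m + 3))} {i : Fin (m + 3)} {N : ℕ}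
    (hc : c.Good) (hEq : c.rel = Eq) (ha : ∀ e u v, a.col e u v = a.col e v u)
    (hblur : ∀ e u v, (∀ j, e j ≠ i) → u ≠ i → v ≠ i →
      Col.blur N (a.col e u v) = Col.blur N (c.col e u v))
    (hdeg : ∀ e u v, (∀ j, e j ≠ i) → u ≠ i → v ≠ i → ¬ ND Eq e u v → a.col e u v = w ∅)
    (e : Fin m → Fin (m + 3)) :
    ∃ f : Fin (m + 3) → Fin (m + 3) → Col, (∀ u v, f u v = f v u) ∧
      (∀ u v, ¬ ND Eq e u v → f u v = w ∅) ∧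
      (∀ u v t, ND Eq e u v → ND Eq e u t → ND Eq e v t → Allowed (f u v) (f v t) (f u t)) ∧
      (∀ u v, (∀ j, e j ≠ i) → u ≠ i → v ≠ i → f u v = a.col e u v) ∧
      (∀ u v, Col.blur N (f u v) = Col.blur N (c.col e u v)) ∧
      (a.RhoFree → ∀ u v, f u v ≠ rho) := by
  have hsymm : ∀ u v, ND Eq e u v ↔ ND Eq e v u := fun u v =>
    ND.comm ⟨fun _ => rfl, Eq.symm, Eq.trans⟩
  have hcdeg : ∀ u v, ¬ ND Eq e u v → c.col e u v = w ∅ := fun u v h =>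
    hc.deg e u v (by rwa [hEq])
  by_cases htri : ∃ u v t, ND Eq e u v ∧ ND Eq e u t ∧ ND Eq e v t
  -- The only triangle of the link is named so that `i` is its vertex `t`, unless `i` lies in `e`.
  -- In the former case `a` prescribes just the edge `u v`, and `Allowed.lift` applies; in the
  -- latter it prescribes nothing, and `Allowed.approx` applies.
  · have htri' : ∃ u v t, ND Eq e u v ∧ ND Eq e u t ∧ ND Eq e v t ∧ (i ∈ Set.range e ∨ t = i) := by
      obtain ⟨u, v, t, h1, h2, h3⟩ := htri
      rcases cover (by simp) (fun _ => rfl) h1 h2 h3 i with h | rfl | rfl | rfl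
      · exact ⟨u, v, t, h1, h2, h3, Or.inl h⟩
      · exact ⟨v, t, i, h3, (hsymm _ _).1 h1, (hsymm _ _).1 h2, Or.inr rfl⟩
      · exact ⟨u, t, i, h2, h1, (hsymm _ _).1 h3, Or.inr rfl⟩
      · exact ⟨u, v, i, h1, h2, h3, Or.inr rfl⟩
    obtain ⟨u, v, t, h1, h2, h3, hi⟩ := htri'
    have hcov := fun x => cover (by simp) (fun _ => rfl) h1 h2 h3 x
    have hcolors : ∃ α β γ, Allowed α β γ ∧ Col.blur N α = Col.blur N (c.col e u v) ∧
        Col.blur N β = Col.blur N (c.col e v t) ∧ Col.blur N γ = Col.blur N (c.col e u t) ∧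
        ((∀ j, e j ≠ i) → α = a.col e u v) ∧ (a.RhoFree → α ≠ rho ∧ β ≠ rho ∧ γ ≠ rho) := by
      have hall := hc.tri e u v t (by rwa [hEq]) (by rwa [hEq]) (by rwa [hEq])
      by_cases hie : i ∈ Set.range e
      · obtain ⟨α, β, γ, k1, k2, k3, k4, k5⟩ := hall.approx N
        exact ⟨α, β, γ, k1, k2, k3, k4, fun h => absurd hie (fun ⟨j, hj⟩ => h j hj), fun _ => k5⟩
      · obtain rfl : t = i := hi.resolve_left hie
        have hbl := hblur e u v (fun j hj => hie ⟨j, hj⟩) h2.2.2.2 h3.2.2.2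
        obtain ⟨β, γ, k1, k2, k3, k4⟩ := hall.lift hbl
        exact ⟨_, β, γ, k1, hbl, k2, k3, fun _ => rfl, fun h => ⟨h _ _ _, k4 (h _ _ _)⟩⟩
    obtain ⟨α, β, γ, k1, k2, k3, k4, k5, k6⟩ := hcolors
    have huv : u ≠ v := h1.2.2.2
    have hut : u ≠ t := h2.2.2.2
    have hvt : v ≠ t := h3.2.2.2
    let f : Fin (m + 3) → Fin (m + 3) → Col := fun x y =>
      if ¬ ND Eq e x y then w ∅ else if x ≠ t ∧ y ≠ t then α else if x ≠ u ∧ y ≠ u then β else γ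
    have hfs : ∀ x y, f x y = f y x := by
      intro x y
      simp only [f, hsymm x y, and_comm]
    have f1 : f u v = α := by simp [f, h1, hut, hvt]
    have f2 : f v t = β := by simp [f, h3, huv.symm, hut.symm]
    have f3 : f u t = γ := by simp [f, h2]
    have f1' : f v u = α := by rw [hfs, f1]
    have f2' : f t v = β := by rw [hfs, f2]
    have f3' : f t u = γ := by rw [hfs, f3]
    have hcase : ∀ x y, ND Eq e x y → (x = u ∧ y = v) ∨ (x = v ∧ y = u) ∨ (x = v ∧ y = t) ∨
        (x = t ∧ y = v) ∨ (x = u ∧ y = t) ∨ (x = t ∧ y = u) := by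
      intro x y h
      have hx := (hcov x).resolve_left (fun ⟨j, hj⟩ => h.2.1 j hj)
      have hy := (hcov y).resolve_left (fun ⟨j, hj⟩ => h.2.2.1 j hj)
      have hxy : x ≠ y := h.2.2.2
      rcases hx with rfl | rfl | rfl <;> rcases hy with rfl | rfl | rfl <;> simp_all
    refine ⟨f, hfs, fun x y h => by simp [f, h], ?_, ?_, ?_, ?_⟩
    · intro x y z hxy hxz hyz
      have d1 : x ≠ y := hxy.2.2.2
      have d2 : x ≠ z := hxz.2.2.2
      have d3 : y ≠ z := hyz.2.2.2
      rcases hcase x y hxy with ⟨hx, hy⟩ | ⟨hx, hy⟩ | ⟨hx, hy⟩ | ⟨hx, hy⟩ | ⟨hx, hy⟩ | ⟨hx, hy⟩ <;>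
      rcases (hcov z).resolve_left (fun ⟨j, hj⟩ => hxz.2.2.1 j hj) with hz | hz | hz <;>
      first
      | exact absurd (hx.trans hz.symm) d2
      | exact absurd (hy.trans hz.symm) d3
      | (simp only [hx, hy, hz, f1, f2, f3, f1', f2', f3']
         first
         | exact k1 | exact k1.rot | exact k1.rot.rot
         | exact k1.swap | exact k1.swap.rot | exact k1.swap.rot.rot)
    · intro x y he hx hy
      by_cases h : ND Eq e x y
      · have hti : t = i := hi.resolve_left (fun ⟨j, hj⟩ => he j hj)
        subst hti
        rcases hcase x y h with ⟨h1, h2⟩ | ⟨h1, h2⟩ | ⟨h1, h2⟩ | ⟨h1, h2⟩ | ⟨h1, h2⟩ | ⟨h1, h2⟩ <;>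
        first | exact absurd h1 hx | exact absurd h2 hy | skip
        · rw [h1, h2, f1, k5 he]
        · rw [h1, h2, f1', k5 he, ha]
      · rw [hdeg e x y he hx hy h]; simp [f, h]
    · intro x y
      by_cases h : ND Eq e x y
      · rcases hcase x y h with ⟨h1, h2⟩ | ⟨h1, h2⟩ | ⟨h1, h2⟩ | ⟨h1, h2⟩ | ⟨h1, h2⟩ | ⟨h1, h2⟩ <;>
        rw [h1, h2]
        · rw [f1, k2]
        · rw [f1', k2, hc.symm]
        · rw [f2, k3]
        · rw [f2', k3, hc.symm]
        · rw [f3, k4]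
        · rw [f3', k4, hc.symm]
      · rw [hcdeg x y h]; simp [f, h]
    · intro hr x y
      obtain ⟨r1, r2, r3⟩ := k6 hr
      simp only [f]
      split_ifs <;> first | assumption | simp
  -- With no triangle to respect, edges are coloured independently: by `a` away from `i`, by
  -- sharpening `c` elsewhere.
  · push Not at htri
    refine ⟨fun x y => if (∀ j, e j ≠ i) ∧ x ≠ i ∧ y ≠ i then a.col e x y
      else sharpen N (c.col e x y), ?_, ?_, ?_, ?_, ?_, ?_⟩
    · intro x y
      simp only [ha e x y, hc.symm e x y, and_comm]
    · intro x y h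
      dsimp only
      split_ifs with h'
      · exact hdeg e x y h'.1 h'.2.1 h'.2.2 h
      · rw [hcdeg x y h]; rfl
    · exact fun u v t h1 h2 h3 => absurd h3 (htri u v t h1 h2)
    · intro x y he hx hy
      exact if_pos ⟨he, hx, hy⟩
    · intro x y
      dsimp only
      split_ifs with h'
      · exact hblur e x y h'.1 h'.2.1 h'.2.2
      · exact blur_sharpen _ _
    · intro hr x y
      dsimp only
      split_ifs with h'
      · exact hr _ _ _
      · exact sharpen_ne_rho _ _

open Classical in
/-- The blurring is a bisimulation. -/
theorem lift {a b c : Str m (Fin (m + 3))} {i : Fin (m + 3)} {N : ℕ} (ha : a.Good) (hc : c.Good)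
    (hbc : AgreeOff i b c) (hab : a.blur N = b.blur N) :
    ∃ d : Str m (Fin (m + 3)), d.Good ∧ AgreeOff i a d ∧ d.blur N = c.blur N ∧
      (a.RhoFree → d.RhoFree) := by
  by_cases hiso : ∃ j, j ≠ i ∧ c.rel j i
  -- Here the move from `b` to `c` merely copies `j` onto `i`, and `a` can answer by the same
  -- copying.
  · obtain ⟨j, hji, hj⟩ := hiso
    have hσ : ∀ x, Function.update id i j x ≠ i := fun x => by
      by_cases hx : x = i <;> simp [hx, hji]
    refine ⟨a.pull (Function.update id i j), ha.pull _, ?_, ?_, fun h e u v => h _ _ _⟩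
    · have := agreeOff_pull a (f := id) (g := Function.update id i j) (i := i)
        (fun x hx => by simp [hx])
      rwa [pull_id] at this
    · rw [blur_pull, hab, ← blur_pull, hbc.pull_eq hσ, hc.pull_update hj]
  push Not at hiso
  have hrel : ∀ x y, x ≠ i → y ≠ i → (c.rel x y ↔ a.rel x y) := fun x y hx hy => by
    rw [rel_of_blur_eq hab]; exact (hbc.1 x y hx hy).symm
  have hblur : ∀ e u v, (∀ j, e j ≠ i) → u ≠ i → v ≠ i →
      Col.blur N (a.col e u v) = Col.blur N (c.col e u v) := fun e u v he hu hv => by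
    rw [col_of_blur_eq hab, hbc.2 e u v he hu hv]
  have hi : ∀ x y, c.rel x y → (x ≠ i ↔ y ≠ i) := by
    intro x y hxy
    constructor
    · rintro hx rfl; exact hiso x hx hxy
    · rintro hy rfl; exact hiso y hy (hc.equiv.symm hxy)
  have hnd : ∀ (e : Fin m → Fin (m + 3)) u v, (∀ j, e j ≠ i) → u ≠ i → v ≠ i → (ND c.rel e u v ↔ ND a.rel e u v) := by
    intro e u v he hu hv
    unfold ND
    simp only [hrel _ _ (he _) (he _), hrel _ _ (he _) hu, hrel _ _ (he _) hv, hrel _ _ hu hv]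
  by_cases hdisc : ∀ x y, c.rel x y → x = y
  · have hEq : c.rel = Eq := by
      funext x y
      exact propext ⟨hdisc x y, fun h => h ▸ hc.equiv.refl x⟩
    choose f f1 f2 f3 f4 f5 f6 using exists_link (a := a) (N := N) hc hEq ha.symm hblur
      (fun e u v he hu hv h => ha.deg e u v fun h' => h (by
        rw [← hEq]; exact (hnd e u v he hu hv).2 h'))
    refine ⟨⟨Eq, f⟩, ⟨⟨fun _ => rfl, Eq.symm, Eq.trans⟩, ?_, fun e => f1 e, fun e => f3 e,
      fun e => f2 e⟩, ⟨?_, ?_⟩, ?_, ?_⟩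
    · intro e e' u u' v v' h1 h2 h3
      rw [show e = e' from funext h1, show u = u' from h2, show v = v' from h3]
    · intro x y hx hy
      rw [← hrel x y hx hy, hEq]
    · intro e u v he hu hv
      exact (f4 e u v he hu hv).symm
    · refine Str.ext hEq.symm ?_
      funext e u v
      exact f5 e u v
    · intro hr e u v
      exact f6 e hr u v
  -- The kernel of `c` is nontrivial, so by counting no link has a triangle. The case split is
  -- compatible with the kernel because `i` is related only to itself.
  · let f : (Fin m → Fin (m + 3)) → Fin (m + 3) → Fin (m + 3) → Col := fun e u v =>
      if (∀ j, e j ≠ i) ∧ u ≠ i ∧ v ≠ i then a.col e u v else sharpen N (c.col e u v)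
    refine ⟨⟨c.rel, f⟩, ⟨hc.equiv, ?_, ?_, ?_, ?_⟩, ⟨?_, ?_⟩, ?_, ?_⟩
    · intro e e' u u' v v' h1 h2 h3
      have h1' : (∀ j, e j ≠ i) ↔ ∀ j, e' j ≠ i := forall_congr' fun j => hi _ _ (h1 j)
      have h2' := hi _ _ h2
      have h3' := hi _ _ h3
      change f e u v = f e' u' v'
      by_cases h : (∀ j, e j ≠ i) ∧ u ≠ i ∧ v ≠ i
      · have h' : (∀ j, e' j ≠ i) ∧ u' ≠ i ∧ v' ≠ i := by rwa [← h1', ← h2', ← h3']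
        simp only [f]
        rw [if_pos h, if_pos h']
        exact ha.congr _ _ _ _ _ _ (fun j => (hrel _ _ (h.1 j) (h'.1 j)).1 (h1 j))
          ((hrel _ _ h.2.1 h'.2.1).1 h2) ((hrel _ _ h.2.2 h'.2.2).1 h3)
      · have h' : ¬ ((∀ j, e' j ≠ i) ∧ u' ≠ i ∧ v' ≠ i) := by rwa [← h1', ← h2', ← h3']
        simp only [f]
        rw [if_neg h, if_neg h', hc.congr _ _ _ _ _ _ h1 h2 h3]
    · intro e u v
      simp only [f, ha.symm e u v, hc.symm e u v, and_comm]
    · intro e u v t h1 h2 h3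
      exfalso
      refine hdisc fun x y hxy => ?_
      have hcov := fun x => cover (by simp) hc.equiv.refl h1 h2 h3 x
      by_contra hne
      have hu : ∀ j, ¬ c.rel u (e j) := fun j h => h1.2.1 j (hc.equiv.symm h)
      have hv : ∀ j, ¬ c.rel v (e j) := fun j h => h1.2.2.1 j (hc.equiv.symm h)
      have ht : ∀ j, ¬ c.rel t (e j) := fun j h => h2.2.2.1 j (hc.equiv.symm h)
      have hvu : ¬ c.rel v u := fun h => h1.2.2.2 (hc.equiv.symm h)
      have htu : ¬ c.rel t u := fun h => h2.2.2.2 (hc.equiv.symm h)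
      have htv : ¬ c.rel t v := fun h => h3.2.2.2 (hc.equiv.symm h)
      rcases hcov x with ⟨j, rfl⟩ | rfl | rfl | rfl <;> rcases hcov y with ⟨k, rfl⟩ | rfl | rfl | rfl
      · exact hne (congrArg e (h1.1 j k hxy))
      · exact h1.2.1 j hxy
      · exact h1.2.2.1 j hxy
      · exact h2.2.2.1 j hxy
      · exact hu k hxy
      · exact hne rfl
      · exact h1.2.2.2 hxy
      · exact h2.2.2.2 hxy
      · exact hv k hxy
      · exact hvu hxy
      · exact hne rfl
      · exact h3.2.2.2 hxy
      · exact ht k hxy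
      · exact htu hxy
      · exact htv hxy
      · exact hne rfl
    · intro e u v h
      simp only [f]
      split_ifs with h'
      · exact ha.deg e u v fun h'' => h ((hnd e u v h'.1 h'.2.1 h'.2.2).2 h'')
      · rw [hc.deg e u v h]; rfl
    · exact fun x y hx hy => (hrel x y hx hy).symm
    · intro e u v he hu hv
      exact (if_pos ⟨he, hu, hv⟩).symm
    · refine Str.ext rfl ?_
      funext e u v
      change Col.blur N (f e u v) = _
      simp only [f]
      split_ifs with h'
      · exact hblur e u v h'.1 h'.2.1 h'.2.2
      · exact blur_sharpen _ _
    · intro hr e u v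
      change f e u v ≠ rho
      simp only [f]
      split_ifs with h'
      · exact hr _ _ _
      · exact sharpen_ne_rho _ _

/-- Pulling back along a constant function gives the trivial structure. -/
theorem Good.pull_const {X Y : Type*} {S : Str m X} {S' : Str m Y} (hS : S.Good) (hS' : S'.Good)
    {Z : Type*} (x : X) (y : Y) : S.pull (fun _ : Z => x) = S'.pull (fun _ : Z => y) := by
  refine Str.ext ?_ ?_
  · funext a b
    exact propext ⟨fun _ => hS'.equiv.refl y, fun _ => hS.equiv.refl x⟩
  · funext e u v
    exact (hS.deg _ _ _ fun h => h.2.2.2 (hS.equiv.refl x)).trans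
      (hS'.deg _ _ _ fun h => h.2.2.2 (hS'.equiv.refl y)).symm

theorem exists_rhoFree_good (m : ℕ) (X : Type*) [Inhabited X] : ∃ S : Str m X, S.Good ∧ S.RhoFree :=
  ⟨⟨fun _ _ => True, fun _ _ _ => w ∅⟩, ⟨⟨fun _ => trivial, fun _ => trivial, fun _ _ => trivial⟩,
    fun _ _ _ _ _ _ _ _ _ => rfl, fun _ _ _ => rfl, fun _ _ _ _ _ _ _ => allowed_white_white _,
    fun _ _ _ _ => rfl⟩, fun _ _ _ => by simp⟩

/-- Every structure is approximated by structures without limit reds. -/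
theorem Good.approx {S : Str m (Fin (m + 3))} (hS : S.Good) (N : ℕ) :
    ∃ S' : Str m (Fin (m + 3)), S'.Good ∧ S'.RhoFree ∧ S'.blur N = S.blur N := by
  have key : ∀ f : Fin (m + 3) → Fin (m + 3), ∃ S' : Str m (Fin (m + 3)), S'.Good ∧ S'.RhoFree ∧
      S'.blur N = (S.pull f).blur N := by
    -- Constant tuples look alike in all good structures, so the walk can begin without limit reds;
    -- `lift` keeps it that way at each move.
    refine update_induction (f := fun _ => 0) ?_ ?_
    · obtain ⟨T, hT, hT'⟩ := exists_rhoFree_good m (Fin (m + 3))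
      exact ⟨T.pull fun _ => 0, hT.pull _, fun e u v => hT' _ _ _, by rw [hT.pull_const hS 0 0]⟩
    · rintro f i x ⟨S', h1, h2, h3⟩
      obtain ⟨d, k1, -, k2, k3⟩ := lift (c := S.pull (Function.update f i x)) h1 (hS.pull _)
        (agreeOff_pull S (i := i) fun j hj => by simp [hj]) h3
      exact ⟨d, k1, k3 h2, k2⟩
  exact key id

end Str

end Rainbow

/-! ### Generalities on cylindric, set and complex algebras -/

namespace CylAlg

variable {n : ℕ}

namespace IsEmbedding

variable {A B : CylAlg.{u} n} {f : A → B} (hf : IsEmbedding f)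
include hf

theorem map_inf (x y : A) : f (x ⊓ y) = f x ⊓ f y := by
  rw [← compl_compl (x ⊓ y), compl_inf, hf.map_compl, hf.map_sup, hf.map_compl, hf.map_compl,
    compl_sup, compl_compl, compl_compl]

theorem map_bot : f ⊥ = ⊥ := by
  rw [← inf_compl_self (⊥ : A.carrier), hf.map_inf, hf.map_compl, inf_compl_self]

theorem map_top : f ⊤ = ⊤ := by
  rw [← compl_bot, hf.map_compl, hf.map_bot, compl_bot]

theorem le_iff {x y : A} : f x ≤ f y ↔ x ≤ y := by
  rw [← sup_eq_right, ← hf.map_sup, hf.injective.eq_iff, sup_eq_right]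

theorem isCA (hB : B.IsCA) : A.IsCA where
  cyl_bot i := hf.injective (by rw [hf.map_cyl, hf.map_bot, hB.cyl_bot])
  le_cyl i x := by rw [← hf.le_iff, hf.map_cyl]; exact hB.le_cyl i _
  cyl_inf_cyl i x y := hf.injective (by simp only [hf.map_cyl, hf.map_inf, hB.cyl_inf_cyl])
  cyl_comm i j x := hf.injective (by simp only [hf.map_cyl]; exact hB.cyl_comm i j _)
  diag_self i := hf.injective (by rw [hf.map_diag, hf.map_top, hB.diag_self])
  diag_eq i j k hi hj := hf.injective (by
    simp only [hf.map_cyl, hf.map_diag, hf.map_inf]; exact hB.diag_eq i j k hi hj)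
  cyl_diag_disjoint i j hij x := hf.injective (by
    simp only [hf.map_cyl, hf.map_diag, hf.map_inf, hf.map_compl, hf.map_bot]
    exact hB.cyl_diag_disjoint i j hij _)

end IsEmbedding

theorem IsEmbedding.comp {A B C : CylAlg.{u} n} {g : B → C} {f : A → B} (hg : IsEmbedding g)
    (hf : IsEmbedding f) : IsEmbedding (g ∘ f) where
  injective := hg.injective.comp hf.injective
  map_sup x y := by simp [hf.map_sup, hg.map_sup]
  map_compl x := by simp [hf.map_compl, hg.map_compl]
  map_cyl i x := by simp [hf.map_cyl, hg.map_cyl]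
  map_diag i j := by simp [hf.map_diag, hg.map_diag]

theorem setAlg_isCA (n : ℕ) (U : Type u) : (setAlg n U).IsCA where
  cyl_bot i := by
    apply Set.eq_empty_of_forall_notMem
    rintro s ⟨t, ht, -⟩
    exact ht
  le_cyl i X := fun s hs => ⟨s, hs, fun _ _ => rfl⟩
  cyl_inf_cyl i X Y := by
    apply Set.Subset.antisymm
    · rintro s ⟨t, ⟨ht, t', ht', h'⟩, h⟩
      exact ⟨⟨t, ht, h⟩, t', ht', fun j hj => (h' j hj).trans (h j hj)⟩
    · rintro s ⟨⟨t, ht, h⟩, t', ht', h'⟩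
      exact ⟨t, ⟨ht, t', ht', fun j hj => (h' j hj).trans (h j hj).symm⟩, h⟩
  cyl_comm i j X := by
    have key : ∀ i j : Fin n, ∀ X : Set (Fin n → U),
        (setAlg n U).cyl i ((setAlg n U).cyl j X) ≤ (setAlg n U).cyl j ((setAlg n U).cyl i X) := by
      rintro i j X s ⟨t, ⟨t', ht', h'⟩, h⟩
      by_cases hij : i = j
      · subst hij
        exact ⟨t, ⟨t', ht', h'⟩, h⟩
      · refine ⟨Function.update s j (t' j), ⟨t', ht', fun k hk => ?_⟩, fun k hk => by simp [hk]⟩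
        by_cases hkj : k = j
        · subst hkj; simp
        · simp [hkj, h' k hkj, h k hk]
    exact le_antisymm (key i j X) (key j i X)
  diag_self i := Set.eq_univ_of_forall fun s => rfl
  diag_eq i j k hi hj := by
    apply Set.Subset.antisymm
    · intro s (hs : s i = s j)
      refine ⟨Function.update s k (s i), ⟨?_, ?_⟩, fun l hl => by simp [hl]⟩
      · change Function.update s k (s i) i = Function.update s k (s i) k
        simp [hi.symm]
      · change Function.update s k (s i) k = Function.update s k (s i) j
        simp [hj.symm, hs]
    · rintro s ⟨t, ⟨h1, h2⟩, h⟩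
      change s i = s j
      rw [← h i hi.symm, ← h j hj.symm]
      exact Eq.trans h1 h2
  cyl_diag_disjoint i j hij X := by
    apply Set.eq_empty_of_forall_notMem
    rintro s ⟨⟨t, ⟨ht, htX⟩, h⟩, t', ⟨ht', htX'⟩, h'⟩
    apply htX'
    have : t' = t := by
      funext k
      by_cases hk : k = i
      · subst hk
        have e1 : t k = t j := ht
        have e2 : t' k = t' j := ht'
        rw [e1, e2, h j hij.symm, h' j hij.symm]
      · rw [h k hk, h' k hk]
    rw [this]
    exact htX

theorem inRCA_of_setAlg {A : CylAlg.{u} n} {U : Type u} {f : A → setAlg n U} (hf : IsEmbedding f) :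
    InRCA n A :=
  ⟨PUnit, fun _ => U, fun x _ => f x,
    { injective := fun _ _ h => hf.injective (congrFun h PUnit.unit)
      map_sup := fun _ _ => funext fun _ => hf.map_sup _ _
      map_compl := fun x => funext fun _ => hf.map_compl x
      map_cyl := fun i x => funext fun _ => hf.map_cyl i x
      map_diag := fun i j => funext fun _ => hf.map_diag i j }⟩

theorem prod_isCA {I : Type u} {F : I → CylAlg.{u} n} (h : ∀ a, (F a).IsCA) : (prod F).IsCA where
  cyl_bot i := funext fun a => (h a).cyl_bot i
  le_cyl i x := fun a => (h a).le_cyl i (x a)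
  cyl_inf_cyl i x y := funext fun a => (h a).cyl_inf_cyl i (x a) (y a)
  cyl_comm i j x := funext fun a => (h a).cyl_comm i j (x a)
  diag_self i := funext fun a => (h a).diag_self i
  diag_eq i j k hi hj := funext fun a => (h a).diag_eq i j k hi hj
  cyl_diag_disjoint i j hij x := funext fun a => (h a).cyl_diag_disjoint i j hij (x a)

/-- Representable algebras are subalgebras of neat reducts. -/
theorem InRCA.inSNr {A : CylAlg.{u} n} (hn : 0 < n) (h : InRCA n A) (k : ℕ) : InSNr n k A := by
  obtain ⟨I, U, f, hf⟩ := h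
  refine ⟨prod fun a => setAlg (n + k) (U a), prod_isCA fun a => setAlg_isCA _ _, ?_⟩
  let g : ∀ a, Set (Fin n → U a) → Set (Fin (n + k) → U a) := fun a X =>
    {s | s ∘ Fin.castAdd k ∈ X}
  have hne : ∀ (i : Fin n) (j : Fin k), Fin.castAdd k i ≠ Fin.natAdd n j := fun i j h => by
    have := congrArg Fin.val h
    simp at this
    omega
  have hg : ∀ a X j, (setAlg (n + k) (U a)).cyl (Fin.natAdd n j) (g a X) = g a X := by
    intro a X j
    apply Set.Subset.antisymm
    · rintro s ⟨t, ht, h⟩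
      have : s ∘ Fin.castAdd k = t ∘ Fin.castAdd k := funext fun i => (h _ (hne i j)).symm
      change s ∘ _ ∈ X
      rw [this]
      exact ht
    · exact fun s hs => ⟨s, hs, fun _ _ => rfl⟩
  refine ⟨fun x => ⟨fun a => g a (f x a), fun j => funext fun a => hg a _ j⟩, ?_, ?_, ?_, ?_, ?_⟩
  · intro x y hxy
    apply hf.injective
    funext a
    have h1 : g a (f x a) = g a (f y a) := congrFun (congrArg Subtype.val hxy) a
    refine Set.ext (α := Fin n → U a) fun s => ?_
    -- Any extension of `s` will do; `0 < n` supplies a value for the spare coordinates.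
    let t : Fin (n + k) → U a := fun i => if h : i.1 < n then s ⟨i.1, h⟩ else s ⟨0, hn⟩
    have hs : t ∘ Fin.castAdd k = s := by
      funext i
      simp [t]
    have := Set.ext_iff.1 h1 t
    simpa only [g, Set.mem_ofPred_eq, hs] using this
  · intro x y
    apply Subtype.ext
    funext a
    change g a (f (x ⊔ y) a) = _
    rw [hf.map_sup]
    rfl
  · intro x
    apply Subtype.ext
    funext a
    change g a (f xᶜ a) = _
    rw [hf.map_compl]
    rfl
  · intro i x
    apply Subtype.ext
    funext a
    change g a (f (A.cyl i x) a) = (setAlg (n + k) (U a)).cyl (Fin.castAdd k i) (g a (f x a))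
    rw [hf.map_cyl]
    change g a ((setAlg n (U a)).cyl i (f x a)) = _
    generalize f x a = X
    change Set (Fin n → U a) at X
    apply Set.Subset.antisymm
    · rintro s ⟨t, ht, h⟩
      refine ⟨Function.update s (Fin.castAdd k i) (t i), ?_, fun j hj => by simp [hj]⟩
      have : Function.update s (Fin.castAdd k i) (t i) ∘ Fin.castAdd k = t := ?_
      · change _ ∘ _ ∈ X
        rw [this]
        exact ht
      funext l
      by_cases hl : l = i
      · subst hl; simp
      · have : Fin.castAdd k l ≠ Fin.castAdd k i := fun h' => hl (Fin.castAdd_injective _ _ h')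
        simp [this, h l hl]
    · rintro s ⟨t, ht, h⟩
      exact ⟨t ∘ Fin.castAdd k, ht, fun j hj => h _ fun h' => hj (Fin.castAdd_injective _ _ h')⟩
  · intro i j
    apply Subtype.ext
    funext a
    change g a (f (A.diag i j) a) = _
    rw [hf.map_diag]
    rfl

/-- A complex algebra is a cylindric algebra if it has a cylindric subalgebra containing all
singletons. -/
theorem complexAlg_isCA {F : AtomStr.{u} n} (S : F.complexAlg.Sub)
    (hS : ∀ a : F.carrier, ({a} : Set F.carrier) ∈ S.carrier) (h : S.toAlg.IsCA) :
    F.complexAlg.IsCA := by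
  -- At singletons the axioms say that each `T i` is an equivalence relation and that these
  -- relations commute; the frame conditions then give the axioms for arbitrary sets.
  have refl : ∀ i a, F.T i a a := fun i a => by
    obtain ⟨b, rfl, hb⟩ := h.le_cyl i ⟨_, hS a⟩ (show a ∈ ({a} : Set F.carrier) from rfl)
    exact hb
  have key : ∀ i (a b c : F.carrier), (∃ d ∈ ({b} : Set F.carrier) ∩ {d | ∃ e ∈ ({c} : Set F.carrier),
      F.T i d e}, F.T i a d) ↔ ((∃ d ∈ ({b} : Set F.carrier), F.T i a d) ∧
        ∃ d ∈ ({c} : Set F.carrier), F.T i a d) := by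
    intro i a b c
    have := congrArg Subtype.val (h.cyl_inf_cyl i ⟨_, hS b⟩ ⟨_, hS c⟩)
    exact Set.ext_iff.1 this a
  have symm : ∀ i a b, F.T i a b → F.T i b a := by
    intro i a b hab
    obtain ⟨d, ⟨rfl, e, rfl, hd⟩, -⟩ := (key i a b a).2 ⟨⟨b, rfl, hab⟩, a, rfl, refl i a⟩
    exact hd
  have trans : ∀ i a b c, F.T i a b → F.T i b c → F.T i a c := by
    intro i a b c hab hbc
    obtain ⟨-, d, rfl, hd⟩ := (key i a b c).1 ⟨b, ⟨rfl, c, rfl, hbc⟩, hab⟩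
    exact hd
  have comm : ∀ i j a b c, F.T i a b → F.T j b c → ∃ d, F.T j a d ∧ F.T i d c := by
    intro i j a b c hab hbc
    have := congrArg Subtype.val (h.cyl_comm i j ⟨_, hS c⟩)
    obtain ⟨d, ⟨e, rfl, he⟩, hd⟩ := (Set.ext_iff.1 this a).1 ⟨b, ⟨c, rfl, hbc⟩, hab⟩
    exact ⟨d, hd, he⟩
  refine ⟨?_, ?_, ?_, ?_, ?_, ?_, ?_⟩
  · intro i
    apply Set.eq_empty_of_forall_notMem
    rintro s ⟨t, ht, -⟩
    exact ht
  · exact fun i X a ha => ⟨a, ha, refl i a⟩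
  · intro i X Y
    apply Set.Subset.antisymm
    · rintro a ⟨b, ⟨hb, c, hc, hbc⟩, hab⟩
      exact ⟨⟨b, hb, hab⟩, c, hc, trans _ _ _ _ hab hbc⟩
    · rintro a ⟨⟨b, hb, hab⟩, c, hc, hac⟩
      exact ⟨b, ⟨hb, c, hc, trans _ _ _ _ (symm _ _ _ hab) hac⟩, hab⟩
  · have key : ∀ i j (X : Set F.carrier), F.complexAlg.cyl i (F.complexAlg.cyl j X) ≤
        F.complexAlg.cyl j (F.complexAlg.cyl i X) := by
      rintro i j X a ⟨b, ⟨c, hc, hbc⟩, hab⟩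
      obtain ⟨d, hd, hd'⟩ := comm i j a b c hab hbc
      exact ⟨d, ⟨c, hc, hd'⟩, hd⟩
    exact fun i j X => le_antisymm (key i j X) (key j i X)
  · exact fun i => congrArg Subtype.val (h.diag_self i)
  · exact fun i j k hi hj => congrArg Subtype.val (h.diag_eq i j k hi hj)
  · intro i j hij X
    apply Set.eq_empty_of_forall_notMem
    rintro a ⟨⟨b, ⟨hb, hbX⟩, hab⟩, c, ⟨hc, hcX⟩, hac⟩
    have := congrArg Subtype.val (h.cyl_diag_disjoint i j hij ⟨_, hS b⟩)
    have h2 := (Set.ext_iff.1 this a).1 ⟨⟨b, ⟨hb, rfl⟩, hab⟩, c, ⟨hc, fun hcb => ?_⟩, hac⟩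
    · exact h2
    · obtain rfl : c = b := hcb
      exact hcX hbX

end CylAlg

/-! ### The blurred algebra and its representation -/

namespace Rainbow

open Col

variable {m : ℕ}

/-- The atom structure: consistent structures on `m + 3` points without limit reds. -/
def atoms (m : ℕ) : AtomStr.{0} (m + 3) where
  carrier := {S : Str m (Fin (m + 3)) // S.Good ∧ S.RhoFree}
  T i a b := Str.AgreeOff i a.1 b.1
  E i j a := a.1.rel i j

/-- Invariance under blurring the reds of level at least `N`. -/
def Inv (N : ℕ) (X : Set (atoms m).carrier) : Prop :=
  ∀ a b : (atoms m).carrier, a.1.blur N = b.1.blur N → a ∈ X → b ∈ X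

theorem Inv.mono {N N' : ℕ} (h : N ≤ N') {X : Set (atoms m).carrier} (hX : Inv N X) : Inv N' X :=
  fun a b hab ha => hX a b (Str.blur_eq_mono h hab) ha

theorem Inv.compl {N : ℕ} {X : Set (atoms m).carrier} (hX : Inv N X) : Inv N Xᶜ :=
  fun a b hab ha hb => ha (hX b a hab.symm hb)

/-- The algebra of all sets of atoms that are invariant under some blurring. -/
def blurSub (m : ℕ) : (atoms m).complexAlg.Sub where
  carrier := {X : Set (atoms m).carrier | ∃ N, Inv N X}
  supClosed' := by
    rintro X ⟨N, hX⟩ Y ⟨N', hY⟩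
    refine ⟨max N N', fun a b hab ha => ?_⟩
    rcases ha with ha | ha
    · exact Or.inl (hX.mono (le_max_left _ _) a b hab ha)
    · exact Or.inr (hY.mono (le_max_right _ _) a b hab ha)
  infClosed' := by
    rintro X ⟨N, hX⟩ Y ⟨N', hY⟩
    exact ⟨max N N', fun a b hab ha => ⟨hX.mono (le_max_left _ _) a b hab ha.1,
      hY.mono (le_max_right _ _) a b hab ha.2⟩⟩
  compl_mem' := by
    rintro X ⟨N, hX⟩
    exact ⟨N, hX.compl⟩
  bot_mem' := ⟨0, fun _ _ _ h => h⟩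
  cyl_mem := by
    rintro i X ⟨N, hX⟩
    refine ⟨N, ?_⟩
    rintro a b hab ⟨c, hc, hac⟩
    -- By bisimilarity cylindrification does not even raise the level `N`.
    obtain ⟨d, h1, h2, h3, h4⟩ := Str.lift b.2.1 c.2.1 hac hab.symm
    exact ⟨⟨d, h1, h4 b.2.2⟩, hX c _ h3.symm hc, h2⟩
  diag_mem i j := ⟨0, fun a b hab ha => by
    change b.1.rel i j
    rw [← Str.rel_of_blur_eq hab]
    exact ha⟩

theorem exists_level (S : Str m (Fin (m + 3))) : ∃ N, ∀ e u v l c, S.col e u v = r l c → l < N := by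
  let lev : Col → ℕ := fun c => match c with
    | r l _ => l + 1
    | _ => 0
  obtain ⟨N, hN⟩ := (Set.finite_range fun p : (Fin m → Fin (m + 3)) × Fin (m + 3) × Fin (m + 3) =>
    lev (S.col p.1 p.2.1 p.2.2)).bddAbove
  refine ⟨N, fun e u v l c h => ?_⟩
  have := hN ⟨(e, u, v), rfl⟩
  simp only [h, lev] at this
  omega

/-- An atom has finitely many colours and no `rho`, so a blur beyond all its levels identifies it
with no other atom. -/
theorem singleton_mem_blurSub (a : (atoms m).carrier) :
    ({a} : Set (atoms m).carrier) ∈ (blurSub m).carrier := by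
  obtain ⟨N, hN⟩ := exists_level a.1
  refine ⟨N, ?_⟩
  rintro _ b hab rfl
  refine Subtype.ext (Str.ext (Str.rel_of_blur_eq hab).symm ?_)
  funext e u v
  rename_i a
  rcases Col.blur_eq_iff (Str.col_of_blur_eq hab e u v) with h | ⟨h | ⟨l, c, hl, h⟩, -⟩
  · exact h.symm
  · exact absurd h (a.2.2 e u v)
  · exact absurd (hN _ _ _ _ _ h) (by omega)

/-- The representation of the blurred algebra over a homogeneous structure. -/
def repr (M : Str m ℕ) (X : Set (atoms m).carrier) : Set (Fin (m + 3) → ℕ) :=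
  {s | ∃ N, Inv N X ∧ ∃ a ∈ X, a.1.blur N = (M.pull s).blur N}

variable {M : Str m ℕ}

/-- The level is immaterial: the type of `s` may contain `rho`, but an atom shares its blur at the
larger of two levels, and invariance puts that atom into `X`. -/
theorem mem_repr_iff (hM : M.Good) {N : ℕ} {X : Set (atoms m).carrier} (hX : Inv N X)
    (s : Fin (m + 3) → ℕ) : s ∈ repr M X ↔ ∃ a ∈ X, a.1.blur N = (M.pull s).blur N := by
  refine ⟨?_, fun h => ⟨N, hX, h⟩⟩
  rintro ⟨N', hX', a, ha, h⟩
  obtain ⟨S, h1, h2, h3⟩ := Str.Good.approx (hM.pull s) (max N N')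
  refine ⟨⟨S, h1, h2⟩, ?_, Str.blur_eq_mono (le_max_left _ _) h3⟩
  exact hX' a _ (h.trans (Str.blur_eq_mono (le_max_right _ _) h3).symm) ha

theorem mem_repr_iff_forall (hM : M.Good) {N : ℕ} {X : Set (atoms m).carrier} (hX : Inv N X)
    (s : Fin (m + 3) → ℕ) :
    s ∈ repr M X ↔ ∀ a : (atoms m).carrier, a.1.blur N = (M.pull s).blur N → a ∈ X := by
  rw [mem_repr_iff hM hX]
  constructor
  · rintro ⟨a, ha, h⟩ b hb
    exact hX a b (h.trans hb.symm) ha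
  · intro h
    obtain ⟨S, h1, h2, h3⟩ := Str.Good.approx (hM.pull s) N
    exact ⟨⟨S, h1, h2⟩, h _ h3, h3⟩

/-- All structures on `m + 3` points are realized in a homogeneous structure. -/
theorem exists_realization (hM : M.Good)
    (hom : ∀ (s : Fin (m + 3) → ℕ) (i : Fin (m + 3)) (τ : Str m (Fin (m + 3))), τ.Good →
      Str.AgreeOff i τ (M.pull s) → ∃ x, M.pull (Function.update s i x) = τ)
    {S : Str m (Fin (m + 3))} (hS : S.Good) : ∃ s, M.pull s = S := by
  have key : ∀ f : Fin (m + 3) → Fin (m + 3), ∃ s : Fin (m + 3) → ℕ, M.pull s = S.pull f := by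
    refine update_induction (f := fun _ => 0) ⟨fun _ => 0, hM.pull_const hS 0 0⟩ ?_
    rintro f i x ⟨s, hs⟩
    obtain ⟨y, hy⟩ := hom s i (S.pull (Function.update f i x)) (hS.pull _) (by
      rw [hs]
      exact Str.agreeOff_pull S fun j hj => by simp [hj])
    exact ⟨_, hy⟩
  exact key id

/-- The blurred algebra. -/
abbrev blurAlg (m : ℕ) : CylAlg.{0} (m + 3) := (blurSub m).toAlg

/-- Injectivity holds because each atom is realized in `M`. Complements are respected since one atom
of the right blur lies in `X` iff all do. For cylindrifications, `Str.lift` carries witnesses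
between atoms and types of tuples, and homogeneity realizes the latter in `M`. -/
theorem repr_isEmbedding (hM : M.Good) (hEq : M.rel = Eq)
    (hom : ∀ (s : Fin (m + 3) → ℕ) (i : Fin (m + 3)) (τ : Str m (Fin (m + 3))), τ.Good →
      Str.AgreeOff i τ (M.pull s) → ∃ x, M.pull (Function.update s i x) = τ) :
    CylAlg.IsEmbedding (A := blurAlg m) (B := CylAlg.setAlg (m + 3) ℕ)
      (fun X => repr M X.1) where
  injective := by
    rintro ⟨X, N, hX⟩ ⟨Y, N', hY⟩ (hXY : repr M X = repr M Y)
    apply Subtype.ext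
    refine Set.ext fun a => ?_
    obtain ⟨s, hs⟩ := exists_realization hM hom a.2.1
    have key : ∀ (X : Set (atoms m).carrier) N, Inv N X → (s ∈ repr M X ↔ a ∈ X) := by
      intro X N hX
      constructor
      · intro h
        exact (mem_repr_iff_forall hM hX s).1 h a (by rw [hs])
      · intro h
        exact (mem_repr_iff hM hX s).2 ⟨a, h, by rw [hs]⟩
    rw [← key X N hX, ← key Y N' hY, hXY]
  map_sup := by
    rintro ⟨X, N, hX⟩ ⟨Y, N', hY⟩
    have hX' := hX.mono (le_max_left N N')
    have hY' := hY.mono (le_max_right N N')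
    have hXY : Inv (max N N') (X ∪ Y) := fun a b hab ha =>
      ha.imp (hX' a b hab) (hY' a b hab)
    refine Set.ext fun s => ?_
    change s ∈ repr M (X ∪ Y) ↔ s ∈ repr M X ∨ s ∈ repr M Y
    rw [mem_repr_iff hM hX', mem_repr_iff hM hY', mem_repr_iff hM hXY]
    constructor
    · rintro ⟨a, ha | ha, h⟩
      exacts [Or.inl ⟨a, ha, h⟩, Or.inr ⟨a, ha, h⟩]
    · rintro (⟨a, ha, h⟩ | ⟨a, ha, h⟩)
      exacts [⟨a, Or.inl ha, h⟩, ⟨a, Or.inr ha, h⟩]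
  map_compl := by
    rintro ⟨X, N, hX⟩
    refine Set.ext fun s => ?_
    change s ∈ repr M Xᶜ ↔ s ∉ repr M X
    rw [mem_repr_iff_forall hM hX.compl, mem_repr_iff hM hX]
    push Not
    exact ⟨fun h a ha hb => h a hb ha, fun h a hb ha => h a ha hb⟩
  map_cyl := by
    rintro i ⟨X, N, hX⟩
    have hX' := (blurSub m).cyl_mem i X ⟨N, hX⟩
    obtain ⟨N', hX'⟩ := hX'
    replace hX := hX.mono (le_max_left N N')
    replace hX' := hX'.mono (le_max_right N N')
    generalize max N N' = K at hX hX'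
    refine Set.ext fun s => ?_
    change s ∈ repr M ((atoms m).complexAlg.cyl i X) ↔ ∃ t ∈ repr M X, ∀ j, j ≠ i → t j = s j
    rw [mem_repr_iff hM hX']
    constructor
    · rintro ⟨a, ⟨b, hb, hab⟩, h⟩
      obtain ⟨d, h1, h2, h3, -⟩ := Str.lift (hM.pull s) b.2.1 hab h.symm
      obtain ⟨x, hx⟩ := hom s i d h1 h2.symm
      refine ⟨Function.update s i x, (mem_repr_iff hM hX _).2 ⟨b, hb, by rw [hx, h3]⟩,
        fun j hj => by simp [hj]⟩
    · rintro ⟨t, ht, hts⟩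
      obtain ⟨b, hb, h⟩ := (mem_repr_iff hM hX _).1 ht
      obtain ⟨d, h1, h2, h3, h4⟩ := Str.lift (c := M.pull s) (N := K) b.2.1 (hM.pull s)
        (Str.agreeOff_pull M hts) h
      exact ⟨⟨d, h1, h4 b.2.2⟩, ⟨b, hb, h2.symm⟩, h3⟩
  map_diag := by
    intro i j
    have h0 : Inv 0 {a : (atoms m).carrier | a.1.rel i j} := fun a b hab ha => by
      change b.1.rel i j
      rw [← Str.rel_of_blur_eq hab]
      exact ha
    refine Set.ext fun s => ?_
    change s ∈ repr M {a : (atoms m).carrier | a.1.rel i j} ↔ s i = s j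
    rw [mem_repr_iff hM h0]
    constructor
    · rintro ⟨a, ha, h⟩
      have ha : a.1.rel i j := ha
      rw [Str.rel_of_blur_eq h] at ha
      change M.rel _ _ at ha
      rwa [hEq] at ha
    · intro h
      obtain ⟨S, h1, h2, h3⟩ := Str.Good.approx (hM.pull s) 0
      refine ⟨⟨S, h1, h2⟩, ?_, h3⟩
      change S.rel i j
      rw [Str.rel_of_blur_eq h3]
      change M.rel _ _
      rwa [hEq]

theorem blurAlg_inRCA (m : ℕ) : CylAlg.InRCA (m + 3) (blurAlg m) := by
  obtain ⟨M, hEq, hM, hom⟩ := exists_homogeneous m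
  exact CylAlg.inRCA_of_setAlg (repr_isEmbedding hM hEq hom)

theorem blurAlg_isCA (m : ℕ) : (blurAlg m).IsCA := by
  obtain ⟨M, hEq, hM, hom⟩ := exists_homogeneous m
  exact (repr_isEmbedding hM hEq hom).isCA (CylAlg.setAlg_isCA _ _)

theorem complexAlg_atoms_isCA (m : ℕ) : (atoms m).complexAlg.IsCA :=
  CylAlg.complexAlg_isCA (blurSub m) singleton_mem_blurSub (blurAlg_isCA m)

end Rainbow

/-! ### Calculus of substitutions -/

namespace CylAlg

variable {n : ℕ}

/-- The substitution operator `s^i_j`. -/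
def sub (B : CylAlg.{u} n) (i j : Fin n) (x : B) : B := B.cyl i (B.diag i j ⊓ x)

namespace IsCA

variable {B : CylAlg.{u} n} (hB : B.IsCA)
include hB

theorem cyl_mono (i : Fin n) {x y : B} (h : x ≤ y) : B.cyl i x ≤ B.cyl i y := by
  have h1 := hB.cyl_inf_cyl i x y
  rw [inf_eq_left.2 (h.trans (hB.le_cyl i y))] at h1
  rw [h1]
  exact inf_le_right

theorem cyl_sup (i : Fin n) (x y : B) : B.cyl i (x ⊔ y) = B.cyl i x ⊔ B.cyl i y := by
  apply le_antisymm
  · rw [← hB.fixed_sup (hB.cyl_cyl i x) (hB.cyl_cyl i y)]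
    exact hB.cyl_mono i (sup_le_sup (hB.le_cyl i x) (hB.le_cyl i y))
  · exact sup_le (hB.cyl_mono i le_sup_left) (hB.cyl_mono i le_sup_right)

theorem cyl_inf_of_fixed {i : Fin n} {x y : B} (hy : B.cyl i y = y) :
    B.cyl i (x ⊓ y) = B.cyl i x ⊓ y := by
  conv_lhs => rw [← hy]
  rw [hB.cyl_inf_cyl, hy]

theorem cyl_diag {i j : Fin n} (h : i ≠ j) : B.cyl i (B.diag i j) = ⊤ := by
  have h1 := hB.diag_eq j j i h h
  rw [hB.diag_self] at h1
  exact top_le_iff.1 (h1 ▸ hB.cyl_mono i inf_le_right)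

theorem cyl_diag' {i j : Fin n} (h : i ≠ j) : B.cyl i (B.diag j i) = ⊤ := by
  have h1 := hB.diag_eq j j i h h
  rw [hB.diag_self] at h1
  exact top_le_iff.1 (h1 ▸ hB.cyl_mono i inf_le_left)

theorem sub_mono (i j : Fin n) {x y : B} (h : x ≤ y) : B.sub i j x ≤ B.sub i j y :=
  hB.cyl_mono i (inf_le_inf_left _ h)

theorem sub_sup (i j : Fin n) (x y : B) : B.sub i j (x ⊔ y) = B.sub i j x ⊔ B.sub i j y := by
  rw [sub, inf_sup_left, hB.cyl_sup]; rfl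

theorem sub_bot (i j : Fin n) : B.sub i j ⊥ = ⊥ := by
  rw [sub, inf_bot_eq, hB.cyl_bot]

theorem sub_inf {i j : Fin n} (hij : i ≠ j) (x y : B) :
    B.sub i j (x ⊓ y) = B.sub i j x ⊓ B.sub i j y := by
  apply le_antisymm
  · exact le_inf (hB.sub_mono i j inf_le_left) (hB.sub_mono i j inf_le_right)
  · have h1 : B.sub i j x = B.sub i j (x ⊓ y) ⊔ B.sub i j (x ⊓ yᶜ) := by
      rw [← hB.sub_sup, ← inf_sup_left, sup_compl_eq_top, inf_top_eq]
    have h2 : B.sub i j (x ⊓ yᶜ) ⊓ B.sub i j y ≤ ⊥ := by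
      have h3 := hB.cyl_diag_disjoint i j hij y
      rw [← h3, inf_comm]
      exact inf_le_inf_left _ (hB.sub_mono i j inf_le_right)
    rw [h1, inf_sup_right]
    exact sup_le inf_le_left (h2.trans bot_le)

theorem sub_of_free {i j : Fin n} (hij : i ≠ j) {x : B} (hx : B.cyl i x = x) : B.sub i j x = x := by
  rw [sub, hB.cyl_inf_of_fixed hx, hB.cyl_diag hij, top_inf_eq]

theorem cyl_sub (i j : Fin n) (x : B) : B.cyl i (B.sub i j x) = B.sub i j x := hB.cyl_cyl i _

theorem cyl_sub_of_free {i j k : Fin n} (hi : k ≠ i) (hj : k ≠ j) {x : B} (hx : B.cyl k x = x) :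
    B.cyl k (B.sub i j x) = B.sub i j x := by
  rw [sub, hB.cyl_comm, hB.cyl_inf_of_fixed hx, hB.fixed_diag hi hj]

/-- As `x` does not depend on `j`, that dimension merely stores the witness for `i`. -/
theorem cyl_sub_target {i j : Fin n} (hij : i ≠ j) {x : B} (hx : B.cyl j x = x) :
    B.cyl j (B.sub i j x) = B.cyl i x := by
  rw [sub, hB.cyl_comm, hB.cyl_inf_of_fixed hx, hB.cyl_diag' hij.symm, top_inf_eq]

/-- The dimension `l` is a mere relay, since `c_l (d_jl ⊓ d_la) = d_ja`. -/
theorem sub_sub {j l a : Fin n} (hjl : j ≠ l) (hja : j ≠ a) (hla : l ≠ a) {x : B}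
    (hx : B.cyl l x = x) : B.sub l a (B.sub j l x) = B.sub j a x := by
  have h1 : B.sub l a (B.sub j l x) = B.cyl l (B.cyl j (B.diag j l ⊓ B.diag l a ⊓ x)) := by
    rw [sub, sub, inf_comm, ← hB.cyl_inf_of_fixed (hB.fixed_diag hjl hja), inf_right_comm]
  rw [h1, hB.cyl_comm, hB.cyl_inf_of_fixed hx, ← hB.diag_eq j a l hjl.symm hla]
  rfl

theorem sub_comm {i a k b : Fin n} (hik : i ≠ k) (hib : i ≠ b) (hka : k ≠ a) (x : B) :
    B.sub i a (B.sub k b x) = B.sub k b (B.sub i a x) := by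
  have h1 : B.sub i a (B.sub k b x) = B.cyl i (B.cyl k (B.diag i a ⊓ (B.diag k b ⊓ x))) := by
    rw [inf_comm (B.diag i a), hB.cyl_inf_of_fixed (hB.fixed_diag hik.symm hka), inf_comm]
    rfl
  have h2 : B.sub k b (B.sub i a x) = B.cyl k (B.cyl i (B.diag k b ⊓ (B.diag i a ⊓ x))) := by
    rw [inf_comm (B.diag k b), hB.cyl_inf_of_fixed (hB.fixed_diag hik hib), inf_comm]
    rfl
  rw [h1, h2, hB.cyl_comm, inf_left_comm]

end IsCA

end CylAlg

/-! ### The obstruction to neat embeddings -/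

namespace Rainbow

open Col

/-- A binary relation for each set of colours, on three dimensions `D 0, D 1, D 2` of a cylindric
algebra with further dimensions `A 0, …, A 3`, subject to the laws of the rainbow colours. -/
structure RainbowRel {N : ℕ} (B : CylAlg.{u} N) (D : Fin 3 → Fin N) (A : Fin 4 → Fin N)
    (c : Fin 3 → Fin 3 → Set Col → B) : Prop where
  isCA : B.IsCA
  injD : Function.Injective D
  injA : Function.Injective A
  ne : ∀ i j, D i ≠ A j
  comm : ∀ j k S, c j k S = c k j S
  free : ∀ j k l S, l ≠ j → l ≠ k → B.cyl (D l) (c j k S) = c j k S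
  freeA : ∀ j k l S, B.cyl (A l) (c j k S) = c j k S
  subst : ∀ j k l S, j ≠ k → j ≠ l → k ≠ l → B.sub (D j) (D l) (c j k S) = c l k S
  green : ∀ i j, i ≠ j → c 0 2 {g i} ⊓ c 1 0 {g j} ≤ c 1 2 {x | ∀ S, x ≠ w S}
  yellow : c 1 2 {yel} ⊓ c 0 1 {yel} ⊓ c 0 2 {x | ∀ S, x ≠ w S} ≤ c 0 2 {x | IsRed x}
  red : ∀ s, c 0 2 {x | ∃ l, x = r l s} ⊓ c 1 2 {x | ∃ l, x = r l s} ⊓ c 0 1 {x | IsRed x} = ⊥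
  shade : c 1 2 {x | IsRed x} ≤ c 1 2 {x | ∃ l, x = r l 0} ⊔ c 1 2 {x | ∃ l, x = r l 1} ⊔
    c 1 2 {x | ∃ l, x = r l 2}
  witness : ∀ i, B.cyl (D 2) (c 0 1 {w Set.univ} ⊓ c 0 2 {g i} ⊓ c 1 2 {yel}) = c 0 1 {w Set.univ}
  ne_bot : c 0 1 {w Set.univ} ≠ ⊥

namespace RainbowRel

variable {N : ℕ} {B : CylAlg.{u} N} {D : Fin 3 → Fin N} {A : Fin 4 → Fin N}
  {c : Fin 3 → Fin 3 → Set Col → B} (h : RainbowRel B D A c)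
include h

theorem ne' {i j : Fin 3} (hij : i ≠ j) : D i ≠ D j := fun h' => hij (h.injD h')

/-- Once a vertex has moved to `A a`, the dimension it came from is forgotten. This lets the laws,
stated in fixed positions, be applied to all apexes. -/
theorem rename {j k l : Fin 3} (hjk : j ≠ k) (hjl : j ≠ l) (hkl : k ≠ l) (a : Fin 4) (S : Set Col) :
    B.sub (D l) (A a) (c l k S) = B.sub (D j) (A a) (c j k S) := by
  rw [← h.subst j k l S hjk hjl hkl, h.isCA.sub_sub (h.ne' hjl) (h.ne _ _) (h.ne _ _)
    (h.free j k l S hjl.symm hkl.symm)]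

/-- The `i`-th apex, in dimension `D 2`. -/
theorem exists_apexes : ∃ z : B, z ≠ ⊥ ∧ (z ≤ c 0 2 {g 0} ∧ z ≤ c 1 2 {yel}) ∧
    ∀ a : Fin 4, z ≤ B.sub (D 2) (A a) (c 0 2 {g a.succ}) ∧
      z ≤ B.sub (D 2) (A a) (c 1 2 {yel}) := by
  have hB := h.isCA
  let α : Fin 5 → B := fun i => c 0 1 {w Set.univ} ⊓ c 0 2 {g i} ⊓ c 1 2 {yel}
  have hα : ∀ i a, B.cyl (A a) (α i) = α i := fun i a =>
    hB.fixed_inf (hB.fixed_inf (h.freeA _ _ _ _) (h.freeA _ _ _ _)) (h.freeA _ _ _ _)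
  have hstep : ∀ (s : Finset (Fin 4)), ∃ z : B, z ≠ ⊥ ∧ z ≤ α 0 ∧
      (∀ a ∈ s, z ≤ B.sub (D 2) (A a) (α a.succ)) ∧ ∀ a ∉ s, B.cyl (A a) z = z := by
    intro s
    induction s using Finset.induction_on with
    | empty =>
      refine ⟨α 0, fun h0 => h.ne_bot ?_, le_rfl, by simp, fun a _ => hα 0 a⟩
      rw [← h.witness 0]
      change B.cyl _ (α 0) = ⊥
      rw [h0, hB.cyl_bot]
    | insert a s ha ih =>
      obtain ⟨z, hz, hz0, hzs, hzf⟩ := ih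
      refine ⟨z ⊓ B.sub (D 2) (A a) (α a.succ), ?_, inf_le_left.trans hz0, ?_, ?_⟩
      · intro h0
        apply hz
        -- The meet is nonzero: `z` is free of `A a`, so quantifying `A a` turns the meet into that
        -- of `z` with `c_{D 2}` of the apex element, and this is `z` by `witness`.
        have h1 := hB.cyl_inf_of_fixed (i := A a) (x := B.sub (D 2) (A a) (α a.succ)) (hzf a ha)
        rw [inf_comm, h0, hB.cyl_bot, hB.cyl_sub_target (h.ne _ _) (hα _ _)] at h1
        have h2 : B.cyl (D 2) (α a.succ) = c 0 1 {w Set.univ} := h.witness _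
        rw [h2, inf_eq_right.2 (hz0.trans (inf_le_left.trans inf_le_left))] at h1
        exact h1.symm
      · intro a' ha'
        rcases Finset.mem_insert.1 ha' with rfl | ha'
        · exact inf_le_right
        · exact inf_le_left.trans (hzs a' ha')
      · intro a' ha'
        rw [Finset.mem_insert, not_or] at ha'
        exact hB.fixed_inf (hzf a' ha'.2) (hB.cyl_sub_of_free (h.ne _ _).symm
          (fun h' => ha'.1 (h.injA h')) (hα _ _))
  obtain ⟨z, hz, hz0, hzs, -⟩ := hstep Finset.univ
  refine ⟨z, hz, ⟨hz0.trans (inf_le_left.trans inf_le_right), hz0.trans inf_le_right⟩, fun a => ?_⟩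
  have hza := hzs a (Finset.mem_univ a)
  exact ⟨hza.trans (hB.sub_mono _ _ (inf_le_left.trans inf_le_right)),
    hza.trans (hB.sub_mono _ _ inf_le_right)⟩

/-- Apex 0 stays in `D 2` and the apex of tint `a.succ` is in `A a`. Moving `D 1` to `A a` in
`green` shows that the edge between them is not white, and moving `D 0` to `A a` in `yellow` that it
is red. -/
theorem red_star (a : Fin 4) : (c 0 2 {g 0} ⊓ c 1 2 {yel}) ⊓ (B.sub (D 2) (A a) (c 0 2 {g a.succ}) ⊓
    B.sub (D 2) (A a) (c 1 2 {yel})) ≤ B.sub (D 1) (A a) (c 1 2 {x | IsRed x}) := by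
  have hB := h.isCA
  have h1 := hB.sub_mono (D 1) (A a) (h.green 0 a.succ (Fin.succ_ne_zero a).symm)
  rw [hB.sub_inf (h.ne _ _), hB.sub_of_free (h.ne _ _) (h.free 0 2 1 _ (by decide) (by decide)),
    h.rename (j := 2) (k := 0) (l := 1) (by decide) (by decide) (by decide), h.comm 2 0] at h1
  have h2 := hB.sub_mono (D 0) (A a) h.yellow
  rw [hB.sub_inf (h.ne _ _), hB.sub_inf (h.ne _ _),
    hB.sub_of_free (h.ne _ _) (h.free 1 2 0 _ (by decide) (by decide)),
    h.rename (j := 2) (k := 1) (l := 0) (by decide) (by decide) (by decide), h.comm 2 1,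
    h.rename (j := 1) (k := 2) (l := 0) (by decide) (by decide) (by decide),
    h.rename (j := 1) (k := 2) (l := 0) (by decide) (by decide) (by decide)] at h2
  refine le_trans (le_inf (le_inf ?_ ?_) (le_trans (le_inf ?_ ?_) h1)) h2
  · exact inf_le_left.trans inf_le_right
  · exact inf_le_right.trans inf_le_right
  · exact inf_le_left.trans inf_le_left
  · exact inf_le_right.trans inf_le_left

/-- The argument for `red_star` with apex 0 replaced by the one in `A a`, for which `D 2` is moved
too. -/
theorem red_pair {a b : Fin 4} (hab : a ≠ b) :
    (B.sub (D 2) (A a) (c 0 2 {g a.succ}) ⊓ B.sub (D 2) (A a) (c 1 2 {yel})) ⊓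
    (B.sub (D 2) (A b) (c 0 2 {g b.succ}) ⊓ B.sub (D 2) (A b) (c 1 2 {yel})) ≤
      B.sub (D 2) (A a) (B.sub (D 1) (A b) (c 1 2 {x | IsRed x})) := by
  have hB := h.isCA
  have h1 := hB.sub_mono (D 2) (A a) (hB.sub_mono (D 1) (A b)
    (h.green a.succ b.succ (fun h' => hab (Fin.succ_injective _ h'))))
  rw [hB.sub_inf (h.ne _ _), hB.sub_inf (h.ne _ _),
    hB.sub_of_free (h.ne _ _) (h.free 0 2 1 _ (by decide) (by decide)),
    h.rename (j := 2) (k := 0) (l := 1) (by decide) (by decide) (by decide), h.comm 2 0,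
    hB.sub_of_free (x := B.sub (D 2) (A b) _) (h.ne 2 a) (hB.cyl_sub _ _ _)] at h1
  have h2 := hB.sub_mono (D 2) (A a) (hB.sub_mono (D 0) (A b) h.yellow)
  rw [hB.sub_inf (h.ne _ _), hB.sub_inf (h.ne _ _), hB.sub_inf (h.ne _ _), hB.sub_inf (h.ne _ _),
    hB.sub_of_free (h.ne _ _) (h.free 1 2 0 _ (by decide) (by decide)),
    h.rename (j := 2) (k := 1) (l := 0) (by decide) (by decide) (by decide), h.comm 2 1,
    h.rename (j := 1) (k := 2) (l := 0) (by decide) (by decide) (by decide),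
    h.rename (j := 1) (k := 2) (l := 0) (by decide) (by decide) (by decide),
    hB.sub_of_free (x := B.sub (D 2) (A b) _) (h.ne 2 a) (hB.cyl_sub _ _ _)] at h2
  refine le_trans (le_inf (le_inf ?_ ?_) (le_trans (le_inf ?_ ?_) h1)) h2
  · exact inf_le_left.trans inf_le_right
  · exact inf_le_right.trans inf_le_right
  · exact inf_le_left.trans inf_le_left
  · exact inf_le_right.trans inf_le_left

/-- This is `red` with `D 0`, `D 1` moved to `A a`, `A b`, while `D 2` holds apex 0. -/
theorem red_triangle (a b : Fin 4) (s : Fin 3) :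
    B.sub (D 1) (A a) (c 1 2 {x | ∃ l, x = r l s}) ⊓ B.sub (D 1) (A b) (c 1 2 {x | ∃ l, x = r l s}) ⊓
      B.sub (D 2) (A a) (B.sub (D 1) (A b) (c 1 2 {x | IsRed x})) = ⊥ := by
  have hB := h.isCA
  have h1 := congrArg (fun x => B.sub (D 0) (A a) (B.sub (D 1) (A b) x)) (h.red s)
  rw [hB.sub_bot, hB.sub_bot, hB.sub_inf (h.ne _ _), hB.sub_inf (h.ne _ _), hB.sub_inf (h.ne _ _),
    hB.sub_inf (h.ne _ _), hB.sub_of_free (h.ne _ _) (h.free 0 2 1 _ (by decide) (by decide)),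
    h.rename (j := 1) (k := 2) (l := 0) (by decide) (by decide) (by decide),
    hB.sub_comm (h.ne' (by decide)) (h.ne _ _) (h.ne _ _),
    hB.sub_of_free (h.ne _ _) (h.free 1 2 0 _ (by decide) (by decide)),
    hB.sub_comm (h.ne' (by decide)) (h.ne _ _) (h.ne _ _),
    h.rename (j := 2) (k := 1) (l := 0) (by decide) (by decide) (by decide), h.comm 2 1,
    hB.sub_comm (h.ne' (by decide)) (h.ne _ _) (h.ne _ _)] at h1
  exact h1

/-- The element `z` is cut down to a nonzero part on which each of the four edges from apex 0 has a
definite shade. Two of the three shades coincide by pigeonhole, against `red_triangle`. -/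
theorem contradiction : False := by
  have hB := h.isCA
  obtain ⟨z, hz, hz0, hza⟩ := h.exists_apexes
  have hstar : ∀ a, z ≤ B.sub (D 1) (A a) (c 1 2 {x | IsRed x}) := fun a =>
    (le_inf (le_inf hz0.1 hz0.2) (le_inf (hza a).1 (hza a).2)).trans (h.red_star a)
  have hshade : ∀ z' ≤ z, z' ≠ ⊥ → ∀ a, ∃ s : Fin 3,
      z' ⊓ B.sub (D 1) (A a) (c 1 2 {x | ∃ l, x = r l s}) ≠ ⊥ := by
    intro z' hz' h0 a
    by_contra! hcon
    apply h0
    have h1 := (hz'.trans (hstar a)).trans (hB.sub_mono _ _ h.shade)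
    rw [hB.sub_sup, hB.sub_sup] at h1
    rw [← inf_eq_left.2 h1, inf_sup_left, inf_sup_left, hcon, hcon, hcon]
    simp
  have hchoice : ∀ T : Finset (Fin 4), ∃ (f : Fin 4 → Fin 3) (z' : B), z' ≤ z ∧ z' ≠ ⊥ ∧
      ∀ a ∈ T, z' ≤ B.sub (D 1) (A a) (c 1 2 {x | ∃ l, x = r l (f a)}) := by
    intro T
    induction T using Finset.induction_on with
    | empty => exact ⟨fun _ => 0, z, le_rfl, hz, by simp⟩
    | insert a T ha ih =>
      obtain ⟨f, z', h1, h2, h3⟩ := ih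
      obtain ⟨s, hs⟩ := hshade z' h1 h2 a
      refine ⟨Function.update f a s, _, inf_le_left.trans h1, hs, ?_⟩
      intro b hb
      rcases Finset.mem_insert.1 hb with rfl | hb
      · simp
      · have hba : b ≠ a := fun h' => ha (h' ▸ hb)
        rw [Function.update_of_ne hba]
        exact inf_le_left.trans (h3 b hb)
  obtain ⟨f, z', h1, h2, h3⟩ := hchoice Finset.univ
  obtain ⟨a, b, hab, hf⟩ := Fintype.exists_ne_map_eq_of_card_lt f (by simp)
  apply h2
  rw [← le_bot_iff, ← h.red_triangle a b (f a)]
  refine le_inf (le_inf (h3 a (Finset.mem_univ a)) ?_) ?_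
  · rw [hf]; exact h3 b (Finset.mem_univ b)
  · exact h1.trans ((le_inf (le_inf (hza a).1 (hza a).2) (le_inf (hza b).1 (hza b).2)).trans
      (h.red_pair hab))

end RainbowRel

end Rainbow

/-! ### Colour sets in the complex algebra and failure of neat embeddability -/

namespace Rainbow

open Col

variable {m : ℕ}

/-- The first `m` coordinates. -/
def ev : Fin m → Fin (m + 3) := Fin.castAdd 3

/-- The last three coordinates. -/
def pt (j : Fin 3) : Fin (m + 3) := Fin.natAdd m j

theorem ev_injective : Function.Injective (ev (m := m)) := Fin.castAdd_injective m 3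

theorem pt_injective : Function.Injective (pt (m := m)) := Fin.natAdd_injective 3 m

theorem ev_ne_pt (i : Fin m) (j : Fin 3) : ev i ≠ pt j := fun h => by
  have := congrArg Fin.val h
  simp [ev, pt] at this
  omega

theorem pt_ne {j k : Fin 3} (h : j ≠ k) : pt (m := m) j ≠ pt k := fun h' => h (pt_injective h')

theorem eq_ev_or_pt (x : Fin (m + 3)) : (∃ j, x = ev j) ∨ ∃ l, x = pt l := by
  revert x
  exact Fin.addCases (fun j => Or.inl ⟨j, rfl⟩) (fun l => Or.inr ⟨l, rfl⟩)

theorem nd_ev {j k : Fin 3} (h : j ≠ k) : ND Eq (ev (m := m)) (pt j) (pt k) :=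
  ⟨fun _ _ h => ev_injective h, fun i => ev_ne_pt i j, fun i => ev_ne_pt i k, pt_ne h⟩

/-- The atoms whose colour between the coordinates `j` and `k` over the first coordinates lies in
`S`. -/
def colSet (j k : Fin 3) (S : Set Col) : Set (atoms m).carrier :=
  {a | ND a.1.rel ev (pt j) (pt k) ∧ a.1.col ev (pt j) (pt k) ∈ S}

theorem colSet_comm (j k : Fin 3) (S : Set Col) : colSet (m := m) j k S = colSet k j S := by
  ext a
  simp only [colSet, Set.mem_ofPred_eq, ND.comm a.2.1.equiv (u := pt j), a.2.1.symm ev (pt j)]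

theorem Str.AgreeOff.nd_iff {X : Type*} {S S' : Str m X} {i : X} (h : Str.AgreeOff i S S')
    {e : Fin m → X} {u v : X} (he : ∀ j, e j ≠ i) (hu : u ≠ i) (hv : v ≠ i) :
    ND S.rel e u v ↔ ND S'.rel e u v := by
  unfold ND
  simp only [h.1 _ _ (he _) (he _), h.1 _ _ (he _) hu, h.1 _ _ (he _) hv, h.1 _ _ hu hv]

theorem mem_colSet_iff {j k l : Fin 3} (hj : l ≠ j) (hk : l ≠ k) {a b : (atoms m).carrier}
    (h : (atoms m).T (pt l) a b) (S : Set Col) : a ∈ colSet j k S ↔ b ∈ colSet j k S := by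
  have h1 : Str.AgreeOff (pt l) a.1 b.1 := h
  have h2 := h1.nd_iff (e := ev) (u := pt j) (v := pt k) (fun i => ev_ne_pt i l) (pt_ne hj.symm)
    (pt_ne hk.symm)
  have h3 := h1.2 ev (pt j) (pt k) (fun i => ev_ne_pt i l) (pt_ne hj.symm) (pt_ne hk.symm)
  simp only [colSet, Set.mem_ofPred_eq, h2, h3]

theorem mem_colSet_of_rel {j k l : Fin 3} {a : (atoms m).carrier} (h : a.1.rel (pt j) (pt l))
    (S : Set Col) : a ∈ colSet j k S ↔ a ∈ colSet l k S := by
  have hG := a.2.1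
  have h1 : ∀ x, a.1.rel x (pt j) ↔ a.1.rel x (pt l) := fun x =>
    ⟨fun h' => hG.equiv.trans h' h, fun h' => hG.equiv.trans h' (hG.equiv.symm h)⟩
  have h2 : ∀ x, a.1.rel (pt j) x ↔ a.1.rel (pt l) x := fun x =>
    ⟨fun h' => hG.equiv.trans (hG.equiv.symm h) h', fun h' => hG.equiv.trans h h'⟩
  have h3 : a.1.col ev (pt j) (pt k) = a.1.col ev (pt l) (pt k) :=
    hG.congr _ _ _ _ _ _ (fun _ => hG.equiv.refl _) h (hG.equiv.refl _)
  simp only [colSet, Set.mem_ofPred_eq, ND, h1, h2, h3]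

theorem cyl_colSet {j k l : Fin 3} (hj : l ≠ j) (hk : l ≠ k) (S : Set Col) :
    (atoms m).complexAlg.cyl (pt l) (colSet j k S) = colSet j k S := by
  apply Set.Subset.antisymm
  · rintro a ⟨b, hb, hab⟩
    exact (mem_colSet_iff hj hk hab S).2 hb
  · exact fun a ha => ⟨a, ha, Str.AgreeOff.refl _ _⟩

theorem sub_colSet {j k l : Fin 3} (hjk : j ≠ k) (hjl : j ≠ l) (S : Set Col) :
    (atoms m).complexAlg.sub (pt j) (pt l) (colSet j k S) = colSet l k S := by
  apply Set.Subset.antisymm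
  · rintro a ⟨b, ⟨hb, hb'⟩, hab⟩
    exact (mem_colSet_iff hjl hjk hab S).2 ((mem_colSet_of_rel hb S).1 hb')
  · intro a ha
    have hT := Str.agreeOff_pull a.1 (f := id) (g := Function.update id (pt j) (pt l)) (i := pt j)
      (fun x hx => by simp [hx])
    let b : (atoms m).carrier := ⟨a.1.pull (Function.update id (pt j) (pt l)), a.2.1.pull _,
      fun _ _ _ => a.2.2 _ _ _⟩
    have hb : b.1.rel (pt j) (pt l) := by
      change a.1.rel _ _
      have : pt (m := m) l ≠ pt j := pt_ne hjl.symm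
      simpa [this] using a.2.1.equiv.refl _
    refine ⟨b, ⟨hb, (mem_colSet_of_rel hb S).2 ?_⟩, hT⟩
    exact (mem_colSet_iff hjl hjk (b := b) hT S).1 ha

/-- The kernel is a congruence, so related points cannot have different colours towards a third. -/
theorem nd_of_col_ne {j k l : Fin 3} {a : (atoms m).carrier} (h : ND a.1.rel ev (pt j) (pt k))
    (h' : ND a.1.rel ev (pt j) (pt l)) (hne : a.1.col ev (pt j) (pt k) ≠ a.1.col ev (pt j) (pt l)) :
    ND a.1.rel ev (pt k) (pt l) :=
  ⟨h.1, h.2.2.1, h'.2.2.1, fun hr => hne (a.2.1.congr _ _ _ _ _ _ (fun _ => a.2.1.equiv.refl _)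
    (a.2.1.equiv.refl _) hr)⟩

theorem colSet_green {i j : Fin 5} (hij : i ≠ j) :
    colSet (m := m) 0 2 {g i} ∩ colSet 1 0 {g j} ⊆ colSet 1 2 {x | ∀ S, x ≠ w S} := by
  rintro a ⟨⟨h1, h2⟩, h3⟩
  rw [colSet_comm] at h3
  obtain ⟨h3, h4⟩ := h3
  have h2 : a.1.col ev (pt 0) (pt 2) = g i := h2
  have h4 : a.1.col ev (pt 0) (pt 1) = g j := h4
  have h5 := nd_of_col_ne h3 h1 (by rw [h2, h4]; simpa using hij.symm)
  refine ⟨h5, fun S hS => ?_⟩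
  have h6 := a.2.1.tri _ _ _ _ h3 h1 h5
  rw [h2, h4, hS] at h6
  simp only [Allowed, Rule] at h6
  tauto

theorem colSet_yellow : colSet (m := m) 1 2 {yel} ∩ colSet 0 1 {yel} ∩ colSet 0 2 {x | ∀ S, x ≠ w S} ⊆
    colSet 0 2 {x | IsRed x} := by
  rintro a ⟨⟨⟨h1, h2⟩, h3, h4⟩, h5, h6⟩
  have h2 : a.1.col ev (pt 1) (pt 2) = yel := h2
  have h4 : a.1.col ev (pt 0) (pt 1) = yel := h4
  have h6 : ∀ S, a.1.col ev (pt 0) (pt 2) ≠ w S := h6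
  refine ⟨h5, ?_⟩
  have h7 := a.2.1.tri _ _ _ _ h3 h5 h1
  rw [h2, h4] at h7
  change IsRed _
  generalize a.1.col ev (pt 0) (pt 2) = x at *
  cases x <;> simp_all [Allowed, Rule, IsRed]

theorem colSet_red (s : Fin 3) : colSet (m := m) 0 2 {x | ∃ l, x = r l s} ∩
    colSet 1 2 {x | ∃ l, x = r l s} ∩ colSet 0 1 {x | IsRed x} = ∅ := by
  apply Set.eq_empty_of_forall_notMem
  rintro a ⟨⟨⟨h1, h2⟩, h3, h4⟩, h5, h6⟩
  obtain ⟨l, h2⟩ : ∃ l, a.1.col ev (pt 0) (pt 2) = r l s := h2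
  obtain ⟨l', h4⟩ : ∃ l, a.1.col ev (pt 1) (pt 2) = r l s := h4
  have h6 : IsRed (a.1.col ev (pt 0) (pt 1)) := h6
  have h7 := a.2.1.tri _ _ _ _ h5 h1 h3
  rw [h2, h4] at h7
  generalize a.1.col ev (pt 0) (pt 1) = x at *
  cases x <;> simp_all [Allowed, Rule, IsRed]

/-- Atoms omit `rho`, so each red edge has one of three shades. Collecting a shade over all levels
is possible in the complex algebra but not in the blurred one. -/
theorem colSet_shade : colSet (m := m) 1 2 {x | IsRed x} ⊆ colSet 1 2 {x | ∃ l, x = r l 0} ∪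
    colSet 1 2 {x | ∃ l, x = r l 1} ∪ colSet 1 2 {x | ∃ l, x = r l 2} := by
  rintro a ⟨h1, h2⟩
  rcases isRed_cases h2 with h | ⟨l, k, h⟩
  · exact absurd h (a.2.2 _ _ _)
  · fin_cases k
    · exact Or.inl (Or.inl ⟨h1, l, h⟩)
    · exact Or.inl (Or.inr ⟨h1, l, h⟩)
    · exact Or.inr ⟨h1, l, h⟩

theorem allowed_whites (S S' S'' : Set (Fin 5)) : Allowed (w S) (w S') (w S'') := by
  simp [Allowed, Rule]

open Classical in
theorem colSet_nonempty : (colSet (m := m) 0 1 {w Set.univ}).Nonempty := by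
  let f : (Fin m → Fin (m + 3)) → Fin (m + 3) → Fin (m + 3) → Col := fun e u v =>
    if ND Eq e u v then w Set.univ else w ∅
  have hsymm : ∀ e u v, ND Eq (X := Fin (m + 3)) (m := m) e u v ↔ ND Eq e v u := fun e u v =>
    ND.comm ⟨fun _ => rfl, Eq.symm, Eq.trans⟩
  refine ⟨⟨⟨Eq, f⟩, ⟨⟨fun _ => rfl, Eq.symm, Eq.trans⟩, ?_, ?_, ?_, ?_⟩, ?_⟩, nd_ev (by decide), ?_⟩
  · intro e e' u u' v v' h1 h2 h3
    rw [show e = e' from funext h1, show u = u' from h2, show v = v' from h3]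
  · intro e u v
    simp only [f, hsymm e u v]
  · intro e u v t h1 h2 h3
    have k1 : f e u v = w Set.univ := if_pos h1
    have k2 : f e u t = w Set.univ := if_pos h2
    have k3 : f e v t = w Set.univ := if_pos h3
    change Allowed (f e u v) (f e v t) (f e u t)
    rw [k1, k2, k3]
    exact allowed_whites _ _ _
  · exact fun e u v h => if_neg h
  · intro e u v
    change f e u v ≠ rho
    simp only [f]
    split_ifs <;> simp
  · exact if_pos (nd_ev (by decide))

open Classical in
/-- Apexes of all tints exist over every base of the full white colour. -/
theorem exists_apex (i : Fin 5) {a : (atoms m).carrier} (ha : a ∈ colSet (m := m) 0 1 {w Set.univ}) :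
    ∃ b, b ∈ colSet 0 1 {w Set.univ} ∩ colSet 0 2 {g i} ∩ colSet 1 2 {yel} ∧
      (atoms m).T (pt 2) a b := by
  obtain ⟨hnd, hcol⟩ := ha
  have hcol : a.1.col ev (pt 0) (pt 1) = w Set.univ := hcol
  have hG := a.2.1
  have p01 : pt (m := m) 0 ≠ pt 1 := pt_ne (by decide)
  have p02 : pt (m := m) 0 ≠ pt 2 := pt_ne (by decide)
  have p12 : pt (m := m) 1 ≠ pt 2 := pt_ne (by decide)
  let P : (Fin m → Fin (m + 3)) → Fin (m + 3) → Fin (m + 3) → Prop :=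
    fun e u v => (∀ j, e j ≠ pt 2) ∧ u ≠ pt 2 ∧ v ≠ pt 2
  let f : (Fin m → Fin (m + 3)) → Fin (m + 3) → Fin (m + 3) → Col := fun e u v =>
    if P e u v then a.1.col e u v
    -- Only the two edges from the apex to the base get a proper colour; with the base they form an
    -- allowed triangle because the label `Set.univ` contains every tint.
    else if e = ev ∧ ((u = pt 0 ∧ v = pt 2) ∨ (u = pt 2 ∧ v = pt 0)) then g i
    else if e = ev ∧ ((u = pt 1 ∧ v = pt 2) ∨ (u = pt 2 ∧ v = pt 1)) then yel
    else w ∅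
  have hfs : ∀ e u v, f e u v = f e v u := by
    intro e u v
    simp only [f, P, hG.symm e u v, and_comm, or_comm]
  have f1 : f ev (pt 0) (pt 2) = g i := by simp [f, P]
  have f2 : f ev (pt 1) (pt 2) = yel := by simp [f, P, p01.symm, p12]
  have f3 : f ev (pt 0) (pt 1) = w Set.univ := by
    have : P ev (pt 0) (pt 1) := ⟨fun j => ev_ne_pt j 2, p02, p12⟩
    simp only [f]
    rw [if_pos this, hcol]
  have f4 : ∀ e u v, ¬ P e u v → e ≠ ev → f e u v = w ∅ := by
    intro e u v h he
    simp [f, h, he]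
  -- The points other than `pt 2` are those of `ev` and the two base points, which are pairwise
  -- unrelated.
  have hrelEq : ∀ x y, x ≠ pt 2 → y ≠ pt 2 → (a.1.rel x y ↔ x = y) := by
    intro x y hx hy
    refine ⟨fun h => ?_, fun h => h ▸ hG.equiv.refl x⟩
    have hl : ∀ l : Fin 3, pt (m := m) l ≠ pt 2 → l = 0 ∨ l = 1 := by
      intro l hl
      fin_cases l
      · exact Or.inl rfl
      · exact Or.inr rfl
      · exact absurd rfl hl
    rcases eq_ev_or_pt x with ⟨j, rfl⟩ | ⟨l, rfl⟩ <;> rcases eq_ev_or_pt y with ⟨k, rfl⟩ | ⟨l', rfl⟩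
    · exact congrArg ev (hnd.1 j k h)
    · rcases hl _ hy with rfl | rfl
      · exact absurd h (hnd.2.1 j)
      · exact absurd h (hnd.2.2.1 j)
    · rcases hl _ hx with rfl | rfl
      · exact absurd (hG.equiv.symm h) (hnd.2.1 k)
      · exact absurd (hG.equiv.symm h) (hnd.2.2.1 k)
    · rcases hl _ hx with rfl | rfl <;> rcases hl _ hy with rfl | rfl
      · rfl
      · exact absurd h hnd.2.2.2
      · exact absurd (hG.equiv.symm h) hnd.2.2.2
      · rfl
  have hndEq : ∀ e u v, P e u v → (ND a.1.rel e u v ↔ ND Eq e u v) := by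
    intro e u v hP
    unfold ND
    simp only [hrelEq _ _ (hP.1 _) (hP.1 _), hrelEq _ _ (hP.1 _) hP.2.1, hrelEq _ _ (hP.1 _) hP.2.2,
      hrelEq _ _ hP.2.1 hP.2.2]
  have hapex : ∀ e u v, (∀ j, e j ≠ pt 2) → ND Eq e u v → ND Eq e u (pt 2) → ND Eq e v (pt 2) →
      Allowed (f e u v) (f e v (pt 2)) (f e u (pt 2)) := by
    intro e u v he h1 h2 h3
    by_cases hev : e = ev
    · subst hev
      have hpt : ∀ x : Fin (m + 3), (∀ j : Fin m, ev j ≠ x) → x ≠ pt 2 → x = pt 0 ∨ x = pt 1 := by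
        intro x hx hx2
        rcases eq_ev_or_pt x with ⟨j, rfl⟩ | ⟨l, rfl⟩
        · exact absurd rfl (hx j)
        · fin_cases l
          · exact Or.inl rfl
          · exact Or.inr rfl
          · exact absurd rfl hx2
      rcases hpt u h2.2.1 h2.2.2.2 with rfl | rfl <;> rcases hpt v h3.2.1 h3.2.2.2 with rfl | rfl
      · exact absurd rfl h1.2.2.2
      · rw [f1, f2, f3]; simp [Allowed, Rule]
      · rw [hfs ev (pt 1) (pt 0), f1, f2, f3]; simp [Allowed, Rule]
      · exact absurd rfl h1.2.2.2
    · rw [f4 e v (pt 2) (fun h => h.2.2 rfl) hev, f4 e u (pt 2) (fun h => h.2.2 rfl) hev]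
      exact allowed_white_white _
  have hgood : (⟨Eq, f⟩ : Str m (Fin (m + 3))).Good := by
    refine ⟨⟨fun _ => rfl, Eq.symm, Eq.trans⟩, ?_, hfs, ?_, ?_⟩
    · intro e e' u u' v v' h1 h2 h3
      rw [show e = e' from funext h1, show u = u' from h2, show v = v' from h3]
    · intro e u v t h1 h2 h3
      change Allowed (f e u v) (f e v t) (f e u t)
      have hsymm : ∀ u v, ND Eq e u v → ND Eq e v u := fun u v =>
        (ND.comm ⟨fun _ => rfl, Eq.symm, Eq.trans⟩).1
      by_cases he : ∀ j, e j ≠ pt 2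
      · rcases cover (by simp) (fun _ => rfl) h1 h2 h3 (pt 2) with ⟨j, hj⟩ | h | h | h
        · exact absurd hj (he j)
        · subst h
          rw [hfs e (pt 2) v, hfs e (pt 2) t]
          exact (hapex e v t he h3 (hsymm _ _ h1) (hsymm _ _ h2)).rot.rot
        · subst h
          rw [hfs e (pt 2) t]
          exact (hapex e u t he h2 h1 (hsymm _ _ h3)).rot.swap
        · subst h
          exact hapex e u v he h1 h2 h3
      · have hev : e ≠ ev := by
          rintro rfl
          exact he fun j => ev_ne_pt j 2
        rw [f4 e u v (fun h => he h.1) hev, f4 e v t (fun h => he h.1) hev,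
          f4 e u t (fun h => he h.1) hev]
        exact allowed_white_white _
    · intro e u v h
      change f e u v = w ∅
      by_cases hP : P e u v
      · simp only [f]
        rw [if_pos hP]
        exact hG.deg e u v fun h' => h ((hndEq e u v hP).1 h')
      · simp only [f]
        rw [if_neg hP, if_neg, if_neg]
        · rintro ⟨rfl, ⟨rfl, rfl⟩ | ⟨rfl, rfl⟩⟩
          exacts [h (nd_ev (by decide)), h (nd_ev (by decide))]
        · rintro ⟨rfl, ⟨rfl, rfl⟩ | ⟨rfl, rfl⟩⟩
          exacts [h (nd_ev (by decide)), h (nd_ev (by decide))]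
  refine ⟨⟨⟨Eq, f⟩, hgood, ?_⟩, ⟨⟨⟨nd_ev (by decide), f3⟩, nd_ev (by decide), f1⟩,
    nd_ev (by decide), f2⟩, ⟨hrelEq, ?_⟩⟩
  · intro e u v
    change f e u v ≠ rho
    simp only [f]
    split_ifs
    · exact a.2.2 _ _ _
    all_goals simp
  · intro e u v he hu hv
    exact (if_pos ⟨he, hu, hv⟩).symm

theorem cyl_apex (i : Fin 5) : (atoms m).complexAlg.cyl (pt 2)
    (colSet 0 1 {w Set.univ} ∩ colSet 0 2 {g i} ∩ colSet 1 2 {yel} : Set (atoms m).carrier) =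
      colSet 0 1 {w Set.univ} := by
  apply Set.Subset.antisymm
  · rintro a ⟨b, ⟨⟨hb, -⟩, -⟩, hab⟩
    exact (mem_colSet_iff (by decide) (by decide) hab _).2 hb
  · intro a ha
    exact exists_apex i ha

/-- The complex algebra of the atom structure has no neat embedding into dimension `m + 3 + k`. -/
theorem not_inSNr {k : ℕ} (hk : 4 ≤ k) : ¬ CylAlg.InSNr (m + 3) k (atoms m).complexAlg := by
  rintro ⟨B, hB, f, hf⟩
  let φ : Set (atoms m).carrier → B := fun X => (f X).1
  have φ_inf : ∀ X Y, φ (X ∩ Y) = φ X ⊓ φ Y := fun X Y => congrArg Subtype.val (hf.map_inf X Y)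
  have φ_sup : ∀ X Y, φ (X ∪ Y) = φ X ⊔ φ Y := fun X Y => congrArg Subtype.val (hf.map_sup X Y)
  have φ_bot : φ ∅ = ⊥ := congrArg Subtype.val hf.map_bot
  have φ_mono : ∀ X Y, X ⊆ Y → φ X ≤ φ Y := fun X Y h => (hf.le_iff (x := X) (y := Y)).2 h
  have φ_cyl : ∀ i X, φ ((atoms m).complexAlg.cyl i X) = B.cyl (Fin.castAdd k i) (φ X) :=
    fun i X => congrArg Subtype.val (hf.map_cyl i X)
  have φ_diag : ∀ i j, φ ((atoms m).complexAlg.diag i j) =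
      B.diag (Fin.castAdd k i) (Fin.castAdd k j) := fun i j => congrArg Subtype.val (hf.map_diag i j)
  have φ_sub : ∀ i j (X : Set (atoms m).carrier), φ ((atoms m).complexAlg.sub i j X) =
      B.sub (Fin.castAdd k i) (Fin.castAdd k j) (φ X) := by
    intro i j X
    let Y : Set (atoms m).carrier := (atoms m).complexAlg.diag i j
    refine (φ_cyl i (Y ∩ X : Set (atoms m).carrier)).trans (congrArg (B.cyl _) ?_)
    exact (φ_inf Y X).trans (congrArg (· ⊓ φ X) (φ_diag i j))
  have φ_inj : Function.Injective φ := fun X Y h => hf.injective (Subtype.ext h)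
  have hne : ∀ (i : Fin (m + 3)) (j : Fin k), Fin.castAdd k i ≠ Fin.natAdd (m + 3) j := fun i j h => by
    have := congrArg Fin.val h
    simp at this
    omega
  -- The last three original dimensions hold the base and one apex, the first four spare dimensions
  -- the other apexes.
  refine RainbowRel.contradiction (B := B) (D := fun j => Fin.castAdd k (pt j))
    (A := fun j => Fin.natAdd (m + 3) (Fin.castLE hk j)) (c := fun j k S => φ (colSet j k S))
    ⟨hB, ?_, ?_, ?_, ?_, ?_, ?_, ?_, ?_, ?_, ?_, ?_, ?_, ?_⟩
  · exact (Fin.castAdd_injective _ _).comp pt_injective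
  · exact (Fin.natAdd_injective _ _).comp (Fin.castLE_injective hk)
  · exact fun i j => hne _ _
  · intro j k S
    simp only [colSet_comm j k]
  · intro j k l S hj hk
    exact (φ_cyl _ _).symm.trans (congrArg φ (cyl_colSet hj hk S))
  · exact fun j k l S => (f (colSet j k S)).2 _
  · intro j k l S hjk hjl _
    exact (φ_sub _ _ _).symm.trans (congrArg φ (sub_colSet hjk hjl S))
  · intro i j hij
    simp only [← φ_inf]
    exact φ_mono _ _ (colSet_green hij)
  · simp only [← φ_inf]
    exact φ_mono _ _ colSet_yellow
  · intro s
    simp only [← φ_inf]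
    rw [colSet_red, φ_bot]
  · simp only [← φ_sup]
    exact φ_mono _ _ colSet_shade
  · intro i
    simp only [← φ_inf]
    exact (φ_cyl _ _).symm.trans (congrArg φ (cyl_apex i))
  · intro h
    have := φ_inj (h.trans φ_bot.symm)
    exact colSet_nonempty.ne_empty this

end Rainbow

/-! ### Failure of complete square representations -/

namespace Rainbow

open Col

variable {m : ℕ}

/-- The tuple with first coordinates `x` and last coordinates `p`, `q`, `t`. -/
def tup {M : Type*} (x : Fin m → M) (p q t : M) : Fin (m + 3) → M := Fin.append x ![p, q, t]

section tup

variable {M : Type*} (x : Fin m → M) (p q t : M)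

@[simp] theorem tup_ev (i : Fin m) : tup x p q t (ev i) = x i := Fin.append_left _ _ _

@[simp] theorem tup_pt_zero : tup x p q t (pt 0) = p := Fin.append_right _ _ 0

@[simp] theorem tup_pt_one : tup x p q t (pt 1) = q := Fin.append_right _ _ 1

@[simp] theorem tup_pt_two : tup x p q t (pt 2) = t := Fin.append_right _ _ 2

theorem tup_self (s : Fin (m + 3) → M) : tup (s ∘ ev) (s (pt 0)) (s (pt 1)) (s (pt 2)) = s := by
  funext i
  rcases eq_ev_or_pt i with ⟨j, rfl⟩ | ⟨l, rfl⟩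
  · simp
  · fin_cases l <;> simp

end tup

/-- A typing of the tuples of `C` by atoms. -/
structure Typing {C : Type*} (ty : (Fin (m + 3) → C) → (atoms m).carrier) : Prop where
  agree : ∀ i s s', (∀ j, j ≠ i → s j = s' j) → (atoms m).T i (ty s) (ty s')
  rel : ∀ s i j, s i = s j → (ty s).1.rel i j

namespace Typing

variable {C : Type*} {ty : (Fin (m + 3) → C) → (atoms m).carrier} (h : Typing ty)
include h

theorem free_zero (x : Fin m → C) (p q t p' : C) (S : Set Col) :
    ty (tup x p q t) ∈ colSet 1 2 S ↔ ty (tup x p' q t) ∈ colSet 1 2 S := by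
  refine mem_colSet_iff (l := 0) (by decide) (by decide) (h.agree _ _ _ fun j hj => ?_) S
  rcases eq_ev_or_pt j with ⟨j, rfl⟩ | ⟨l, rfl⟩
  · simp
  · fin_cases l <;> first | simp; done | exact absurd rfl hj

theorem free_one (x : Fin m → C) (p q t q' : C) (S : Set Col) :
    ty (tup x p q t) ∈ colSet 0 2 S ↔ ty (tup x p q' t) ∈ colSet 0 2 S := by
  refine mem_colSet_iff (l := 1) (by decide) (by decide) (h.agree _ _ _ fun j hj => ?_) S
  rcases eq_ev_or_pt j with ⟨j, rfl⟩ | ⟨l, rfl⟩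
  · simp
  · fin_cases l <;> first | simp; done | exact absurd rfl hj

theorem free_two (x : Fin m → C) (p q t t' : C) (S : Set Col) :
    ty (tup x p q t) ∈ colSet 0 1 S ↔ ty (tup x p q t') ∈ colSet 0 1 S := by
  refine mem_colSet_iff (l := 2) (by decide) (by decide) (h.agree _ _ _ fun j hj => ?_) S
  rcases eq_ev_or_pt j with ⟨j, rfl⟩ | ⟨l, rfl⟩
  · simp
  · fin_cases l <;> first | simp; done | exact absurd rfl hj

/-- With `t` in both of the last positions, these coordinates are related and the edge can be read
at either. -/
theorem mem_zero_two (x : Fin m → C) (p q t r : C) (S : Set Col) :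
    ty (tup x p q t) ∈ colSet 0 2 S ↔ ty (tup x p t r) ∈ colSet 0 1 S := by
  rw [h.free_one x p q t t, h.free_two x p t r t, colSet_comm 0 2, colSet_comm 0 1]
  exact mem_colSet_of_rel (h.rel _ (pt 2) (pt 1) (by simp)) S

theorem mem_one_two (x : Fin m → C) (p q t r : C) (S : Set Col) :
    ty (tup x p q t) ∈ colSet 1 2 S ↔ ty (tup x q t r) ∈ colSet 0 1 S := by
  rw [h.free_zero x p q t q, ← h.mem_zero_two x q q t r]
  exact mem_colSet_of_rel (h.rel _ (pt 1) (pt 0) (by simp)) S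

theorem mem_swap (x : Fin m → C) (p q t : C) (S : Set Col) :
    ty (tup x p q t) ∈ colSet 0 1 S ↔ ty (tup x q p t) ∈ colSet 0 1 S := by
  rw [h.free_two x p q t p, ← h.mem_one_two x p q p t, colSet_comm 1 2]
  exact mem_colSet_of_rel (h.rel _ (pt 0) (pt 2) (by simp)) S

/-- Five apexes of different tints over the same base are impossible. -/
theorem false_of_apexes (x : Fin m → C) (u v : C) (b : Fin 5 → C)
    (hb : ∀ i, ty (tup x u v (b i)) ∈ colSet 0 2 {g i} ∩ colSet 1 2 {yel}) : False := by
  have hg : ∀ i t, ty (tup x u (b i) t) ∈ colSet 0 1 {g i} := fun i t =>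
    (h.mem_zero_two x u v (b i) t _).1 (hb i).1
  have hy : ∀ i t, ty (tup x v (b i) t) ∈ colSet 0 1 {yel} := fun i t =>
    (h.mem_one_two x u v (b i) t _).1 (hb i).2
  have hred : ∀ i j, i ≠ j → ∀ t, ty (tup x (b j) (b i) t) ∈ colSet 0 1 {c | IsRed c} := by
    intro i j hij t
    have h1 : ty (tup x u (b j) (b i)) ∈ colSet 1 2 {c | ∀ S, c ≠ w S} :=
      colSet_green hij ⟨(h.mem_zero_two _ _ _ _ v _).2 (hg i v), by
        rw [colSet_comm]; exact hg j _⟩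
    refine (h.mem_zero_two _ _ v _ _ _).1 (colSet_yellow ⟨⟨?_, ?_⟩, ?_⟩)
    · exact (h.mem_one_two _ _ _ _ u _).2 (hy i u)
    · exact (h.mem_swap _ _ _ _ _).1 (hy j _)
    · exact (h.mem_zero_two _ _ _ _ u _).2 ((h.mem_one_two _ _ _ _ _ _).1 h1)
  have hshade : ∀ j : Fin 4, ∃ s : Fin 3, ∀ t,
      ty (tup x (b j.succ) (b 0) t) ∈ colSet 0 1 {c | ∃ l, c = r l s} := by
    intro j
    have h1 := hred 0 j.succ (Fin.succ_ne_zero j).symm u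
    rcases colSet_shade ((h.mem_one_two x u _ _ u _).2 h1) with (h2 | h2) | h2
    · exact ⟨0, fun t => (h.mem_one_two _ _ _ _ _ _).1 h2⟩
    · exact ⟨1, fun t => (h.mem_one_two _ _ _ _ _ _).1 h2⟩
    · exact ⟨2, fun t => (h.mem_one_two _ _ _ _ _ _).1 h2⟩
  choose f hf using hshade
  obtain ⟨i, j, hij, hfij⟩ := Fintype.exists_ne_map_eq_of_card_lt f (by simp)
  have h1 : ty (tup x (b i.succ) (b j.succ) (b 0)) ∈ colSet (m := m) 0 2 {c | ∃ l, c = r l (f i)} ∩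
      colSet 1 2 {c | ∃ l, c = r l (f i)} ∩ colSet 0 1 {c | IsRed c} := by
    refine ⟨⟨?_, ?_⟩, ?_⟩
    · exact (h.mem_zero_two _ _ _ _ u _).2 (hf i u)
    · rw [hfij]
      exact (h.mem_one_two _ _ _ _ u _).2 (hf j u)
    · exact hred _ _ (fun h' => hij (Fin.succ_injective _ h').symm) _
  rw [colSet_red] at h1
  exact h1

end Typing

/-- The set of atoms underlying an element of the blurred algebra. -/
def els (X : blurAlg m) : Set (atoms m).carrier := X.1

/-- The atom given by the singleton of `a`. -/
def single (a : (atoms m).carrier) : blurAlg m :=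
  ⟨({a} : Set (atoms m).carrier), singleton_mem_blurSub a⟩

theorem isLUB_single : IsLUB (Set.range (single (m := m))) ⊤ := by
  refine ⟨fun _ _ => le_top, fun X hX => ?_⟩
  intro a _
  have h : els (single a) ⊆ els X := hX ⟨a, rfl⟩
  exact h (Set.mem_singleton a)

section RelRep

variable {R : RelRep (blurAlg m)}

theorem sat_mono {X Y : blurAlg m} (h : X ≤ Y) {s : Fin (m + 3) → R.M} (hs : R.Sat X s) :
    R.Sat Y s := by
  obtain ⟨x, hx, rfl⟩ := hs
  exact ⟨x, (R.embedding.le_iff (x := X) (y := Y)).2 h hx, rfl⟩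

theorem Sat.mem_V {X : blurAlg m} {s : Fin (m + 3) → R.M} (hs : R.Sat X s) : s ∈ R.V := by
  obtain ⟨x, -, rfl⟩ := hs
  exact x.2

theorem sat_inf {X Y : blurAlg m} {s : Fin (m + 3) → R.M} (hX : R.Sat X s) (hY : R.Sat Y s) :
    R.Sat (X ⊓ Y) s := by
  obtain ⟨x, hx, rfl⟩ := hX
  obtain ⟨y, hy, hxy⟩ := hY
  obtain rfl := Subtype.ext hxy
  refine ⟨y, ?_, rfl⟩
  rw [R.embedding.map_inf]
  exact ⟨hx, hy⟩

theorem not_sat_bot (s : Fin (m + 3) → R.M) : ¬ R.Sat ⊥ s := by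
  rintro ⟨x, hx, -⟩
  rw [R.embedding.map_bot] at hx
  exact hx

theorem sat_top {s : Fin (m + 3) → R.M} (hs : s ∈ R.V) : R.Sat ⊤ s := by
  refine ⟨⟨s, hs⟩, ?_, rfl⟩
  rw [R.embedding.map_top]
  trivial

theorem sat_cyl {X : blurAlg m} {i : Fin (m + 3)} {s : Fin (m + 3) → R.M} :
    R.Sat ((blurAlg m).cyl i X) s ↔ s ∈ R.V ∧ ∃ t, R.Sat X t ∧ ∀ j, j ≠ i → t j = s j := by
  unfold RelRep.Sat
  rw [R.embedding.map_cyl]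
  constructor
  · rintro ⟨x, ⟨t, ht, h⟩, rfl⟩
    exact ⟨x.2, t.1, ⟨t, ht, rfl⟩, h⟩
  · rintro ⟨hs, _, ⟨t, ht, rfl⟩, h⟩
    exact ⟨⟨s, hs⟩, ⟨t, ht, h⟩, rfl⟩

theorem sat_diag {i j : Fin (m + 3)} {s : Fin (m + 3) → R.M} :
    R.Sat ((blurAlg m).diag i j) s ↔ s ∈ R.V ∧ s i = s j := by
  unfold RelRep.Sat
  rw [R.embedding.map_diag]
  constructor
  · rintro ⟨x, hx, rfl⟩
    exact ⟨x.2, hx⟩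
  · rintro ⟨hs, h⟩
    exact ⟨⟨s, hs⟩, h, rfl⟩

theorem mem_of_sat {X : blurAlg m} {a : (atoms m).carrier} {s : Fin (m + 3) → R.M}
    (ha : R.Sat (single a) s) (hX : R.Sat X s) : a ∈ els X := by
  by_contra h
  have h1 : els (single a ⊓ X) ⊆ els ⊥ := by
    rintro b ⟨rfl, hb⟩
    exact h hb
  exact not_sat_bot s (sat_mono h1 (sat_inf ha hX))

theorem sat_of_mem {X : blurAlg m} {a : (atoms m).carrier} {s : Fin (m + 3) → R.M}
    (ha : R.Sat (single a) s) (hX : a ∈ els X) : R.Sat X s :=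
  sat_mono (show els (single a) ⊆ els X by rintro b rfl; exact hX) ha

/-- The singletons have supremum 1, and completeness preserves it. -/
theorem exists_type (hR : R.IsComplete) {s : Fin (m + 3) → R.M} (hs : s ∈ R.V) :
    ∃ a, R.Sat (single a) s := by
  obtain ⟨_, ⟨a, rfl⟩, h⟩ := (hR _ _ isLUB_single s).1 (sat_top hs)
  exact ⟨a, h⟩

theorem T_of_agree {a b : (atoms m).carrier} {s t : Fin (m + 3) → R.M} {i : Fin (m + 3)}
    (ha : R.Sat (single a) s) (hb : R.Sat (single b) t) (h : ∀ j, j ≠ i → s j = t j) :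
    (atoms m).T i a b := by
  obtain ⟨c, rfl, hc⟩ := mem_of_sat ha
    (sat_cyl.2 ⟨Sat.mem_V ha, t, hb, fun j hj => (h j hj).symm⟩)
  exact hc

theorem rel_of_eq {a : (atoms m).carrier} {s : Fin (m + 3) → R.M} {i j : Fin (m + 3)}
    (ha : R.Sat (single a) s) (h : s i = s j) : a.1.rel i j :=
  mem_of_sat ha (sat_diag.2 ⟨Sat.mem_V ha, h⟩)

/-- The identity `c_i d_ij = 1` must hold in `V`, which is therefore closed under copying
coordinates. -/
theorem update_mem_V {s : Fin (m + 3) → R.M} (hs : s ∈ R.V) (i j : Fin (m + 3)) :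
    Function.update s i (s j) ∈ R.V := by
  by_cases hij : i = j
  · subst hij; simpa using hs
  have h := sat_top hs
  rw [← (blurAlg_isCA m).cyl_diag hij, sat_cyl] at h
  obtain ⟨-, t, ht, h⟩ := h
  rw [sat_diag] at ht
  have : t = Function.update s i (s j) := by
    funext l
    by_cases hl : l = i
    · subst hl
      simp [ht.2, h j (Ne.symm hij)]
    · simp [hl, h l hl]
  exact this ▸ ht.1

theorem const_mem_V {s : Fin (m + 3) → R.M} (hs : s ∈ R.V) : (fun _ => s 0) ∈ R.V := by
  have key : ∀ S : Finset (Fin (m + 3)), S.piecewise (fun _ => s 0) s ∈ R.V := by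
    intro S
    induction S using Finset.induction_on with
    | empty => simpa using hs
    | insert j S _ ih =>
      rw [Finset.piecewise_insert]
      have := update_mem_V ih j 0
      have h0 : S.piecewise (fun _ => s 0) s 0 = s 0 := by
        by_cases h : (0 : Fin (m + 3)) ∈ S <;> simp [h]
      rwa [h0] at this
  simpa using key Finset.univ

theorem exists_mem_V (R : RelRep (blurAlg m)) : ∃ s, s ∈ R.V := by
  by_contra! h
  obtain ⟨a, -⟩ := colSet_nonempty (m := m)
  have h1 : R.f (single a) = R.f ⊥ := by
    refine Set.ext fun x => ?_
    exact absurd x.2 (h x.1)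
  have h2 : a ∈ els (⊥ : blurAlg m) := by
    rw [← R.embedding.injective h1]
    exact Set.mem_singleton a
  exact h2

/-- All atoms are realized inside cliques. -/
theorem exists_clique (hR : R.IsComplete) {k : ℕ} (hsq : R.IsSquare (m + 3 + k))
    (a : (atoms m).carrier) : ∃ s : Fin (m + 3 + k) → R.M, R.IsClique (Set.range s) ∧
      R.Sat (single a) (s ∘ Fin.castAdd k) := by
  let at' : (Fin (m + 3) → Fin (m + 3)) → (atoms m).carrier := fun f =>
    ⟨a.1.pull f, a.2.1.pull f, fun _ _ _ => a.2.2 _ _ _⟩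
  have key : ∀ f : Fin (m + 3) → Fin (m + 3), ∃ s : Fin (m + 3 + k) → R.M,
      R.IsClique (Set.range s) ∧ R.Sat (single (at' f)) (s ∘ Fin.castAdd k) := by
    -- A single point is a clique and the type of a constant tuple is the trivial atom. Each further
    -- move is a cylindrification whose witness squareness finds inside a clique.
    refine update_induction (f := fun _ => 0) ?_ ?_
    · obtain ⟨s, hs⟩ := exists_mem_V R
      have hc := const_mem_V hs
      refine ⟨fun _ => s 0, ?_, ?_⟩
      · intro t ht
        rwa [show t = fun _ => s 0 from funext fun i => by simpa [eq_comm] using ht i]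
      · obtain ⟨b, hb⟩ := exists_type hR hc
        suffices b = at' fun _ => 0 by rwa [this] at hb
        have hrel : ∀ i j, b.1.rel i j := fun i j => rel_of_eq hb rfl
        refine Subtype.ext (Str.ext ?_ ?_)
        · funext i j
          exact propext ⟨fun _ => a.2.1.equiv.refl _, fun _ => hrel i j⟩
        · funext e u v
          exact (b.2.1.deg _ _ _ fun h => h.2.2.2 (hrel _ _)).trans
            ((a.2.1.pull _).deg _ _ _ fun h => h.2.2.2 (a.2.1.equiv.refl _)).symm
    · rintro f i x ⟨s, hs, hf⟩
      obtain ⟨t, ht, -, h⟩ := hsq s hs (Fin.castAddEmb k) i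
        (single (at' (Function.update f i x))) (sat_of_mem hf
          ⟨_, rfl, Str.agreeOff_pull a.1 fun j hj => by simp [hj]⟩)
      exact ⟨t, ht, h⟩
  exact key id

/-- The embedding of dimensions that uses the spare dimension `j` for the last coordinate. -/
def spare {k : ℕ} (j : Fin k) : Fin (m + 3) ↪ Fin (m + 3 + k) where
  toFun := Function.update (Fin.castAdd k) (pt 2) (Fin.natAdd (m + 3) j)
  inj' := by
    have hne : ∀ i : Fin (m + 3), Fin.castAdd k i ≠ Fin.natAdd (m + 3) j := fun i h => by
      have := congrArg Fin.val h
      simp at this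
      omega
    intro x y hxy
    by_cases hx : x = pt 2 <;> by_cases hy : y = pt 2
    · rw [hx, hy]
    · subst hx
      rw [Function.update_self, Function.update_of_ne hy] at hxy
      exact absurd hxy.symm (hne _)
    · subst hy
      rw [Function.update_self, Function.update_of_ne hx] at hxy
      exact absurd hxy (hne _)
    · rw [Function.update_of_ne hx, Function.update_of_ne hy] at hxy
      exact Fin.castAdd_injective _ _ hxy

theorem spare_pt {k : ℕ} (j : Fin k) : spare (m := m) j (pt 2) = Fin.natAdd (m + 3) j :=
  Function.update_self _ _ _

theorem spare_of_ne {k : ℕ} (j : Fin k) {x : Fin (m + 3)} (h : x ≠ pt 2) :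
    spare j x = Fin.castAdd k x := Function.update_of_ne h _ _

/-- The apexes of tint `i` over a base of the full white colour. -/
def apexSet (i : Fin 5) : Set (atoms m).carrier :=
  colSet 0 1 {w Set.univ} ∩ colSet 0 2 {g i} ∩ colSet 1 2 {yel}

/-- Only non-red colours are involved, so even the coarsest blur, at level 0, respects this set. -/
theorem apexSet_mem (i : Fin 5) : apexSet i ∈ (blurSub m).carrier := by
  have key : ∀ (j k : Fin 3) (c : Col), (∀ d, Col.blur 0 d = Col.blur 0 c → d = c) →
      Inv 0 (colSet (m := m) j k {c}) := by
    rintro j k c hc a b hab ⟨h1, h2⟩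
    have h2 : a.1.col ev (pt j) (pt k) = c := h2
    refine ⟨?_, hc _ ?_⟩
    · rwa [← Str.rel_of_blur_eq hab]
    · rw [← Str.col_of_blur_eq hab, h2]
  have key' : ∀ {c : Col}, ¬ IsRed c → ∀ d, Col.blur 0 d = Col.blur 0 c → d = c := by
    intro c hc d hd
    rcases Col.blur_eq_iff hd with h | ⟨-, h | ⟨l, k, -, h⟩⟩
    · exact h
    · exact absurd (h ▸ trivial) hc
    · exact absurd (h ▸ trivial) hc
  exact ⟨0, fun a b hab ⟨⟨h1, h2⟩, h3⟩ => ⟨⟨key _ _ _ (key' id) a b hab h1,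
    key _ _ _ (key' id) a b hab h2⟩, key _ _ _ (key' id) a b hab h3⟩⟩

/-- The element of the blurred algebra given by the apexes of tint `i`. -/
def apex (i : Fin 5) : blurAlg m := ⟨apexSet i, apexSet_mem i⟩

/-- Five apexes over the same base occur in a clique. -/
theorem exists_apexes (hR : R.IsComplete) {k : ℕ} (hk : 4 ≤ k) (hsq : R.IsSquare (m + 3 + k)) :
    ∃ s : Fin (m + 3 + k) → R.M, R.IsClique (Set.range s) ∧
      R.Sat (apex 0) (s ∘ Fin.castAdd k) ∧
      ∀ j : Fin 4, R.Sat (apex j.succ) (s ∘ spare (Fin.castLE hk j)) := by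
  have key : ∀ S : Finset (Fin 4), ∃ s : Fin (m + 3 + k) → R.M, R.IsClique (Set.range s) ∧
      R.Sat (apex 0) (s ∘ Fin.castAdd k) ∧
      ∀ j ∈ S, R.Sat (apex j.succ) (s ∘ spare (Fin.castLE hk j)) := by
    intro S
    induction S using Finset.induction_on with
    | empty =>
      obtain ⟨a, ha⟩ := colSet_nonempty (m := m)
      obtain ⟨b, hb, -⟩ := exists_apex 0 ha
      obtain ⟨s, hs, h⟩ := exists_clique hR hsq b
      exact ⟨s, hs, sat_of_mem h hb, by simp⟩
    | insert j S hj ih =>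
      obtain ⟨s, hs, h0, hS⟩ := ih
      obtain ⟨a, ha⟩ := exists_type hR (Sat.mem_V h0)
      obtain ⟨b, hb⟩ := exists_type hR (s := s ∘ spare (Fin.castLE hk j))
        (hs _ fun i => Set.mem_range_self _)
      have hab : (atoms m).T (pt 2) b a := T_of_agree hb ha fun i hi => by
        simp [spare_of_ne _ hi]
      have ha' : a ∈ apexSet 0 := mem_of_sat ha h0
      have hb' : b ∈ colSet 0 1 {w Set.univ} :=
        (mem_colSet_iff (by decide) (by decide) hab _).2 ha'.1.1
      -- Only the spare coordinate of `j` changes, so the base and the apexes already found survive.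
      obtain ⟨t, ht, hts, h⟩ := hsq s hs (spare (Fin.castLE hk j)) (pt 2) (apex j.succ)
        (sat_of_mem hb (exists_apex j.succ hb'))
      rw [spare_pt] at hts
      refine ⟨t, ht, ?_, ?_⟩
      · suffices t ∘ Fin.castAdd k = s ∘ Fin.castAdd k by rwa [this]
        funext i
        refine hts _ fun h' => ?_
        have := congrArg Fin.val h'
        simp at this
        omega
      · intro j' hj'
        rcases Finset.mem_insert.1 hj' with rfl | hj'
        · exact h
        · suffices t ∘ spare (Fin.castLE hk j') = s ∘ spare (Fin.castLE hk j') by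
            rw [this]; exact hS j' hj'
          have hne : j' ≠ j := fun h' => hj (h' ▸ hj')
          funext i
          refine hts _ fun h' => ?_
          by_cases hi : i = pt 2
          · subst hi
            rw [spare_pt] at h'
            exact hne (Fin.castLE_injective hk (Fin.natAdd_injective _ _ h'))
          · rw [spare_of_ne _ hi] at h'
            have := congrArg Fin.val h'
            simp at this
            omega
  obtain ⟨s, h1, h2, h3⟩ := key Finset.univ
  exact ⟨s, h1, h2, fun j => h3 j (Finset.mem_univ j)⟩

end RelRep

/-- The blurred algebra has no complete `(m + 3 + k)`-square relativized representation. -/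
theorem not_isComplete_of_isSquare {k : ℕ} (hk : 4 ≤ k) (R : RelRep (blurAlg m))
    (hR : R.IsComplete) : ¬ R.IsSquare (m + 3 + k) := by
  intro hsq
  obtain ⟨s, hs, h0, hj⟩ := exists_apexes hR hk hsq
  -- All tuples of the clique lie in the unit, so completeness types every one of them by an atom.
  have hty : ∀ t : Fin (m + 3) → Set.range s, ∃ a, R.Sat (single a) (fun i => (t i).1) := fun t =>
    exists_type hR (hs _ fun i => (t i).2)
  choose ty hty using hty
  have hT : Typing ty := ⟨fun i t t' h => T_of_agree (hty t) (hty t') fun j hj => by rw [h j hj],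
    fun t i j h => rel_of_eq (hty t) (by rw [h])⟩
  let p : Fin (m + 3 + k) → Set.range s := fun i => ⟨s i, i, rfl⟩
  have key : ∀ (l : Fin (m + 3) → Fin (m + 3 + k)) (i : Fin 5), (∀ j, j ≠ pt 2 → l j = Fin.castAdd k j) →
      R.Sat (apex i) (s ∘ l) → ty (tup (fun j => p (Fin.castAdd k (ev j))) (p (Fin.castAdd k (pt 0)))
        (p (Fin.castAdd k (pt 1))) (p (l (pt 2)))) ∈ colSet 0 2 {g i} ∩ colSet 1 2 {yel} := by
    intro l i hl h
    have h1 := hty (p ∘ l)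
    have h2 : ty (p ∘ l) ∈ apexSet i := mem_of_sat h1 h
    have h3 := tup_self (p ∘ l)
    simp only [Function.comp_def, hl _ (ev_ne_pt _ 2), hl _ (pt_ne (show (0 : Fin 3) ≠ 2 by decide)),
      hl _ (pt_ne (show (1 : Fin 3) ≠ 2 by decide))] at h3
    rw [h3]
    exact ⟨h2.1.2, h2.2⟩
  refine hT.false_of_apexes (fun j => p (Fin.castAdd k (ev j))) (p (Fin.castAdd k (pt 0)))
    (p (Fin.castAdd k (pt 1))) (Fin.cases (p (Fin.castAdd k (pt 2)))
    fun j => p (spare (m := m) (Fin.castLE hk j) (pt 2))) fun i => ?_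
  induction i using Fin.cases with
  | zero => exact key _ 0 (fun _ _ => rfl) h0
  | succ j => exact key _ j.succ (fun _ h => spare_of_ne _ h) (hj j)

end Rainbow

/-! ### Sahlqvist equations pass to the complex algebra -/

namespace CylTerm

variable {n : ℕ} {F : AtomStr.{u} n}

/-- The term `t` holds at the point `x` of an atom structure under a valuation. -/
def Holds (V : ℕ → Set F.carrier) (t : CylTerm n) (x : F.carrier) : Prop :=
  x ∈ (show Set F.carrier from eval F.complexAlg V t)

variable {V V' : ℕ → Set F.carrier} {x : F.carrier} {s t : CylTerm n}

theorem holds_var {p : ℕ} : Holds V (var p) x ↔ x ∈ V p := Iff.rfl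

theorem holds_neg : Holds V (neg t) x ↔ ¬ Holds V t x := Iff.rfl

theorem holds_and : Holds V (and s t) x ↔ Holds V s x ∧ Holds V t x := Iff.rfl

theorem holds_or : Holds V (or s t) x ↔ Holds V s x ∨ Holds V t x := Iff.rfl

theorem holds_cyl {i : Fin n} : Holds V (cyl i t) x ↔ ∃ y, Holds V t y ∧ F.T i x y := Iff.rfl

theorem holds_box {i : Fin n} : Holds V (box i t) x ↔ ∀ y, F.T i x y → Holds V t y := by
  rw [box, holds_neg, holds_cyl]
  push Not
  exact ⟨fun h y hy => by_contra fun h' => h y h' hy, fun h y hy hT => hy (h y hT)⟩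

theorem holds_mono (h : ∀ p, V p ⊆ V' p) (t : CylTerm n) :
    (HasPolarity true t → ∀ x, Holds V t x → Holds V' t x) ∧
      (HasPolarity false t → ∀ x, Holds V' t x → Holds V t x) := by
  induction t with
  | var p => exact ⟨fun _ x hx => h p hx, fun hp => absurd hp (by simp [HasPolarity])⟩
  | bot => exact ⟨fun _ _ hx => hx, fun _ _ hx => hx⟩
  | top => exact ⟨fun _ _ hx => hx, fun _ _ hx => hx⟩
  | diag i j => exact ⟨fun _ _ hx => hx, fun _ _ hx => hx⟩
  | neg t ih => exact ⟨fun hp x hx h' => hx (ih.2 hp x h'), fun hp x hx h' => hx (ih.1 hp x h')⟩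
  | and s t ihs iht =>
    exact ⟨fun hp x hx => ⟨ihs.1 hp.1 x hx.1, iht.1 hp.2 x hx.2⟩,
      fun hp x hx => ⟨ihs.2 hp.1 x hx.1, iht.2 hp.2 x hx.2⟩⟩
  | or s t ihs iht =>
    exact ⟨fun hp x hx => hx.imp (ihs.1 hp.1 x) (iht.1 hp.2 x),
      fun hp x hx => hx.imp (ihs.2 hp.1 x) (iht.2 hp.2 x)⟩
  | cyl i t ih =>
    exact ⟨fun hp x ⟨y, hy, hT⟩ => ⟨y, ih.1 hp y hy, hT⟩,
      fun hp x ⟨y, hy, hT⟩ => ⟨y, ih.2 hp y hy, hT⟩⟩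

theorem holds_congr (t : CylTerm n) (h : ∀ p ∈ vars t, V p = V' p) (x : F.carrier) :
    Holds V t x ↔ Holds V' t x := by
  induction t generalizing x with
  | var p => rw [holds_var, holds_var, h p rfl]
  | bot => exact Iff.rfl
  | top => exact Iff.rfl
  | diag i j => exact Iff.rfl
  | neg t ih => exact not_congr (ih h x)
  | and s t ihs iht =>
    exact and_congr (ihs (fun p hp => h p (Or.inl hp)) x) (iht (fun p hp => h p (Or.inr hp)) x)
  | or s t ihs iht =>
    exact or_congr (ihs (fun p hp => h p (Or.inl hp)) x) (iht (fun p hp => h p (Or.inr hp)) x)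
  | cyl i t ih => exact exists_congr fun y => and_congr_left fun _ => ih h y

variable {S : F.complexAlg.Sub} (hT : ∀ i x y, F.T i x y → F.T i y x)

include hT in
open Classical in
/-- There is a least valuation making a boxed atom true on a given set. -/
theorem IsBoxedAtom.exists_valuation (ht : IsBoxedAtom t) (Y : Set F.carrier)
    (hY : Y ∈ S.carrier) (h : ∀ y ∈ Y, Holds V t y) :
    ∃ V' : ℕ → Set F.carrier, (∀ p, V' p ∈ S.carrier) ∧ (∀ p, V' p ⊆ V p) ∧
      ∀ V'' : ℕ → Set F.carrier, (∀ p, V' p ⊆ V'' p) → ∀ y ∈ Y, Holds V'' t y := by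
  induction ht generalizing Y with
  | var p =>
    refine ⟨fun q => if q = p then Y else ∅, fun q => ?_, fun q => ?_, fun V'' h' y hy => ?_⟩
    · dsimp only
      split_ifs
      exacts [hY, S.bot_mem']
    · dsimp only
      split_ifs with hq
      · subst hq; exact h
      · exact Set.empty_subset _
    · have := h' p
      simp only [↓reduceIte] at this
      exact this hy
  | box i _ ih =>
    -- By symmetry of `T i`, the points accessible from `Y` form `c_i Y`, which is still in `S`.
    obtain ⟨V', h1, h2, h3⟩ := ih (F.complexAlg.cyl i Y) (S.cyl_mem i Y hY) (by
      rintro z ⟨y, hy, hzy⟩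
      exact holds_box.1 (h y hy) z (hT _ _ _ hzy))
    refine ⟨V', h1, h2, fun V'' h' y hy => holds_box.2 fun z hz => ?_⟩
    exact h3 V'' h' z ⟨y, hy, hT _ _ _ hz⟩

include hT in
-- Boxed atoms need only a least valuation generated from a singleton, and meets take unions of
-- such. The upper bound `V` is there for the negative parts, which survive shrinking of the
-- valuation.
theorem IsSahlqvistAntecedent.exists_valuation (hS : ∀ a, ({a} : Set F.carrier) ∈ S.carrier)
    (hs : IsSahlqvistAntecedent s) (h : Holds V s x) :
    ∃ V' : ℕ → Set F.carrier, (∀ p, V' p ∈ S.carrier) ∧ (∀ p, V' p ⊆ V p) ∧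
      ∀ V'' : ℕ → Set F.carrier, (∀ p, V' p ⊆ V'' p) → (∀ p, V'' p ⊆ V p) → Holds V'' s x := by
  induction hs generalizing x with
  | top => exact ⟨fun _ => ∅, fun _ => S.bot_mem', fun _ => Set.empty_subset _, fun _ _ _ => trivial⟩
  | bot => exact absurd h id
  | boxed ht =>
    obtain ⟨V', h1, h2, h3⟩ := ht.exists_valuation hT {x} (hS x) (by rintro _ rfl; exact h)
    exact ⟨V', h1, h2, fun V'' h' _ => h3 V'' h' x rfl⟩
  | negative ht =>
    exact ⟨fun _ => ∅, fun _ => S.bot_mem', fun _ => Set.empty_subset _,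
      fun V'' _ h' => (holds_mono h' _).2 ht x h⟩
  | and _ _ ihs iht =>
    obtain ⟨V₁, h1, h2, h3⟩ := ihs h.1
    obtain ⟨V₂, k1, k2, k3⟩ := iht h.2
    exact ⟨fun p => V₁ p ∪ V₂ p, fun p => S.supClosed' (h1 p) (k1 p),
      fun p => Set.union_subset (h2 p) (k2 p), fun V'' h' h'' =>
        ⟨h3 V'' (fun p => Set.subset_union_left.trans (h' p)) h'',
          k3 V'' (fun p => Set.subset_union_right.trans (h' p)) h''⟩⟩
  | or _ _ ihs iht =>
    rcases h with h | h
    · obtain ⟨V', h1, h2, h3⟩ := ihs h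
      exact ⟨V', h1, h2, fun V'' h' h'' => Or.inl (h3 V'' h' h'')⟩
    · obtain ⟨V', h1, h2, h3⟩ := iht h
      exact ⟨V', h1, h2, fun V'' h' h'' => Or.inr (h3 V'' h' h'')⟩
  | cyl i _ ih =>
    obtain ⟨y, hy, hxy⟩ := h
    obtain ⟨V', h1, h2, h3⟩ := ih hy
    exact ⟨V', h1, h2, fun V'' h' h'' => ⟨y, h3 V'' h' h'', hxy⟩⟩

include hT in
open Classical in
/-- A Sahlqvist term that can be refuted can be refuted in any subalgebra with all singletons. -/
theorem IsSahlqvist.exists_valuation (hS : ∀ a, ({a} : Set F.carrier) ∈ S.carrier)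
    (ht : IsSahlqvist t) (h : ¬ Holds V t x) :
    ∃ V' : ℕ → Set F.carrier, (∀ p, V' p ∈ S.carrier) ∧ ¬ Holds V' t x := by
  induction ht generalizing x with
  | imp hs ht =>
    rw [holds_or, not_or, holds_neg, not_not] at h
    obtain ⟨V', h1, h2, h3⟩ := hs.exists_valuation hT hS h.1
    refine ⟨V', h1, ?_⟩
    rw [holds_or, not_or, holds_neg, not_not]
    exact ⟨h3 V' (fun _ => subset_rfl) h2, fun h' => h.2 ((holds_mono h2 _).1 ht x h')⟩
  | box i _ ih =>
    rw [holds_box] at h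
    push Not at h
    obtain ⟨y, hxy, hy⟩ := h
    obtain ⟨V', h1, h2⟩ := ih hy
    exact ⟨V', h1, fun h' => h2 (holds_box.1 h' y hxy)⟩
  | and _ _ ihs iht =>
    rw [holds_and, not_and_or] at h
    rcases h with h | h
    · obtain ⟨V', h1, h2⟩ := ihs h
      exact ⟨V', h1, fun h' => h2 h'.1⟩
    · obtain ⟨V', h1, h2⟩ := iht h
      exact ⟨V', h1, fun h' => h2 h'.2⟩
  | @or s t _ _ hd ihs iht =>
    rw [holds_or, not_or] at h
    obtain ⟨V₁, h1, h2⟩ := ihs h.1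
    obtain ⟨V₂, k1, k2⟩ := iht h.2
    -- The disjuncts share no variables, so their refuting valuations can be glued.
    refine ⟨fun p => if p ∈ vars s then V₁ p else V₂ p, fun p => ?_, ?_⟩
    · dsimp only
      split_ifs
      exacts [h1 p, k1 p]
    · rw [holds_or, not_or, holds_congr s (V' := V₁) fun p hp => if_pos hp,
        holds_congr t (V' := V₂) fun p hp => if_neg fun hp' => Set.disjoint_left.1 hd hp' hp]
      exact ⟨h2, k2⟩

theorem eval_sub {A : CylAlg.{u} n} (S : A.Sub) (v : ℕ → S.toAlg) (t : CylTerm n) :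
    (eval S.toAlg v t).1 = eval A (fun p => (v p).1) t := by
  induction t with
  | var p => rfl
  | bot => rfl
  | top => rfl
  | diag i j => rfl
  | neg t ih => exact congrArg (·ᶜ) ih
  | and s t ihs iht => exact congrArg₂ (· ⊓ ·) ihs iht
  | or s t ihs iht => exact congrArg₂ (· ⊔ ·) ihs iht
  | cyl i t ih => exact congrArg (A.cyl i) ih

include hT in
/-- Sahlqvist equations are preserved from a subalgebra with all singletons to the complex
algebra. -/
theorem IsSahlqvist.validIn (hS : ∀ a, ({a} : Set F.carrier) ∈ S.carrier)
    (ht : IsSahlqvist t) (h : t.ValidIn S.toAlg) : t.ValidIn F.complexAlg := by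
  intro V
  by_contra hV
  obtain ⟨x, hx⟩ : ∃ x, ¬ Holds V t x := by
    by_contra! hx
    exact hV (Set.eq_univ_of_forall hx)
  obtain ⟨V', h1, h2⟩ := ht.exists_valuation hT hS hx
  have h3 := (eval_sub S (fun p => ⟨V' p, h1 p⟩) t).symm.trans (congrArg Subtype.val (h _))
  apply h2
  change x ∈ (show Set F.carrier from eval F.complexAlg V' t)
  rw [h3]
  trivial

end CylTerm

/-! ### Atom structures of algebras of sets with all singletons -/

namespace AtomStr

variable {n : ℕ} {F G H : AtomStr.{u} n}

theorem Isomorphic.symm (h : F.Isomorphic G) : G.Isomorphic F := by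
  obtain ⟨e, h1, h2⟩ := h
  exact ⟨e.symm, fun i a b => by simp [h1], fun i j a => by simp [h2]⟩

theorem Isomorphic.trans (h : F.Isomorphic G) (h' : G.Isomorphic H) : F.Isomorphic H := by
  obtain ⟨e, h1, h2⟩ := h
  obtain ⟨e', h1', h2'⟩ := h'
  exact ⟨e.trans e', fun i a b => by simp [h1, h1'], fun i j a => by simp [h2, h2']⟩

theorem Isomorphic.exists_isEmbedding (h : F.Isomorphic G) :
    ∃ f : F.complexAlg → G.complexAlg, CylAlg.IsEmbedding f := by
  obtain ⟨e, h1, h2⟩ := h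
  refine ⟨fun X => {b : G.carrier | e.symm b ∈ (show Set F.carrier from X)}, ?_, ?_, ?_, ?_, ?_⟩
  · intro X Y hXY
    refine Set.ext fun a => ?_
    have := Set.ext_iff.1 hXY (e a)
    simpa using this
  · exact fun _ _ => rfl
  · exact fun _ => rfl
  · intro i X
    refine Set.ext fun b => ?_
    constructor
    · rintro ⟨c, hc, hT⟩
      refine ⟨e c, ?_, ?_⟩
      · change e.symm (e c) ∈ (show Set F.carrier from X)
        rwa [e.symm_apply_apply]
      · rw [h1, e.apply_symm_apply] at hT
        exact hT
    · rintro ⟨c, hc, hT⟩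
      exact ⟨e.symm c, hc, by rw [h1, e.apply_symm_apply, e.apply_symm_apply]; exact hT⟩
  · intro i j
    refine Set.ext fun b => ?_
    change F.E i j (e.symm b) ↔ G.E i j b
    rw [h2, e.apply_symm_apply]

end AtomStr

namespace CylAlg

variable {n : ℕ} {A B : CylAlg.{u} n} {F : AtomStr.{u} n}

theorem InSNr.of_isEmbedding {k : ℕ} (h : InSNr n k B) {f : A → B} (hf : IsEmbedding f) :
    InSNr n k A := by
  obtain ⟨C, hC, g, hg⟩ := h
  exact ⟨C, hC, g ∘ f, hg.comp hf⟩

theorem Sub.isEmbedding_val (S : A.Sub) : IsEmbedding (A := S.toAlg) (B := A) Subtype.val :=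
  ⟨Subtype.val_injective, fun _ _ => rfl, fun _ => rfl, fun _ _ => rfl, fun _ _ => rfl⟩

theorem isEmbedding_id (A : CylAlg.{u} n) : IsEmbedding (A := A) (B := A) id :=
  ⟨Function.injective_id, fun _ _ => rfl, fun _ => rfl, fun _ _ => rfl, fun _ _ => rfl⟩

section Singletons

variable {f : A → F.complexAlg} (hf : IsEmbedding f) {at' : F.carrier → A}
  (hat : ∀ a, f (at' a) = ({a} : Set F.carrier))
include hf hat

theorem IsEmbedding.singleton_le_iff (a : F.carrier) (x : A) :
    at' a ≤ x ↔ a ∈ (show Set F.carrier from f x) := by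
  rw [← hf.le_iff, hat]
  exact Set.singleton_subset_iff

theorem IsEmbedding.singleton_ne_bot (a : F.carrier) : at' a ≠ ⊥ := by
  intro h
  have h1 := hat a
  rw [h, hf.map_bot] at h1
  exact Set.singleton_ne_empty a h1.symm

theorem IsEmbedding.exists_singleton_le {x : A} (hx : x ≠ ⊥) : ∃ a, at' a ≤ x := by
  by_contra! h
  apply hx
  apply hf.injective
  rw [hf.map_bot]
  exact Set.eq_empty_of_forall_notMem fun a ha => h a ((hf.singleton_le_iff hat a x).2 ha)

theorem IsEmbedding.isAtom_singleton (a : F.carrier) : IsAtom (at' a) := by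
  refine ⟨hf.singleton_ne_bot hat a, fun y hy => ?_⟩
  by_contra h
  obtain ⟨b, hb⟩ := hf.exists_singleton_le hat h
  have h1 := (hf.singleton_le_iff hat b _).1 (hb.trans hy.le)
  rw [hat] at h1
  obtain rfl : b = a := h1
  exact hy.not_ge hb

theorem IsEmbedding.isAtomic : IsAtomic A := by
  refine ⟨fun x => ?_⟩
  by_cases hx : x = ⊥
  · exact Or.inl hx
  · obtain ⟨a, ha⟩ := hf.exists_singleton_le hat hx
    exact Or.inr ⟨_, hf.isAtom_singleton hat a, ha⟩

/-- An algebra of sets of points with all singletons has the expected atom structure. -/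
theorem IsEmbedding.isomorphic_atomStr : F.Isomorphic A.atomStr := by
  refine ⟨Equiv.ofBijective (fun a => ⟨at' a, hf.isAtom_singleton hat a⟩) ⟨?_, ?_⟩, ?_, ?_⟩
  · intro a b hab
    have h1 : at' a = at' b := congrArg Subtype.val hab
    have h2 := hat a
    rw [h1, hat b] at h2
    exact (Set.singleton_injective h2).symm
  · rintro ⟨x, hx⟩
    obtain ⟨a, ha⟩ := hf.exists_singleton_le hat hx.1
    exact ⟨a, Subtype.ext ((hx.le_iff.1 ha).resolve_left (hf.singleton_ne_bot hat a))⟩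
  · intro i a b
    change _ ↔ at' a ≤ A.cyl i (at' b)
    rw [hf.singleton_le_iff hat, hf.map_cyl, hat]
    constructor
    · exact fun h => ⟨b, rfl, h⟩
    · rintro ⟨c, rfl, h⟩
      exact h
  · intro i j a
    change _ ↔ at' a ≤ A.diag i j
    rw [hf.singleton_le_iff hat, hf.map_diag]
    rfl

end Singletons

end CylAlg

/-! ### Comparison of the blurred and the complex algebra -/

namespace Rainbow

variable {m : ℕ}

theorem blurAlg_isAtomic (m : ℕ) : IsAtomic (blurAlg m) :=
  (blurSub m).isEmbedding_val.isAtomic (at' := single) fun _ => rfl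

theorem atoms_isomorphic_blurAlg (m : ℕ) : (atoms m).Isomorphic (blurAlg m).atomStr :=
  (blurSub m).isEmbedding_val.isomorphic_atomStr (at' := single) fun _ => rfl

theorem complexAlg_isAtomic (m : ℕ) : IsAtomic (atoms m).complexAlg :=
  (CylAlg.isEmbedding_id (atoms m).complexAlg).isAtomic
    (at' := fun a => ({a} : Set (atoms m).carrier)) fun _ => rfl

theorem atoms_isomorphic_complexAlg (m : ℕ) :
    (atoms m).Isomorphic (atoms m).complexAlg.atomStr :=
  (CylAlg.isEmbedding_id (atoms m).complexAlg).isomorphic_atomStr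
    (at' := fun a => ({a} : Set (atoms m).carrier)) fun _ => rfl

theorem blurSub_isDense (m : ℕ) : (blurSub m).IsDense := by
  intro X hX
  obtain ⟨a, ha⟩ := (CylAlg.isEmbedding_id (atoms m).complexAlg).exists_singleton_le
    (at' := fun a => ({a} : Set (atoms m).carrier)) (fun _ => rfl) hX
  exact ⟨_, singleton_mem_blurSub a, Set.singleton_ne_empty a, ha⟩

theorem isCompletionOf_blurAlg (m : ℕ) : IsCompletionOf (atoms m).complexAlg (blurAlg m) := by
  refine ⟨complexAlg_atoms_isCA m, fun X => ?_, blurSub m, id, CylAlg.isEmbedding_id _,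
    Function.surjective_id, blurSub_isDense m⟩
  let X' : Set (Set (atoms m).carrier) := X
  exact ⟨⋃₀ X', fun x hx => Set.subset_sUnion_of_mem (S := X') hx,
    fun y hy => Set.sUnion_subset (S := X') fun x hx => hy hx⟩

theorem complexAlg_atomStr_blurAlg_not_inSNr {k : ℕ} (hk : 4 ≤ k) :
    ¬ CylAlg.InSNr (m + 3) k (blurAlg m).atomStr.complexAlg := by
  obtain ⟨f, hf⟩ := (atoms_isomorphic_blurAlg m).exists_isEmbedding
  exact fun h => not_inSNr hk (h.of_isEmbedding hf)

theorem validIn_complexAlg {t : CylTerm (m + 3)} (ht : t.IsSahlqvist)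
    (h : t.ValidIn (blurAlg m)) : t.ValidIn (atoms m).complexAlg :=
  ht.validIn (fun _ _ _ => Str.AgreeOff.symm) singleton_mem_blurSub h

/-- Every Sahlqvist equation of `blurAlg m` holds in the complex algebra, so no set of them
separates the two. -/
theorem not_sahlqvistAxiomatizable {K : CylAlg.{0} (m + 3) → Prop} (h : K (blurAlg m))
    (h' : ¬ K (atoms m).complexAlg) : ¬ SahlqvistAxiomatizable K := by
  rintro ⟨Γ, hΓ, hK⟩
  exact h' ((hK _ (complexAlg_atoms_isCA m)).2 fun t ht =>
    validIn_complexAlg (hΓ t ht) ((hK _ (blurAlg_isCA m)).1 h t ht))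

end Rainbow

open Rainbow in
theorem mainTheorem3 (n : ℕ) (hn : 3 ≤ n) :
    (∃ A B : CylAlg.{0} n, A.IsCA ∧ B.IsCA ∧ IsAtomic A ∧ IsAtomic B ∧
      A.atomStr.Isomorphic B.atomStr ∧
      CylAlg.InRCA n A ∧ ¬ CylAlg.InRCA n B ∧ ¬ CylAlg.InSNr n 4 B) ∧
    ((∀ k : ℕ, 4 ≤ k →
        ¬ ClosedUnderCompletions (CylAlg.InSNr.{0} n k) ∧
        ¬ AtomCanonical (CylAlg.InSNr.{0} n k)) ∧
      ¬ AtomCanonical (CylAlg.InRCA.{0} n)) ∧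
    (∃ B : CylAlg.{0} n, B.IsCA ∧ ¬ CylAlg.InRCA n B ∧ ¬ CylAlg.InSNr n 4 B ∧
      ∃ S : B.Sub, S.IsDense ∧ CylAlg.InRCA n S.toAlg) ∧
    ((∀ k : ℕ, 4 ≤ k → ¬ SahlqvistAxiomatizable (CylAlg.InSNr.{0} n k)) ∧
      ¬ SahlqvistAxiomatizable (CylAlg.InRCA.{0} n)) ∧
    (∃ A : CylAlg.{0} n, A.IsCA ∧ IsAtomic A ∧ CylAlg.InRCA n A ∧
      ∀ k : ℕ, 4 ≤ k → ¬ ∃ R : RelRep A, R.IsComplete ∧ R.IsSquare (n + k)) := by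
  obtain ⟨m, rfl⟩ : ∃ m, n = m + 3 := ⟨n - 3, by omega⟩
  have hSNr : ∀ k, 4 ≤ k → ¬ CylAlg.InSNr (m + 3) k (atoms m).complexAlg := fun k hk => not_inSNr hk
  -- Representable algebras are neatly embeddable for every number of spare dimensions; four already
  -- fail here.
  have hRCA : ¬ CylAlg.InRCA (m + 3) (atoms m).complexAlg := fun h =>
    hSNr 4 le_rfl (h.inSNr (by omega) 4)
  have hblur : ∀ k, CylAlg.InSNr (m + 3) k (blurAlg m) := (blurAlg_inRCA m).inSNr (by omega)
  refine ⟨⟨blurAlg m, (atoms m).complexAlg, blurAlg_isCA m, complexAlg_atoms_isCA m,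
      blurAlg_isAtomic m, complexAlg_isAtomic m,
      (atoms_isomorphic_blurAlg m).symm.trans (atoms_isomorphic_complexAlg m),
      blurAlg_inRCA m, hRCA, hSNr 4 le_rfl⟩,
    ⟨fun k hk => ⟨fun h => hSNr k hk (h _ _ (hblur k) (isCompletionOf_blurAlg m)),
      fun h => complexAlg_atomStr_blurAlg_not_inSNr hk (h _ (hblur k) (blurAlg_isAtomic m))⟩,
      fun h => complexAlg_atomStr_blurAlg_not_inSNr le_rfl
        ((h _ (blurAlg_inRCA m) (blurAlg_isAtomic m)).inSNr (by omega) 4)⟩,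
    ⟨(atoms m).complexAlg, complexAlg_atoms_isCA m, hRCA, hSNr 4 le_rfl, blurSub m,
      blurSub_isDense m, blurAlg_inRCA m⟩,
    ⟨fun k hk => not_sahlqvistAxiomatizable (hblur k) (hSNr k hk),
      not_sahlqvistAxiomatizable (blurAlg_inRCA m) hRCA⟩,
    ⟨blurAlg m, blurAlg_isCA m, blurAlg_isAtomic m, blurAlg_inRCA m,
      fun k hk ⟨R, hR, hsq⟩ => not_isComplete_of_isSquare hk R hR hsq⟩⟩
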